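/- **Conventions.** Let $G$ be a finite group and let $j: U\to X$ be a morphism of Noetherian schemes, where $U=\mathrm{Spec}(F)$ is affine. A coherent $\mathcal O_XG$-module is a coherent $\mathcal O_X$-module on which $G$ acts by $\mathcal O_X$-linear homomorphisms. It is called *locally projective* if its stalk at every $x\in X$ is a projective $\mathcal O_{X,x}G$-module. * Let $\mathcal H$ be the category of all coherent $\mathcal O_XG$-modules $\mathcal V$ such that $j^*\mathcal V=0$ and such that there is an exact sequence $0\to\mathcal P\to\mathcal Q\to\mathcal V\to0$ with $\mathcal P,\mathcal Q$ locally projective coherent $\mathcal O_XG$-modules. Let $K_0T(\mathcal O_XG)=K_0(\mathcal H)$ be its Grothendieck group: generators $[\mathcal V]$ for $\mathcal V$ in $\mathcal H$, and relations $[\mathcal V]=[\mathcal V']+[\mathcal V'']$ for all short exact sequences $0\to\mathcal V'\to\mathcal V\to\mathcal V''\to0$ in $\mathcal H$. * Let $K_0(j_1^*)$ be the abelian group generated by the triples $[\mathcal P,\alpha,\mathcal Q]$, where $\mathcal P,\mathcal Q$ are locally projective coherent $\mathcal O_XG$-modules and $\alpha:j^*\mathcal P\to j^*\mathcal Q$ is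 an $\mathcal O_UG$-isomorphism. The relations are $[\mathcal P,\alpha,\mathcal Q]=[\mathcal P',\alpha',\mathcal Q']+[\mathcal P'',\alpha'',\mathcal Q'']$ for all pairs of short exact sequences $0\to\mathcal P'\to\mathcal P\to\mathcal P''\to0$ and $0\to\mathcal Q'\to\mathcal Q\to\mathcal Q''\to0$ whose images under $j^*$ are compatible with $\alpha',\alpha,\alpha''$, and $[\mathcal P,\beta\alpha,\mathcal R]=[\mathcal P,\alpha,\mathcal Q]+[\mathcal Q,\beta,\mathcal R]$ for all composable $\alpha,\beta$. **Proposition 1.7.** In each of the following cases, $j^*(f)$ is an isomorphism for every exact sequence $0\to\mathcal P\xrightarrow{f}\mathcal Q\to\mathcal V\to0$ with $\mathcal V$ in $\mathcal H$ and $\mathcal P,\mathcal Q$ locally projective coherent; there is exactly one homomorphism $$\psi:K_0T(\mathcal O_XG)\to K_0(j_1^*)$$ such that $\psi([\mathcal V])=[\mathcal P,j^*(f),\mathcal Q]$ for every such sequence; and $\psi$ is bijective. (a) $X=\mathrm{Spec}(A)$ is affine with $A$ Noetherian, $F=A_S$ is the localization of $A$ at a multiplicative set $S$ of non-zero-divisors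 of $A$, and $j:\mathrm{Spec}(F)\to\mathrm{Spec}(A)$ is the canonical morphism. (b) $X$ is Noetherian, $j:U=\mathrm{Spec}(F)\to X$ is an open immersion, and there is a quasi-coherent ideal sheaf $\mathcal I$ on $X$ with zero locus $X\setminus j(U)$ which is locally generated by a non-zero-divisor. (c) $X$ is a Dedekind scheme (i.e., Noetherian, regular, irreducible and $\dim(X)=1$), $F$ is the function field of $X$, and $j:\mathrm{Spec}(F)\to X$ is the canonical morphism. -/

import Mathlib

open CategoryTheory CategoryTheory.Limits AlgebraicGeometry

universe w u v

noncomputable section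

/-! ### Grothendieck groups of exact subcategories -/

section GrothendieckGroup

variable {C : Type w} [Category.{v} C] [Abelian C]

/-- The relations `[S₂] - [S₁] - [S₃]`, one for each short exact sequence `0 → S₁ → S₂ → S₃ → 0`
of the ambient abelian category whose three terms lie in the full subcategory `H`. -/
def k0Relations (H : ObjectProperty C) : Set (FreeAbelianGroup H.FullSubcategory) :=
  {x | ∃ (S : ShortComplex C) (_ : S.ShortExact) (h₁ : H S.X₁) (h₂ : H S.X₂) (h₃ : H S.X₃),
    x = FreeAbelianGroup.of ⟨S.X₂, h₂⟩ - FreeAbelianGroup.of ⟨S.X₁, h₁⟩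
      - FreeAbelianGroup.of ⟨S.X₃, h₃⟩}

/-- The Grothendieck group `K₀(H)` of a full subcategory `H` of an abelian category. -/
abbrev K0 (H : ObjectProperty C) : Type _ :=
  FreeAbelianGroup H.FullSubcategory ⧸ AddSubgroup.closure (k0Relations H)

/-- The class `[V]` in `K₀(H)` of an object `V` of `H`. -/
def K0.mk (H : ObjectProperty C) (V : H.FullSubcategory) : K0 H :=
  QuotientAddGroup.mk (FreeAbelianGroup.of V)

end GrothendieckGroup

/-! ### Modules over the group ring `𝒪_X G` -/

section Equivariant

variable {X : Scheme.{u}} {G : Type v} [Group G]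

/-- The `𝒪_{X,x}`-module structure on the stalk at `x` of an `𝒪_X`-module. -/
instance stalkModule (M : X.Modules) (x : X) :
    Module (X.presheaf.stalk x) (M.presheaf.stalk x) :=
  PresheafOfModules.instModuleCarrierStalkCommRingCatCarrierAbPresheafOpensCarrier
    (R := X.presheaf) M.val x

theorem stalk_germ_smul (M : X.Modules) (x : X) (U : X.Opens) (hx : x ∈ U)
    (r : Γ(X, U)) (m : Γ(M, U)) :
    M.presheaf.germ U x hx (r • m) =
      X.presheaf.germ U x hx r • M.presheaf.germ U x hx m :=
  PresheafOfModules.germ_smul (R := X.presheaf) M.val x U hx r m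

theorem stalk_map_germ {M N : X.Modules} (φ : M ⟶ N) (x : X) (U : X.Opens) (hx : x ∈ U)
    (m : Γ(M, U)) :
    (TopCat.Presheaf.stalkFunctor Ab x).map φ.mapPresheaf (M.presheaf.germ U x hx m) =
      N.presheaf.germ U x hx (φ.app U m) :=
  TopCat.Presheaf.stalkFunctor_map_germ_apply U x hx φ.mapPresheaf m

/-- The `𝒪_{X,x}`-linear map on stalks induced by a morphism of `𝒪_X`-modules. -/
def stalkLinearMap {M N : X.Modules} (φ : M ⟶ N) (x : X) :
    M.presheaf.stalk x →ₗ[X.presheaf.stalk x] N.presheaf.stalk x where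
  toFun := (TopCat.Presheaf.stalkFunctor Ab x).map φ.mapPresheaf
  map_add' := map_add _
  map_smul' r m := by
    obtain ⟨U, hU, r, rfl⟩ := X.presheaf.exists_germ_eq r
    obtain ⟨V, hV, m, rfl⟩ := M.presheaf.exists_germ_eq m
    have hW : x ∈ U ⊓ V := ⟨hU, hV⟩
    have hr := X.presheaf.germ_res_apply (homOfLE (inf_le_left : U ⊓ V ≤ U)) x hW r
    have hm := M.presheaf.germ_res_apply (homOfLE (inf_le_right : U ⊓ V ≤ V)) x hW m
    rw [← hr, ← hm]
    generalize X.presheaf.map (homOfLE (inf_le_left : U ⊓ V ≤ U)).op r = r'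
    generalize M.presheaf.map (homOfLE (inf_le_right : U ⊓ V ≤ V)).op m = m'
    have h₁ := stalk_germ_smul M x (U ⊓ V) hW r' m'
    have h₂ := stalk_map_germ φ x (U ⊓ V) hW (r' • m')
    rw [Scheme.Modules.Hom.app_smul] at h₂
    have h₃ := stalk_germ_smul N x (U ⊓ V) hW r' (φ.app (U ⊓ V) m')
    have h₄ := stalk_map_germ φ x (U ⊓ V) hW m'
    refine (congrArg _ h₁.symm).trans (h₂.trans (h₃.trans ?_))
    exact congrArg (fun t ↦ X.presheaf.germ (U ⊓ V) x hW r' • t) h₄.symm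

/-- The representation of `G` over `𝒪_{X,x}` on the stalk at `x` of an `𝒪_X G`-module, that is,
of an `𝒪_X`-module on which `G` acts by `𝒪_X`-linear homomorphisms. -/
def stalkRep (P : Action X.Modules G) (x : X) :
    Representation (X.presheaf.stalk x) G (P.V.presheaf.stalk x) where
  toFun g := stalkLinearMap (P.ρ g) x
  map_one' := by
    ext m
    obtain ⟨U, hU, m, rfl⟩ := P.V.presheaf.exists_germ_eq m
    simp only [map_one]
    exact stalk_map_germ (𝟙 P.V) x U hU m
  map_mul' g h := by
    ext m
    obtain ⟨U, hU, m, rfl⟩ := P.V.presheaf.exists_germ_eq m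
    simp only [map_mul]
    refine (stalk_map_germ (P.ρ h ≫ P.ρ g) x U hU m).trans ?_
    refine ((congrArg ((TopCat.Presheaf.stalkFunctor Ab x).map (P.ρ g).mapPresheaf)
      (stalk_map_germ (P.ρ h) x U hU m)).trans (stalk_map_germ (P.ρ g) x U hU _)).symm

/-- On a (locally) Noetherian scheme: a coherent `𝒪_X G`-module is an `𝒪_X G`-module whose
underlying `𝒪_X`-module is coherent, i.e. quasi-coherent with finitely generated sections over
every affine open subset. -/
def IsCoherentOG (P : Action X.Modules G) : Prop :=
  SheafOfModules.IsQuasicoherent P.V ∧ ∀ U : X.affineOpens, Module.Finite Γ(X, U) Γ(P.V, U)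

/-- Locally projective coherent `𝒪_X G`-modules: every stalk `P_x` is a projective module over
the group ring `𝒪_{X,x} G`. -/
def locProj (X : Scheme.{u}) (G : Type v) [Group G] : ObjectProperty (Action X.Modules G) :=
  fun P ↦ IsCoherentOG P ∧
    ∀ x : X, Module.Projective (MonoidAlgebra (X.presheaf.stalk x) G) (stalkRep P x).asModule

end Equivariant

/-! ### The relative Grothendieck group, torsion modules, and the map `ψ` -/

section Relative

variable {X U : Scheme.{u}} (G : Type v) [Group G] (j : U ⟶ X)

/-- The inverse image functor `j^*` from `𝒪_X G`-modules to `𝒪_U G`-modules. -/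
abbrev pullbackOG : Action X.Modules G ⥤ Action U.Modules G :=
  (Scheme.Modules.pullback j).mapAction G

/-- Triples `(P, α, Q)` of locally projective coherent `𝒪_X G`-modules `P`, `Q` and an
`𝒪_U G`-isomorphism `α : j^* P ≅ j^* Q`. -/
structure RelTriple where
  P : Action X.Modules G
  Q : Action X.Modules G
  hP : locProj X G P
  hQ : locProj X G Q
  α : (pullbackOG G j).obj P ≅ (pullbackOG G j).obj Q

/-- The relations of the Grothendieck group of triples: `[T] = [T'] + [T'']` for every short exact
sequence `0 → T' → T → T'' → 0` of triples. Such a sequence consists of short exact sequences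
`0 → P' → P → P'' → 0` and `0 → Q' → Q → Q'' → 0` of `𝒪_X G`-modules which, after applying `j^*`,
commute with the isomorphisms `α'`, `α`, `α''`. -/
def relExactRelations : Set (FreeAbelianGroup (RelTriple G j)) :=
  {x | ∃ (T' T T'' : RelTriple G j)
    (a : T'.P ⟶ T.P) (b : T.P ⟶ T''.P) (c : T'.Q ⟶ T.Q) (d : T.Q ⟶ T''.Q)
    (hab : a ≫ b = 0) (hcd : c ≫ d = 0),
    (ShortComplex.mk a b hab).ShortExact ∧ (ShortComplex.mk c d hcd).ShortExact ∧
    (pullbackOG G j).map a ≫ T.α.hom = T'.α.hom ≫ (pullbackOG G j).map c ∧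
    (pullbackOG G j).map b ≫ T''.α.hom = T.α.hom ≫ (pullbackOG G j).map d ∧
    x = FreeAbelianGroup.of T - FreeAbelianGroup.of T' - FreeAbelianGroup.of T''}

/-- The relations `[P, βα, R] = [P, α, Q] + [Q, β, R]`. -/
def relCompRelations : Set (FreeAbelianGroup (RelTriple G j)) :=
  {x | ∃ (P Q R : Action X.Modules G) (hP : locProj X G P) (hQ : locProj X G Q)
    (hR : locProj X G R) (α : (pullbackOG G j).obj P ≅ (pullbackOG G j).obj Q)
    (β : (pullbackOG G j).obj Q ≅ (pullbackOG G j).obj R),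
    x = FreeAbelianGroup.of ⟨P, R, hP, hR, α ≪≫ β⟩ - FreeAbelianGroup.of ⟨P, Q, hP, hQ, α⟩
      - FreeAbelianGroup.of ⟨Q, R, hQ, hR, β⟩}

/-- The relative Grothendieck group `K₀(j₁^*)`: the Grothendieck group of all triples modulo the
composition relations. -/
abbrev RelK0 : Type _ :=
  FreeAbelianGroup (RelTriple G j) ⧸
    AddSubgroup.closure (relExactRelations G j ∪ relCompRelations G j)

/-- The class `[P, α, Q]` in `K₀(j₁^*)`. -/
def RelK0.mk (T : RelTriple G j) : RelK0 G j :=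
  QuotientAddGroup.mk (FreeAbelianGroup.of T)

/-- The category `ℋ` of coherent `𝒪_X G`-modules `V` with `j^* V = 0` which admit a resolution
`0 → P → Q → V → 0` by locally projective coherent `𝒪_X G`-modules. -/
def torsionModules : ObjectProperty (Action X.Modules G) :=
  fun V ↦ IsCoherentOG V ∧ IsZero ((pullbackOG G j).obj V) ∧
    ∃ (P Q : Action X.Modules G) (f : P ⟶ Q) (g : Q ⟶ V) (w : f ≫ g = 0),
      locProj X G P ∧ locProj X G Q ∧ (ShortComplex.mk f g w).ShortExact

/-- The group `K₀T(𝒪_X G) = K₀(ℋ)`. -/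
abbrev K0T : Type _ := K0 (torsionModules G j)

/-- `ψ : K₀T(𝒪_X G) → K₀(j₁^*)` maps the class `[V]` to `[P, j^*(f), Q]` for every `V` in `ℋ` and
every resolution `0 → P → Q → V → 0` with first map `f` by locally projective coherent
`𝒪_X G`-modules (in particular, `j^*(f)` is an isomorphism for each of them). -/
def IsPsi (ψ : K0T G j →+ RelK0 G j) : Prop :=
  ∀ (V : (torsionModules G j).FullSubcategory) (P Q : Action X.Modules G)
    (hP : locProj X G P) (hQ : locProj X G Q) (f : P ⟶ Q) (g : Q ⟶ V.obj) (w : f ≫ g = 0),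
    (ShortComplex.mk f g w).ShortExact →
    ∃ α : (pullbackOG G j).obj P ≅ (pullbackOG G j).obj Q,
      α.hom = (pullbackOG G j).map f ∧
      ψ (K0.mk (torsionModules G j) V) = RelK0.mk G j ⟨P, Q, hP, hQ, α⟩

/-- The map `ψ` is well defined (there is exactly one homomorphism with its defining property),
and it is bijective. -/
def PsiBijective : Prop :=
  (∃! ψ : K0T G j →+ RelK0 G j, IsPsi G j ψ) ∧
    ∀ ψ : K0T G j →+ RelK0 G j, IsPsi G j ψ → Function.Bijective ψ

end Relative

/-! ### Geometric hypotheses -/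

/-- A quasi-coherent ideal sheaf which is locally generated by a single non-zero-divisor. -/
def IsLocallyGeneratedByNonZeroDivisor {X : Scheme.{u}} (I : X.IdealSheafData) : Prop :=
  ∀ x : X, ∃ V : X.affineOpens, x ∈ V.1 ∧
    ∃ f ∈ nonZeroDivisors Γ(X, V), I.ideal V = Ideal.span {f}

/-- A Dedekind scheme: Noetherian, irreducible, regular and of dimension one. -/
class IsDedekindScheme (X : Scheme.{u}) : Prop
    extends AlgebraicGeometry.IsNoetherian X, IrreducibleSpace X where
  regular : ∀ x : X, IsRegularLocalRing (X.presheaf.stalk x)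
  dim_eq_one : topologicalKrullDim X = 1

end

/-! All three cases share one feature: on a suitable affine open cover $V_i$ of $X$, the morphism
$j$ is a localization at a multiplicative set $S_i$ of non-zero-divisors. The section functors
identify $j^*$ with localization there, so $j^*$ is exact on quasi-coherent modules, and for a
resolution $0\to P\to Q\to V\to 0$ the map $j^*f$ is an isomorphism exactly when $j^*V=0$
(`TwistableCover.isIso_pullback_iff`). Locally projective modules have no $S_i$-torsion, so $P\to
j_*j^*P$ is mono. Hence $j^*$ is faithful on maps into such modules, and a map $f$ out of one with
$j^*f$ invertible is mono.

The second ingredient is clearing denominators globally. An isomorphism $\alpha:j^*P\to j^*Q$ has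
denominators $s_i\in S_i$ on the charts. If an invertible ideal $D$ is contained in every $(s_i)$
and becomes trivial over $U$, then $\alpha$ is defined on the locally projective module $DP$. Thus
$\alpha=j^*(h)\,j^*(i)^{-1}$ with $i:R\to P$ and $h:R\to Q$ (`TwistableCover.exists_refinement`).
One $D$ can serve a whole short exact sequence of triples, because twisting is exact on locally
projective modules (`shortExact_twistOG`).

The rest is formal. The class of a resolution does not depend on its choice, since two resolutions
are dominated by their fibre product over $V$, and kernels contribute identity triples, which are
zero. Additivity comes from the composition relation: a resolution of the middle term factors
through a lattice that resolves both ends (`resolutionClass_eq_add`). The inverse sends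
$[P,\alpha,Q]$ to $[\mathrm{coker}\,h]-[\mathrm{coker}\,i]$. Common refinements show that this is
well defined and respects composition, and the snake lemma shows that it respects exact sequences
(`psiBijective_of_twistableCover`).

It remains to produce $D$: a principal ideal in the affine case, a power of $\mathcal I$ for an open
immersion, and for a Dedekind scheme a product of the ideals $(s_i)$, each extended by the unit
ideal outside its chart. -/

noncomputable section

/-! ### Sections over affine opens and the localization criterion -/

section

variable {X : Scheme.{u}}

/-- The functor of sections over an open subset. -/
def sectionsOver (U : X.Opens) : X.Modules ⥤ Ab.{u} :=
  Scheme.Modules.toPresheaf X ⋙ (evaluation _ _).obj (.op U)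

instance (U : X.Opens) : PreservesLimits (sectionsOver U) where
  preservesLimitsOfShape {J} _ :=
    have : PreservesLimitsOfShape J ((evaluation X.Opensᵒᵖ Ab.{u}).obj (.op U)) :=
      evaluation_preservesLimitsOfShape _
    @comp_preservesLimitsOfShape _ _ _ _ _ _ _ _ (Scheme.Modules.toPresheaf X)
      ((evaluation _ _).obj (.op U)) _ this

instance (U : X.Opens) : (sectionsOver U).Additive where

theorem sections_exact {S : ShortComplex X.Modules} (hS : S.Exact) [Mono S.f] (U : X.Opens) :
    Function.Exact (S.f.app U) (S.g.app U) := by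
  have := hS.map_of_mono_of_preservesKernel (sectionsOver U) inferInstance inferInstance
  rw [ShortComplex.ab_exact_iff_function_exact] at this
  exact this

theorem app_injective {M N : X.Modules} (f : M ⟶ N) [Mono f] (U : X.Opens) :
    Function.Injective (f.app U) := by
  have : Mono ((sectionsOver U).map f) := inferInstance
  exact (AddCommGrpCat.mono_iff_injective _).mp this

open Opposite in
-- Ensures that a section over `V`, acting on the restriction of a module to the spectrum, acts
-- through its ordinary restriction in `X`.
theorem fromSpec_appIso_inv {V : X.Opens} (hV : IsAffineOpen V) (U : (Spec Γ(X, V)).Opens)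
    (hU : hV.fromSpec ''ᵁ U ≤ V) :
    (Scheme.ΓSpecIso Γ(X, V)).inv ≫ (Spec Γ(X, V)).presheaf.map U.leTop.op ≫
      (hV.fromSpec.appIso U).inv = X.presheaf.map (homOfLE hU).op := by
  rw [← Category.assoc, Iso.comp_inv_eq, Scheme.Hom.appIso_hom,
    Scheme.Hom.naturality_assoc, hV.fromSpec_app_self]
  simp only [Category.assoc, ← Functor.map_comp]
  rfl

theorem restrict_fromSpec_smul (M : X.Modules) {V : X.Opens} (hV : IsAffineOpen V)
    (U : (Spec Γ(X, V)).Opens) (hU : hV.fromSpec ''ᵁ U ≤ V) (a : Γ(X, V))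
    (m : Γ(M.restrict hV.fromSpec, U)) :
    (M.restrictAppIso hV.fromSpec U).hom (a • m) =
      X.presheaf.map (homOfLE hU).op a • (M.restrictAppIso hV.fromSpec U).hom m := by
  rw [Scheme.Modules.smul_Spec_def]
  refine (Scheme.Modules.smul_restrictAppIso_hom_apply hV.fromSpec M U _ m).trans ?_
  rw [← fromSpec_appIso_inv hV U hU]
  rfl

/-- `M` is localizing on `V` if sections over basic open subsets of `V` are obtained from sections
over `V` by localization. -/
structure IsLocalizingOn (M : X.Modules) (V : X.Opens) : Prop where
  exists_lift (a : Γ(X, V)) (s : Γ(M, X.basicOpen a)) : ∃ (n : ℕ) (t : Γ(M, V)),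
    M.presheaf.map (homOfLE (X.basicOpen_le a)).op t =
      X.presheaf.map (homOfLE (X.basicOpen_le a)).op (a ^ n) • s
  exists_pow_smul_eq_zero (a : Γ(X, V)) (t : Γ(M, V)) :
    M.presheaf.map (homOfLE (X.basicOpen_le a)).op t = 0 → ∃ n : ℕ, a ^ n • t = 0

theorem restrict_smul_of_image_eq (M : X.Modules) {V : X.Opens} (hV : IsAffineOpen V)
    (U : (Spec Γ(X, V)).Opens) {W : X.Opens} (hUW : hV.fromSpec ''ᵁ U = W) (hW : W ≤ V)
    (a : Γ(X, V)) (m : Γ(M.restrict hV.fromSpec, U)) :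
    M.presheaf.map (homOfLE hUW.ge).op ((M.restrictAppIso hV.fromSpec U).hom (a • m)) =
      X.presheaf.map (homOfLE hW).op a •
        M.presheaf.map (homOfLE hUW.ge).op ((M.restrictAppIso hV.fromSpec U).hom m) := by
  subst hUW
  have := restrict_fromSpec_smul M hV U hW a m
  have e : homOfLE (le_refl (hV.fromSpec ''ᵁ U)) = 𝟙 _ := rfl
  simp only [e, op_id, M.presheaf.map_id]
  exact this

/-- Sections of the restriction to `Spec Γ(X, V)` as sections of the module. -/
def restrictSections (M : X.Modules) {V : X.Opens} (hV : IsAffineOpen V)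
    (U : (Spec Γ(X, V)).Opens) {W : X.Opens} (hUW : hV.fromSpec ''ᵁ U = W) :
    Γ(M.restrict hV.fromSpec, U) ≃+ Γ(M, W) :=
  ((M.restrictAppIso hV.fromSpec U) ≪≫
    M.presheaf.mapIso (eqToIso hUW.symm).op).addCommGroupIsoToAddEquiv

theorem restrictSections_smul (M : X.Modules) {V : X.Opens} (hV : IsAffineOpen V)
    (U : (Spec Γ(X, V)).Opens) {W : X.Opens} (hUW : hV.fromSpec ''ᵁ U = W) (hW : W ≤ V)
    (a : Γ(X, V)) (m : Γ(M.restrict hV.fromSpec, U)) :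
    restrictSections M hV U hUW (a • m) =
      X.presheaf.map (homOfLE hW).op a • restrictSections M hV U hUW m :=
  restrict_smul_of_image_eq M hV U hUW hW a m

theorem restrictSections_map (M : X.Modules) {V : X.Opens} (hV : IsAffineOpen V)
    {U U' : (Spec Γ(X, V)).Opens} {W W' : X.Opens} (hUW : hV.fromSpec ''ᵁ U = W)
    (hUW' : hV.fromSpec ''ᵁ U' = W') (h : U' ≤ U) (h' : W' ≤ W)
    (m : Γ(M.restrict hV.fromSpec, U)) :
    restrictSections M hV U' hUW' ((M.restrict hV.fromSpec).presheaf.map (homOfLE h).op m) =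
      M.presheaf.map (homOfLE h').op (restrictSections M hV U hUW m) := by
  subst hUW hUW'
  have e : homOfLE (le_refl (hV.fromSpec ''ᵁ U)) = 𝟙 _ := rfl
  simp only [restrictSections, Iso.addCommGroupIsoToAddEquiv, Iso.trans_hom, Functor.mapIso_hom,
    Iso.op_hom, eqToIso_refl, Iso.refl_hom, op_id, M.presheaf.map_id, Category.comp_id,
    AddMonoidHom.toAddEquiv_apply]
  rfl

theorem image_top_fromSpec {V : X.Opens} (hV : IsAffineOpen V) : hV.fromSpec ''ᵁ ⊤ = V := by
  rw [Scheme.Hom.image_top_eq_opensRange, hV.opensRange_fromSpec]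

/-- The maps `restrictSections` respect scalars and restriction, so the two conditions are the
surjectivity and kernel axioms of a localized module at the powers of `a`. The remaining axiom,
invertibility of `a` on its basic open subset, always holds. -/
theorem isLocalizingOn_iff (M : X.Modules) {V : X.Opens} (hV : IsAffineOpen V) :
    IsLocalizingOn M V ↔ IsLocalizing (modulesSpecToSheaf.obj (M.restrict hV.fromSpec)) := by
  let N := M.restrict hV.fromSpec
  let eT := restrictSections M hV ⊤ (image_top_fromSpec hV)
  let eD (a : Γ(X, V)) : _ ≃+ Γ(M, X.basicOpen a) := restrictSections M hV _
      (hV.fromSpec_image_basicOpen a)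
  have hres (a : Γ(X, V)) (t : Γ(N, ⊤)) :
      eD a (N.presheaf.map (homOfLE le_top).op t) =
        M.presheaf.map (homOfLE (X.basicOpen_le a)).op (eT t) :=
    restrictSections_map M hV _ _ _ _ t
  have hT (a : Γ(X, V)) (t : Γ(N, ⊤)) : eT (a • t) = a • eT t := by
    refine (restrictSections_smul M hV ⊤ _ le_rfl a t).trans ?_
    have e : homOfLE (le_refl V) = 𝟙 _ := rfl
    rw [e, op_id, X.presheaf.map_id]
    rfl
  let D (a : Γ(X, V)) : (Spec Γ(X, V)).Opens := PrimeSpectrum.basicOpen a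
  have hD (a b : Γ(X, V)) (t : Γ(N, D a)) :
      eD a (b • t) = X.presheaf.map (homOfLE (X.basicOpen_le a)).op b • eD a t :=
    restrictSections_smul M hV _ _ _ b t
  constructor
  · intro h a
    refine IsLocalizedModule.Away.mk_of_addCommGroup ?_ ?_ ?_
    · exact Scheme.Modules.isUnit_algebraMap_end_of_le_basicOpen a le_rfl
    · intro s
      obtain ⟨n, t, ht⟩ := h.exists_lift a (eD a s)
      refine ⟨n, eT.symm t, (eD a).injective ?_⟩
      refine (hD a (a ^ n) s).trans (ht.symm.trans ?_)
      refine Eq.trans ?_ (hres a (eT.symm t)).symm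
      rw [AddEquiv.apply_symm_apply]
    · intro t ht
      obtain ⟨n, hn⟩ := h.exists_pow_smul_eq_zero a (eT t)
        ((hres a t).symm.trans ((congrArg (eD a) ht).trans (map_zero _)))
      exact ⟨n, eT.injective ((hT _ t).trans (hn.trans (map_zero _).symm))⟩
  · intro h
    refine ⟨fun a s ↦ ?_, fun a t ht ↦ ?_⟩
    · have := h a
      obtain ⟨⟨t, _, n, rfl⟩, hn⟩ := IsLocalizedModule.surj (.powers a)
        ((modulesSpecToSheaf.obj N).obj.map (PrimeSpectrum.basicOpen a).leTop.op).hom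
        ((eD a).symm s)
      refine ⟨n, eT t, ?_⟩
      refine (hres a t).symm.trans ((congrArg (eD a) hn.symm).trans ?_)
      refine (hD a (a ^ n) _).trans ?_
      rw [AddEquiv.apply_symm_apply]
    · have := h a
      have h0 : ((modulesSpecToSheaf.obj N).obj.map (PrimeSpectrum.basicOpen a).leTop.op).hom
          (eT.symm t) = 0 := by
        refine (eD a).injective (((hres a _).trans ?_).trans (map_zero (eD a)).symm)
        rw [AddEquiv.apply_symm_apply, ht]
      obtain ⟨⟨_, n, rfl⟩, hn⟩ := (IsLocalizedModule.eq_zero_iff (.powers a) _).mp h0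
      refine ⟨n, ?_⟩
      have := (hT (a ^ n) (eT.symm t)).symm.trans ((congrArg eT hn).trans (map_zero eT))
      rwa [AddEquiv.apply_symm_apply] at this

end

/-! ### Quasi-coherence as a local condition -/

section

variable {X : Scheme.{u}}

theorem isLocalizingOn_of_isQuasicoherent (M : X.Modules) (hM : M.IsQuasicoherent)
    {V : X.Opens} (hV : IsAffineOpen V) : IsLocalizingOn M V := by
  have : M.IsQuasicoherent := hM
  rw [isLocalizingOn_iff M hV, ← isIso_fromTildeΓ_iff_isLocalizing]
  have : (M.restrict hV.fromSpec).IsQuasicoherent :=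
    Scheme.Modules.isQuasicoherent_restrictFunctor _ M
  infer_instance

theorem isQuasicoherent_restrict_iff (M : X.Modules) {V : X.Opens} (hV : IsAffineOpen V) :
    (M.restrict hV.fromSpec).IsQuasicoherent ↔ IsLocalizingOn M V := by
  rw [isLocalizingOn_iff M hV, ← isIso_fromTildeΓ_iff_isLocalizing]
  exact isQuasicoherent_iff_isIso_fromTildeΓ _

/-- On each chart the module is the tilde of its global sections, which has a tautological
presentation: all elements as generators, all relations. This presentation is carried to the open
subscheme `V i` and then, by an equivalence, to the slice site over `V i`. -/
theorem isQuasicoherent_of_restrict (M : X.Modules) {ι : Type u} (V : ι → X.Opens)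
    (hV : ∀ i, IsAffineOpen (V i)) (hcov : ⨆ i, V i = ⊤)
    (h : ∀ i, (M.restrict (hV i).fromSpec).IsQuasicoherent) :
    M.IsQuasicoherent := by
  refine SheafOfModules.QuasicoherentData.isQuasicoherent (R := X.ringCatSheaf)
    { I := ι, X := V, coversTop := ?_, presentation := fun i ↦ ?_ }
  · rw [Opens.coversTop_iff]
    exact hcov
  · let N := M.restrict (hV i).fromSpec
    have : IsIso N.fromTildeΓ := (isQuasicoherent_iff_isIso_fromTildeΓ _).mp (h i)
    let p0 : SheafOfModules.Presentation (tilde ((modulesSpecToSheaf.obj N).presheaf.obj (.op ⊤)))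
        :=
      presentationTilde _ .univ (by simp) _ (Submodule.span_eq _)
    let p1 : SheafOfModules.Presentation N := @SheafOfModules.Presentation.ofIsIso _ _ _ _ _ _ _ _
        N.fromTildeΓ this p0
    let p2 : SheafOfModules.Presentation (N.restrict (hV i).isoSpec.hom) :=
      Scheme.Modules.presentationRestrict (hV i).isoSpec.hom p1
    let e : N.restrict (hV i).isoSpec.hom ≅ M.restrict (V i).ι :=
      (Scheme.Modules.restrictFunctorComp _ _).symm.app M ≪≫
        (Scheme.Modules.restrictFunctorCongr (by simp)).app M
    let p3 : SheafOfModules.Presentation (M.restrict (V i).ι) :=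

      @SheafOfModules.Presentation.ofIsIso _ _ _ _ _ _ _ _ e.hom e.isIso_hom p2
    let E := Scheme.Modules.overEquiv (V i)
    let F : SheafOfModules.{u} (V i).toScheme.ringCatSheaf ⥤
      SheafOfModules.{u} (X.ringCatSheaf.over (V i)) := E.inverse
    have : PreservesColimitsOfSize.{u, u} F :=
      E.symm.toAdjunction.leftAdjoint_preservesColimits
    let p4 := p3.map F
      (TopologicalSpace.Opens.sheafOfModulesEquivOverInverseUnit _ X.ringCatSheaf).symm
    let e' : E.inverse.obj (M.restrict (V i).ι) ≅
        (SheafOfModules.overFunctor X.ringCatSheaf (V i)).obj M :=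
      E.inverse.mapIso ((Scheme.Modules.overFunctorEquiv (V i)).app M).symm ≪≫
        (E.unitIso.app _).symm
    exact SheafOfModules.Presentation.ofIsIso e'.hom p4

/-- Naturality of the counit, invertible at both modules, identifies `f` with the tilde of its map
on global sections; a faithful functor reflects epimorphisms. -/
theorem app_surjective_top_of_epi {R : CommRingCat.{u}} {M N : (Spec R).Modules} (f : M ⟶ N)
    [Epi f] (hM : M.IsQuasicoherent) (hN : N.IsQuasicoherent) :
    Function.Surjective (f.app ⊤) := by
  have : IsIso M.fromTildeΓ := (isQuasicoherent_iff_isIso_fromTildeΓ _).mp hM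
  have : IsIso N.fromTildeΓ := (isQuasicoherent_iff_isIso_fromTildeΓ _).mp hN
  let g := moduleSpecΓFunctor.map f
  have hg : Epi ((tilde.functor R).map g) := by
    have h1 : (tilde.functor R).map g ≫ N.fromTildeΓ = M.fromTildeΓ ≫ f :=
      (tilde.adjunction (R := R)).counit.naturality f
    have h2 : Epi ((tilde.functor R).map g ≫ N.fromTildeΓ) := by
      rw [h1]
      have : Epi M.fromTildeΓ := inferInstance
      exact @epi_comp _ _ _ _ _ _ this _ _
    have h3 : (tilde.functor R).map g =
        ((tilde.functor R).map g ≫ N.fromTildeΓ) ≫ inv N.fromTildeΓ :=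
      (IsIso.eq_comp_inv N.fromTildeΓ).mpr rfl
    rw [h3]
    have : Epi (inv N.fromTildeΓ) := inferInstance
    exact @epi_comp _ _ _ _ _ _ h2 _ this
  have h4 : Epi g := (tilde.functor R).epi_of_epi_map hg
  exact (ModuleCat.epi_iff_surjective g).mp h4

theorem restrictSections_app {M N : X.Modules} (f : M ⟶ N) {V : X.Opens} (hV : IsAffineOpen V)
    (U : (Spec Γ(X, V)).Opens) {W : X.Opens} (hUW : hV.fromSpec ''ᵁ U = W)
    (m : Γ(M.restrict hV.fromSpec, U)) :
    restrictSections N hV U hUW (((Scheme.Modules.restrictFunctor hV.fromSpec).map f).app U m) =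
      f.app W (restrictSections M hV U hUW m) := by
  subst hUW
  simp only [restrictSections, Iso.addCommGroupIsoToAddEquiv, Iso.trans_hom, Functor.mapIso_hom,
    Iso.op_hom, eqToIso_refl, Iso.refl_hom, op_id, M.presheaf.map_id, N.presheaf.map_id,
    Category.comp_id, AddMonoidHom.toAddEquiv_apply]
  rfl

theorem app_surjective_of_epi {M N : X.Modules} (f : M ⟶ N) [Epi f]
    (hM : M.IsQuasicoherent) (hN : N.IsQuasicoherent)
    {V : X.Opens} (hV : IsAffineOpen V) : Function.Surjective (f.app V) := by
  have : M.IsQuasicoherent := hM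
  have : N.IsQuasicoherent := hN
  have := app_surjective_top_of_epi ((Scheme.Modules.restrictFunctor hV.fromSpec).map f)
    (Scheme.Modules.isQuasicoherent_restrictFunctor _ M)
    (Scheme.Modules.isQuasicoherent_restrictFunctor _ N)
  intro n
  obtain ⟨m, hm⟩ := this ((restrictSections N hV ⊤ (image_top_fromSpec hV)).symm n)
  refine ⟨restrictSections M hV ⊤ (image_top_fromSpec hV) m, ?_⟩
  rw [← restrictSections_app, hm, AddEquiv.apply_symm_apply]

theorem isQuasicoherent_of_isLocalizingOn (M : X.Modules) {ι : Type u} (V : ι → X.Opens)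
    (hV : ∀ i, IsAffineOpen (V i)) (hcov : ⨆ i, V i = ⊤) (h : ∀ i, IsLocalizingOn M (V i)) :
    M.IsQuasicoherent :=
  isQuasicoherent_of_restrict M V hV hcov
    fun i ↦ (isQuasicoherent_restrict_iff M (hV i)).mpr (h i)

theorem isQuasicoherent_iff_isLocalizingOn (M : X.Modules) :
    M.IsQuasicoherent ↔ ∀ V : X.affineOpens, IsLocalizingOn M V :=
  ⟨fun h V ↦ isLocalizingOn_of_isQuasicoherent M h V.2, fun h ↦
    isQuasicoherent_of_isLocalizingOn M (fun V : X.affineOpens ↦ V.1) (fun V ↦ V.2)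
      (by simpa using iSup_affineOpens_eq_top X) h⟩

end

/-! ### Quasi-coherence of kernels, cokernels and sums -/

section

variable {X : Scheme.{u}}

theorem app_map {M N : X.Modules} (f : M ⟶ N) {U W : X.Opens} (i : W ⟶ U)
    (m : Γ(M, U)) : f.app W (M.presheaf.map i.op m) = N.presheaf.map i.op (f.app U m) :=
  congr($(f.mapPresheaf.naturality i.op) m)

theorem isQuasicoherent_of_exact_of_mono {S : ShortComplex X.Modules} (hS : S.Exact) [Mono S.f]
    (h₂ : S.X₂.IsQuasicoherent) (h₃ : S.X₃.IsQuasicoherent) : S.X₁.IsQuasicoherent := by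
  rw [isQuasicoherent_iff_isLocalizingOn] at *
  intro V
  refine ⟨fun a s ↦ ?_, fun a t ht ↦ ?_⟩
  · obtain ⟨n, t, ht⟩ := (h₂ V).exists_lift a (S.f.app _ s)
    have hgf : S.g.app _ (S.f.app _ s) = 0 := (sections_exact hS _).apply_apply_eq_zero s
    -- The lift `t` maps to zero in `S.X₃` only over the basic open subset. A further power of `a`
    -- kills its image over all of `V` and so moves `t` into `S.X₁`.
    obtain ⟨k, hk⟩ := (h₃ V).exists_pow_smul_eq_zero a (S.g.app _ t) (by
      rw [← app_map, ht, Scheme.Modules.Hom.app_smul, hgf, smul_zero])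
    rw [← Scheme.Modules.Hom.app_smul] at hk
    obtain ⟨t', ht'⟩ := (sections_exact hS _ _).mp hk
    refine ⟨k + n, t', app_injective S.f _ ?_⟩
    rw [app_map, ht', Scheme.Modules.map_smul, ht, Scheme.Modules.Hom.app_smul, ← mul_smul,
      ← map_mul, pow_add]
  · obtain ⟨n, hn⟩ := (h₂ V).exists_pow_smul_eq_zero a (S.f.app _ t)
      (by rw [← app_map, ht, map_zero])
    refine ⟨n, app_injective S.f _ ?_⟩
    rw [Scheme.Modules.Hom.app_smul, hn, map_zero]

/-- The tilde functor preserves cokernels, and the invertible counits identify `f` with the tilde of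
a linear map. -/
theorem isQuasicoherent_cokernel_Spec {R : CommRingCat.{u}} {M N : (Spec R).Modules} (f : M ⟶ N)
    (hM : M.IsQuasicoherent) (hN : N.IsQuasicoherent) : (cokernel f).IsQuasicoherent := by
  have hM' : IsIso M.fromTildeΓ := (isQuasicoherent_iff_isIso_fromTildeΓ _).mp hM
  have hN' : IsIso N.fromTildeΓ := (isQuasicoherent_iff_isIso_fromTildeΓ _).mp hN
  rw [isQuasicoherent_iff_isIso_fromTildeΓ, isIso_fromTildeΓ_iff]
  let g := moduleSpecΓFunctor.map f
  have h1 : (tilde.functor R).map g ≫ N.fromTildeΓ = M.fromTildeΓ ≫ f :=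
    (tilde.adjunction (R := R)).counit.naturality f
  let iso : cokernel ((tilde.functor R).map g) ≅ cokernel f :=
    cokernel.mapIso _ _ (@asIso _ _ _ _ M.fromTildeΓ hM')
      (@asIso _ _ _ _ N.fromTildeΓ hN') h1
  exact ⟨cokernel g, ⟨PreservesCokernel.iso (tilde.functor R) g ≪≫ iso⟩⟩

theorem isQuasicoherent_of_iso {M N : X.Modules} (e : M ≅ N) (hM : M.IsQuasicoherent) :
    N.IsQuasicoherent :=
  (SheafOfModules.isQuasicoherent X.ringCatSheaf).prop_of_iso e hM

theorem isQuasicoherent_of_exact_of_epi {S : ShortComplex X.Modules} (hS : S.Exact) [Epi S.g]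
    (h₁ : S.X₁.IsQuasicoherent) (h₂ : S.X₂.IsQuasicoherent) : S.X₃.IsQuasicoherent := by
  refine isQuasicoherent_of_restrict _ (fun V : X.affineOpens ↦ V.1) (fun V ↦ V.2)
    (iSup_affineOpens_eq_top X) fun V ↦ ?_
  have e : cokernel S.f ≅ S.X₃ := (cokernelIsCokernel S.f).coconePointUniqueUpToIso hS.gIsCokernel
  have hV : IsAffineOpen V.1 := V.2
  let F := Scheme.Modules.restrictFunctor hV.fromSpec
  refine isQuasicoherent_of_iso (PreservesCokernel.iso F S.f).symm ?_ |>
    isQuasicoherent_of_iso (F.mapIso e)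
  have : S.X₁.IsQuasicoherent := h₁
  have : S.X₂.IsQuasicoherent := h₂
  exact isQuasicoherent_cokernel_Spec _ (Scheme.Modules.isQuasicoherent_restrictFunctor _ _)
    (Scheme.Modules.isQuasicoherent_restrictFunctor _ _)

theorem isQuasicoherent_biprod {M N : X.Modules} (hM : M.IsQuasicoherent)
    (hN : N.IsQuasicoherent) : (M ⊞ N).IsQuasicoherent := by
  rw [isQuasicoherent_iff_isLocalizingOn] at *
  intro V
  have h {U : X.Opens} (m : Γ(M ⊞ N, U)) :
      m = biprod.inl (X := M).app U ((biprod.fst : M ⊞ N ⟶ M).app U m) +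
        (biprod.inr : N ⟶ M ⊞ N).app U ((biprod.snd : M ⊞ N ⟶ N).app U m) := by
    have := congr(Scheme.Modules.Hom.app $(biprod.total (X := M) (Y := N)) U m)
    exact this.symm
  refine ⟨fun a s ↦ ?_, fun a t ht ↦ ?_⟩
  · obtain ⟨n₁, t₁, h₁⟩ := (hM V).exists_lift a ((biprod.fst : M ⊞ N ⟶ M).app _ s)
    obtain ⟨n₂, t₂, h₂⟩ := (hN V).exists_lift a ((biprod.snd : M ⊞ N ⟶ N).app _ s)
    refine ⟨n₁ + n₂, (biprod.inl : M ⟶ M ⊞ N).app _ (a ^ n₂ • t₁) +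
      (biprod.inr : N ⟶ M ⊞ N).app _ (a ^ n₁ • t₂), ?_⟩
    conv_rhs => rw [h s]
    rw [map_add, ← app_map, ← app_map, Scheme.Modules.map_smul,
      Scheme.Modules.map_smul, h₁, h₂, ← mul_smul, ← mul_smul, ← map_mul, ← map_mul, ← pow_add,
      ← pow_add, add_comm n₂, smul_add, Scheme.Modules.Hom.app_smul, Scheme.Modules.Hom.app_smul]
  · obtain ⟨n₁, h₁⟩ := (hM V).exists_pow_smul_eq_zero a ((biprod.fst : M ⊞ N ⟶ M).app _ t)
      (by rw [← app_map, ht, map_zero])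
    obtain ⟨n₂, h₂⟩ := (hN V).exists_pow_smul_eq_zero a ((biprod.snd : M ⊞ N ⟶ N).app _ t)
      (by rw [← app_map, ht, map_zero])
    refine ⟨n₁ + n₂, ?_⟩
    have e₁ : a ^ (n₁ + n₂) • (biprod.fst : M ⊞ N ⟶ M).app _ t = 0 := by
      rw [add_comm, pow_add, mul_smul, h₁, smul_zero]
    have e₂ : a ^ (n₁ + n₂) • (biprod.snd : M ⊞ N ⟶ N).app _ t = 0 := by
      rw [pow_add, mul_smul, h₂, smul_zero]
    rw [h (a ^ (n₁ + n₂) • t), Scheme.Modules.Hom.app_smul (biprod.fst : M ⊞ N ⟶ M),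
      Scheme.Modules.Hom.app_smul (biprod.snd : M ⊞ N ⟶ N), e₁, e₂, map_zero, map_zero, add_zero]

/-! ### Sections and exactness -/

theorem section_ext (M : X.Modules) {U : X.Opens} (m m' : Γ(M, U))
    (h : ∀ x ∈ U, ∃ (W : X.Opens) (i : W ≤ U), x ∈ W ∧
      M.presheaf.map (homOfLE i).op m = M.presheaf.map (homOfLE i).op m') : m = m' :=
  TopCat.Presheaf.IsSheaf.section_ext M.isSheaf fun x hx ↦ by
    obtain ⟨W, i, hxW, e⟩ := h x hx
    exact ⟨W, i, hxW, e⟩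

theorem mono_of_injective {M N : X.Modules} (f : M ⟶ N)
    (h : ∀ U (m : Γ(M, U)), f.app U m = 0 → m = 0) : Mono f := by
  refine Preadditive.mono_of_cancel_zero f fun {Z} g hg ↦ ?_
  ext U z
  exact h U _ congr(Scheme.Modules.Hom.app $hg U z)

theorem epi_of_locally_surjective {M N : X.Modules} (f : M ⟶ N)
    (h : ∀ (U : X.Opens) (n : Γ(N, U)), ∀ x ∈ U, ∃ (W : X.Opens) (i : W ≤ U), x ∈ W ∧
      ∃ m : Γ(M, W), f.app W m = N.presheaf.map (homOfLE i).op n) : Epi f := by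
  refine Preadditive.epi_of_cancel_zero f fun {Z} g hg ↦ ?_
  ext U n
  refine section_ext Z _ _ fun x hx ↦ ?_
  obtain ⟨W, i, hxW, m, hm⟩ := h U n x hx
  refine ⟨W, i, hxW, ?_⟩
  rw [← app_map, ← hm]
  exact congr(Scheme.Modules.Hom.app $hg W m).trans (map_zero _).symm

theorem shortExact_of_sections (S : ShortComplex X.Modules)
    (h₁ : ∀ U (m : Γ(S.X₁, U)), S.f.app U m = 0 → m = 0)
    (h₂ : ∀ U (m : Γ(S.X₂, U)), S.g.app U m = 0 → ∃ m', S.f.app U m' = m)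
    (h₃ : ∀ (U : X.Opens) (n : Γ(S.X₃, U)), ∀ x ∈ U, ∃ (W : X.Opens) (i : W ≤ U), x ∈ W ∧
      ∃ m : Γ(S.X₂, W), S.g.app W m = S.X₃.presheaf.map (homOfLE i).op n) : S.ShortExact where
  exact := by
    rw [ShortComplex.exact_iff_epi_kernel_lift]
    refine epi_of_locally_surjective _ fun U n x hx ↦ ⟨U, le_rfl, hx, ?_⟩
    obtain ⟨m', hm'⟩ := h₂ U ((kernel.ι S.g).app U n)
      congr(Scheme.Modules.Hom.app $(kernel.condition S.g) U n)
    refine ⟨m', app_injective (kernel.ι S.g) _ ?_⟩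
    refine (congr(Scheme.Modules.Hom.app $(kernel.lift_ι S.g S.f S.zero) U m').trans hm').trans ?_
    rw [app_map]
    have e : homOfLE (le_refl U) = 𝟙 _ := rfl
    rw [e, op_id, CategoryTheory.Functor.map_id]
    rfl
  mono_f := mono_of_injective _ h₁
  epi_g := epi_of_locally_surjective _ h₃

/-- No gluing of local lifts is needed: the composite of `f` with the cokernel of `g` vanishes
locally, hence vanishes, and a mono is the kernel of its cokernel. -/
theorem exists_lift_of_locally {M N Q : X.Modules} (f : M ⟶ N) (g : Q ⟶ N) [Mono g]
    (h : ∀ (U : X.Opens) (m : Γ(M, U)), ∀ x ∈ U, ∃ (W : X.Opens) (i : W ≤ U), x ∈ W ∧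
      ∃ q : Γ(Q, W), g.app W q = f.app W (M.presheaf.map (homOfLE i).op m)) :
    ∃ k : M ⟶ Q, k ≫ g = f := by
  have h0 : f ≫ cokernel.π g = 0 := by
    ext U m
    refine section_ext _ _ _ fun x hx ↦ ?_
    obtain ⟨W, i, hxW, q, hq⟩ := h U m x hx
    refine ⟨W, i, hxW, ?_⟩
    rw [← app_map, ← app_map]
    refine (congrArg ((cokernel.π g).app W) hq).symm.trans ?_
    exact congr(Scheme.Modules.Hom.app $(cokernel.condition g) W q)
  exact ⟨Abelian.monoLift g f h0, Abelian.monoLift_comp _ _ _⟩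

end

/-! ### Coherent modules, stalks, and local projectivity in exact sequences -/

section

variable {X : Scheme.{u}}

/-- The linear map on sections induced by a morphism of modules. -/
def sectionsLinearMap {M N : X.Modules} (f : M ⟶ N) (U : X.Opens) :
    Γ(M, U) →ₗ[Γ(X, U)] Γ(N, U) where
  toFun := f.app U
  map_add' := map_add _
  map_smul' := f.app_smul

/-- On a locally Noetherian scheme: coherent modules. -/
def IsCoherentModule (M : X.Modules) : Prop :=
  M.IsQuasicoherent ∧ ∀ U : X.affineOpens, Module.Finite Γ(X, U) Γ(M, U)

theorem finite_sections_of_mono [IsLocallyNoetherian X] {M N : X.Modules} (f : M ⟶ N) [Mono f]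
    (hN : ∀ U : X.affineOpens, Module.Finite Γ(X, U) Γ(N, U)) (U : X.affineOpens) :
    Module.Finite Γ(X, U) Γ(M, U) := by
  have := hN U
  have := IsLocallyNoetherian.component_noetherian U
  exact Module.Finite.of_injective (sectionsLinearMap f U.1) (app_injective f U.1)

theorem isCoherentModule_of_exact_of_mono [IsLocallyNoetherian X] {S : ShortComplex X.Modules}
    (hS : S.Exact) [Mono S.f] (h₂ : IsCoherentModule S.X₂) (h₃ : IsCoherentModule S.X₃) :
    IsCoherentModule S.X₁ :=
  ⟨isQuasicoherent_of_exact_of_mono hS h₂.1 h₃.1, finite_sections_of_mono S.f h₂.2⟩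

theorem isCoherentModule_of_exact_of_epi {S : ShortComplex X.Modules}
    (hS : S.Exact) [Epi S.g] (h₁ : IsCoherentModule S.X₁) (h₂ : IsCoherentModule S.X₂) :
    IsCoherentModule S.X₃ := by
  have h := isQuasicoherent_of_exact_of_epi hS h₁.1 h₂.1
  refine ⟨h, fun U ↦ ?_⟩
  have := h₂.2 U
  exact Module.Finite.of_surjective (sectionsLinearMap S.g U.1)
    (app_surjective_of_epi S.g h₂.1 h U.2)

theorem isCoherentModule_biprod [IsLocallyNoetherian X] {M N : X.Modules} (hM : IsCoherentModule M)
    (hN : IsCoherentModule N) : IsCoherentModule (M ⊞ N) := by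
  refine ⟨isQuasicoherent_biprod hM.1 hN.1, fun U ↦ ?_⟩
  have := hM.2 U
  have := hN.2 U
  have := IsLocallyNoetherian.component_noetherian U
  refine Module.Finite.of_injective ((sectionsLinearMap (biprod.fst : M ⊞ N ⟶ M) U.1).prod
    (sectionsLinearMap (biprod.snd : M ⊞ N ⟶ N) U.1)) ?_
  rw [← LinearMap.ker_eq_bot, LinearMap.ker_eq_bot']
  intro m hm
  have h₁ : (biprod.fst : M ⊞ N ⟶ M).app U.1 m = 0 := congrArg Prod.fst hm
  have h₂ : (biprod.snd : M ⊞ N ⟶ N).app U.1 m = 0 := congrArg Prod.snd hm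
  have := congr(Scheme.Modules.Hom.app $(biprod.total (X := M) (Y := N)) U.1 m)
  refine this.symm.trans ?_
  change (biprod.inl : M ⟶ M ⊞ N).app U.1 ((biprod.fst : M ⊞ N ⟶ M).app U.1 m) +
    (biprod.inr : N ⟶ M ⊞ N).app U.1 ((biprod.snd : M ⊞ N ⟶ N).app U.1 m) = 0
  rw [h₁, h₂, map_zero, map_zero, add_zero]

/-! ### Stalks -/

theorem germ_eq_zero (M : X.Modules) (x : X) (U : X.Opens) (hx : x ∈ U) (m : Γ(M, U))
    (h : M.presheaf.germ U x hx m = 0) :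
    ∃ (W : X.Opens) (i : W ≤ U), x ∈ W ∧ M.presheaf.map (homOfLE i).op m = 0 := by
  obtain ⟨W, hW, i, i', e⟩ := M.presheaf.germ_eq x hx hx m 0 (h.trans (map_zero _).symm)
  exact ⟨W, i.le, hW, e.trans (map_zero _)⟩

theorem germ_map (M : X.Modules) {x : X} {U W : X.Opens} (i : W ≤ U) (hx : x ∈ W) (m : Γ(M, U)) :
    M.presheaf.germ W x hx (M.presheaf.map (homOfLE i).op m) = M.presheaf.germ U x (i hx) m :=
  M.presheaf.germ_res_apply (homOfLE i) x hx m

theorem exists_germ_eq_of_affine (M : X.Modules) (x : X) (m : M.presheaf.stalk x) (V : X.Opens)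
    (hxV : x ∈ V) :
    ∃ (U : X.affineOpens) (hx : x ∈ U.1) (_ : U.1 ≤ V) (m' : Γ(M, U)),
      M.presheaf.germ U.1 x hx m' = m := by
  obtain ⟨W, hW, m, rfl⟩ := M.presheaf.exists_germ_eq m
  obtain ⟨_, ⟨U, hU, rfl⟩, hxU, hUW⟩ := X.isBasis_affineOpens.exists_subset_of_mem_open
    (show x ∈ ((W ⊓ V : X.Opens) : Set X) from ⟨hW, hxV⟩) (W ⊓ V).2
  have hU' : U ≤ (W ⊓ V : X.Opens) := hUW
  exact ⟨⟨_, hU⟩, hxU, hU'.trans inf_le_right,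
    M.presheaf.map (homOfLE (hU'.trans inf_le_left)).op m, germ_map M (hU'.trans inf_le_left) _ _⟩

theorem stalkLinearMap_germ {M N : X.Modules} (f : M ⟶ N) (x : X) (U : X.Opens) (hx : x ∈ U)
    (m : Γ(M, U)) : stalkLinearMap f x (M.presheaf.germ U x hx m) =
      N.presheaf.germ U x hx (f.app U m) :=
  stalk_map_germ f x U hx m

theorem stalkLinearMap_injective {M N : X.Modules} (f : M ⟶ N) [Mono f] (x : X) :
    Function.Injective (stalkLinearMap f x) := by
  rw [← LinearMap.ker_eq_bot, LinearMap.ker_eq_bot']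
  intro m hm
  obtain ⟨U, hx, m, rfl⟩ := M.presheaf.exists_germ_eq m
  rw [stalkLinearMap_germ] at hm
  obtain ⟨W, i, hxW, h⟩ := germ_eq_zero N x U hx _ hm
  rw [← app_map] at h
  rw [← germ_map M i hxW, app_injective f W (h.trans (map_zero _).symm), map_zero]

theorem stalkLinearMap_exact {S : ShortComplex X.Modules} (hS : S.Exact) [Mono S.f] (x : X) :
    Function.Exact (stalkLinearMap S.f x) (stalkLinearMap S.g x) := by
  intro m
  constructor
  · intro hm
    obtain ⟨U, hx, m, rfl⟩ := S.X₂.presheaf.exists_germ_eq m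
    rw [stalkLinearMap_germ] at hm
    obtain ⟨W, i, hxW, h⟩ := germ_eq_zero S.X₃ x U hx _ hm
    rw [← app_map] at h
    obtain ⟨m', hm'⟩ := (sections_exact hS _ _).mp h
    refine ⟨S.X₁.presheaf.germ W x hxW m', ?_⟩
    rw [stalkLinearMap_germ, hm', germ_map]
  · rintro ⟨m, rfl⟩
    obtain ⟨U, hx, m, rfl⟩ := S.X₁.presheaf.exists_germ_eq m
    rw [stalkLinearMap_germ, stalkLinearMap_germ, (sections_exact hS U).apply_apply_eq_zero,
      map_zero]

theorem stalkLinearMap_surjective {M N : X.Modules} (f : M ⟶ N) [Epi f] (hM : M.IsQuasicoherent)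
    (hN : N.IsQuasicoherent) (x : X) : Function.Surjective (stalkLinearMap f x) := by
  intro n
  obtain ⟨U, hx, -, n, rfl⟩ := exists_germ_eq_of_affine N x n ⊤ trivial
  obtain ⟨m, rfl⟩ := app_surjective_of_epi f hM hN U.2 n
  exact ⟨M.presheaf.germ U.1 x hx m, stalkLinearMap_germ f x _ hx m⟩

variable {G : Type v} [Group G]

theorem projective_left_of_shortExact {R M N P : Type*} [Ring R] [AddCommGroup M] [AddCommGroup N]
    [AddCommGroup P] [Module R M] [Module R N] [Module R P] (f : M →ₗ[R] N) (g : N →ₗ[R] P)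
    (hf : Function.Injective f) (hfg : Function.Exact f g) (hg : Function.Surjective g)
    [Module.Projective R N] [Module.Projective R P] : Module.Projective R M := by
  obtain ⟨l, hl⟩ := Module.projective_lifting_property g LinearMap.id hg
  obtain ⟨e, he, -⟩ := hfg.splitSurjectiveEquiv hf ⟨l, hl⟩
  refine Module.Projective.of_split f (LinearMap.fst R M P ∘ₗ e.toLinearMap) ?_
  ext m
  simp [he]

theorem projective_middle_of_shortExact {R M N P : Type*} [Ring R] [AddCommGroup M]
    [AddCommGroup N] [AddCommGroup P] [Module R M] [Module R N] [Module R P] (f : M →ₗ[R] N)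
    (g : N →ₗ[R] P) (hf : Function.Injective f) (hfg : Function.Exact f g)
    (hg : Function.Surjective g) [Module.Projective R M] [Module.Projective R P] :
    Module.Projective R N := by
  obtain ⟨l, hl⟩ := Module.projective_lifting_property g LinearMap.id hg
  obtain ⟨e, -, -⟩ := hfg.splitSurjectiveEquiv hf ⟨l, hl⟩
  exact Module.Projective.of_equiv e.symm

section Representation

variable {k V₁ V₂ V₃ : Type*} [CommRing k] [AddCommGroup V₁] [AddCommGroup V₂]
  [AddCommGroup V₃] [Module k V₁] [Module k V₂] [Module k V₃] (ρ₁ : Representation k G V₁)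
  (ρ₂ : Representation k G V₂) (ρ₃ : Representation k G V₃) (f : V₁ →ₗ[k] V₂) (g : V₂ →ₗ[k] V₃)

/-- The linear map over the group ring given by an equivariant linear map. -/
def asModuleHom (hf : ∀ (a : G) (v : V₁), f (ρ₁ a v) = ρ₂ a (f v)) :
    ρ₁.asModule →ₗ[MonoidAlgebra k G] ρ₂.asModule :=
  Representation.IntertwiningMap.equivLinearMapAsModule ρ₁ ρ₂
    (f.intertwiningMap_of_isIntertwiningMap ρ₁ ρ₂ hf)

theorem projective_asModule_left (hf : ∀ (a : G) (v : V₁), f (ρ₁ a v) = ρ₂ a (f v))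
    (hg : ∀ (a : G) (v : V₂), g (ρ₂ a v) = ρ₃ a (g v)) (hfi : Function.Injective f)
    (hfg : Function.Exact f g) (hgs : Function.Surjective g)
    (h₂ : Module.Projective (MonoidAlgebra k G) ρ₂.asModule)
    (h₃ : Module.Projective (MonoidAlgebra k G) ρ₃.asModule) :
    Module.Projective (MonoidAlgebra k G) ρ₁.asModule :=
  projective_left_of_shortExact (asModuleHom ρ₁ ρ₂ f hf) (asModuleHom ρ₂ ρ₃ g hg) hfi hfg hgs

theorem projective_asModule_middle (hf : ∀ (a : G) (v : V₁), f (ρ₁ a v) = ρ₂ a (f v))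
    (hg : ∀ (a : G) (v : V₂), g (ρ₂ a v) = ρ₃ a (g v)) (hfi : Function.Injective f)
    (hfg : Function.Exact f g) (hgs : Function.Surjective g)
    (h₁ : Module.Projective (MonoidAlgebra k G) ρ₁.asModule)
    (h₃ : Module.Projective (MonoidAlgebra k G) ρ₃.asModule) :
    Module.Projective (MonoidAlgebra k G) ρ₂.asModule :=
  projective_middle_of_shortExact (asModuleHom ρ₁ ρ₂ f hf) (asModuleHom ρ₂ ρ₃ g hg) hfi hfg hgs

theorem projective_asModule_of_bijective (hf : ∀ (a : G) (v : V₁), f (ρ₁ a v) = ρ₂ a (f v))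
    (hfb : Function.Bijective f) (h₁ : Module.Projective (MonoidAlgebra k G) ρ₁.asModule) :
    Module.Projective (MonoidAlgebra k G) ρ₂.asModule :=
  Module.Projective.of_equiv (LinearEquiv.ofBijective (asModuleHom ρ₁ ρ₂ f hf) hfb)

/-- A section of the canonical free cover over the group ring is also `k`-linear, and a free module
over the group ring is free over `k`. This makes stalks of locally projective modules torsion-free.
-/
theorem projective_of_projective_asModule
    (h : Module.Projective (MonoidAlgebra k G) ρ₁.asModule) : Module.Projective k V₁ := by
  have : Module.Projective k ρ₁.asModule := by
    obtain ⟨s, hs⟩ := h.out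
    refine Module.Projective.of_split (s.restrictScalars k)
      ((Finsupp.linearCombination (MonoidAlgebra k G) id).restrictScalars k) ?_
    ext m
    exact hs m
  exact Module.Projective.of_equiv ρ₁.asModuleEquiv

end Representation

theorem stalkLinearMap_comm {P Q : Action X.Modules G} (f : P ⟶ Q) (x : X) (a : G)
    (m : P.V.presheaf.stalk x) :
    stalkLinearMap f.hom x (stalkRep P x a m) = stalkRep Q x a (stalkLinearMap f.hom x m) := by
  obtain ⟨U, hx, m, rfl⟩ := P.V.presheaf.exists_germ_eq m
  change stalkLinearMap f.hom x (stalkLinearMap (P.ρ a) x _) =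
    stalkLinearMap (Q.ρ a) x (stalkLinearMap f.hom x _)
  rw [stalkLinearMap_germ, stalkLinearMap_germ, stalkLinearMap_germ, stalkLinearMap_germ]
  exact congrArg _ congr(Scheme.Modules.Hom.app $(f.comm a) U m)

theorem shortExact_V {S : ShortComplex (Action X.Modules G)} (hS : S.ShortExact) :
    (S.map (Action.forget X.Modules G)).ShortExact :=
  hS.map_of_exact _

theorem shortExact_of_V {S : ShortComplex (Action X.Modules G)}
    (hS : (S.map (Action.forget X.Modules G)).ShortExact) : S.ShortExact where
  exact := (ShortComplex.exact_map_iff_of_faithful S (Action.forget X.Modules G)).mp hS.exact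
  mono_f := (Action.forget X.Modules G).mono_of_mono_map hS.mono_f
  epi_g := (Action.forget X.Modules G).epi_of_epi_map hS.epi_g

/-- Kernels of epimorphisms between locally projective modules are locally projective. -/
theorem locProj_left [IsLocallyNoetherian X] {S : ShortComplex (Action X.Modules G)}
    (hS : S.ShortExact) (h₂ : locProj X G S.X₂) (h₃ : locProj X G S.X₃) : locProj X G S.X₁ := by
  have hV := shortExact_V hS
  have := hV.mono_f
  have := hV.epi_g
  refine ⟨isCoherentModule_of_exact_of_mono hV.exact h₂.1 h₃.1, fun x ↦ ?_⟩
  exact projective_asModule_left (stalkRep S.X₁ x) (stalkRep S.X₂ x) (stalkRep S.X₃ x)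
    (stalkLinearMap S.f.hom x) (stalkLinearMap S.g.hom x) (stalkLinearMap_comm S.f x)
    (stalkLinearMap_comm S.g x) (stalkLinearMap_injective (S.map (Action.forget _ G)).f x)
    (stalkLinearMap_exact hV.exact x)
    (stalkLinearMap_surjective (S.map (Action.forget _ G)).g h₂.1.1 h₃.1.1 x) (h₂.2 x) (h₃.2 x)

/-- Coherent extensions of locally projective modules are locally projective. -/
theorem locProj_middle {S : ShortComplex (Action X.Modules G)}
    (hS : S.ShortExact) (h₁ : locProj X G S.X₁) (h₃ : locProj X G S.X₃)
    (h₂ : IsCoherentOG S.X₂) : locProj X G S.X₂ := by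
  have hV := shortExact_V hS
  have := hV.mono_f
  have := hV.epi_g
  refine ⟨h₂, fun x ↦ ?_⟩
  exact projective_asModule_middle (stalkRep S.X₁ x) (stalkRep S.X₂ x) (stalkRep S.X₃ x)
    (stalkLinearMap S.f.hom x) (stalkLinearMap S.g.hom x) (stalkLinearMap_comm S.f x)
    (stalkLinearMap_comm S.g x) (stalkLinearMap_injective (S.map (Action.forget _ G)).f x)
    (stalkLinearMap_exact hV.exact x)
    (stalkLinearMap_surjective (S.map (Action.forget _ G)).g h₂.1 h₃.1.1 x) (h₁.2 x) (h₃.2 x)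

theorem isCoherentOG_left [IsLocallyNoetherian X] {S : ShortComplex (Action X.Modules G)}
    (hS : S.ShortExact) (h₂ : IsCoherentOG S.X₂) (h₃ : IsCoherentOG S.X₃) : IsCoherentOG S.X₁ := by
  have hV := shortExact_V hS
  have := hV.mono_f
  exact isCoherentModule_of_exact_of_mono hV.exact h₂ h₃

theorem isCoherentOG_right {S : ShortComplex (Action X.Modules G)}
    (hS : S.ShortExact) (h₁ : IsCoherentOG S.X₁) (h₂ : IsCoherentOG S.X₂) : IsCoherentOG S.X₃ := by
  have hV := shortExact_V hS
  have := hV.epi_g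
  exact isCoherentModule_of_exact_of_epi hV.exact h₁ h₂

theorem isCoherentOG_biprod [IsLocallyNoetherian X] {P Q : Action X.Modules G}
    (hP : IsCoherentOG P) (hQ : IsCoherentOG Q) : IsCoherentOG (P ⊞ Q) := by
  have e : P.V ⊞ Q.V ≅ (P ⊞ Q).V :=
    have := preservesBinaryBiproduct_of_preservesBinaryProduct (Action.forget X.Modules G)
      (X := P) (Y := Q)
    ((Action.forget X.Modules G).mapBiprod P Q).symm
  have h := isCoherentModule_biprod hP hQ
  refine ⟨isQuasicoherent_of_iso e h.1, finite_sections_of_mono e.inv h.2⟩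

end

/-! ### Morphisms from quasi-coherent modules into direct images -/

section

variable {X : Scheme.{u}}

/-- Morphisms from quasi-coherent modules to `N` are determined by their values on `V`, which can
be arbitrary linear maps. -/
def HomsDeterminedOn (N : X.Modules) (V : X.Opens) : Prop :=
  ∀ M : X.Modules, M.IsQuasicoherent → ∀ g : Γ(M, V) →+ Γ(N, V),
    (∀ (a : Γ(X, V)) (m : Γ(M, V)), g (a • m) = a • g m) → ∃! ψ : M ⟶ N, ∀ m, ψ.app V m = g m

theorem HomsDeterminedOn.of_iso {N N' : X.Modules} {V : X.Opens} (h : HomsDeterminedOn N V)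
    (e : N ≅ N') : HomsDeterminedOn N' V := by
  intro M hM g hg
  have he (n : Γ(N', V)) : e.hom.app V (e.inv.app V n) = n :=
    congr(Scheme.Modules.Hom.app $(e.inv_hom_id) V n)
  obtain ⟨ψ, hψ, huniq⟩ := h M hM ((e.inv.app V).hom.comp g) fun a m ↦ by
    change e.inv.app V (g _) = a • e.inv.app V (g _)
    rw [hg, Scheme.Modules.Hom.app_smul]
  refine ⟨ψ ≫ e.hom, fun m ↦ ?_, fun ψ' hψ' ↦ ?_⟩
  · exact (congrArg _ (hψ m)).trans (he _)
  · rw [← huniq (ψ' ≫ e.inv) fun m ↦ congrArg (e.inv.app V) (hψ' m)]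
    simp

/-- Up to the adjunction bijection, the map induced by `R` is precomposition with the counit at `M`.
-/
theorem bijective_map_of_isIso_counit {C : Type*} {D : Type*} [Category* C] [Category* D]
    {L : C ⥤ D} {R : D ⥤ C} (adj : L ⊣ R) (M N : D) [IsIso (adj.counit.app M)] :
    Function.Bijective (R.map : (M ⟶ N) → (R.obj M ⟶ R.obj N)) := by
  have key (f : M ⟶ N) : adj.homEquiv _ _ (adj.counit.app M ≫ f) = R.map f := by
    rw [Adjunction.homEquiv_unit, Functor.map_comp, adj.right_triangle_components_assoc]
  constructor
  · intro f f' h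
    rw [← key, ← key] at h
    exact (cancel_epi _).mp ((adj.homEquiv _ _).injective h)
  · intro g
    refine ⟨inv (adj.counit.app M) ≫ (adj.homEquiv _ _).symm g, ?_⟩
    rw [← key, IsIso.hom_inv_id_assoc, Equiv.apply_symm_apply]

theorem existsUnique_app_top {R : CommRingCat.{u}} {M N : (Spec R).Modules}
    (hM : M.IsQuasicoherent) (g : Γ(M, ⊤) →+ Γ(N, ⊤))
    (hg : ∀ (a : R) (m : Γ(M, ⊤)), g (a • m) = a • g m) :
    ∃! ψ : M ⟶ N, ∀ m, ψ.app ⊤ m = g m := by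
  have hM' : IsIso M.fromTildeΓ := (isQuasicoherent_iff_isIso_fromTildeΓ _).mp hM
  let adj := tilde.adjunction (R := R)
  have : IsIso (adj.counit.app M) := hM'
  have key := bijective_map_of_isIso_counit adj M N
  let g' : moduleSpecΓFunctor.obj M ⟶ moduleSpecΓFunctor.obj N :=
    ModuleCat.ofHom (X := moduleSpecΓFunctor.obj M) (Y := moduleSpecΓFunctor.obj N)
      { toFun := g, map_add' := g.map_add, map_smul' := hg }
  have h1 (f : M ⟶ N) : (∀ m, f.app ⊤ m = g m) ↔ moduleSpecΓFunctor.map f = g' := by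
    constructor
    · intro h
      exact ModuleCat.hom_ext (LinearMap.ext h)
    · intro h m
      exact congr(ModuleCat.Hom.hom $h m)
  simp only [h1]
  exact key.existsUnique g'

theorem map_map_map_cancel (M : X.Modules) {U₁ U₂ U₃ : X.Opens} (i₁ : U₂ ⟶ U₁) (i₂ : U₃ ⟶ U₂)
    (i₃ : U₁ ⟶ U₃) (m : Γ(M, U₁)) :
    M.presheaf.map i₃.op (M.presheaf.map i₂.op (M.presheaf.map i₁.op m)) = m := by
  rw [← Functor.map_comp_apply, ← Functor.map_comp_apply]
  exact congr($(M.presheaf.map_id _) m)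

/-- Sections over an affine open subset of the direct image of a module on its spectrum. -/
def pushforwardFromSpecSections {V : X.Opens} (hV : IsAffineOpen V) (K : (Spec Γ(X, V)).Modules) :
    Γ((Scheme.Modules.pushforward hV.fromSpec).obj K, V) ≃+ Γ(K, ⊤) :=
  (K.presheaf.mapIso (eqToIso hV.fromSpec_preimage_self.symm).op).addCommGroupIsoToAddEquiv

theorem pushforwardFromSpecSections_smul {V : X.Opens} (hV : IsAffineOpen V)
    (K : (Spec Γ(X, V)).Modules) (a : Γ(X, V))
    (m : Γ((Scheme.Modules.pushforward hV.fromSpec).obj K, V)) :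
    pushforwardFromSpecSections hV K (a • m) = a • pushforwardFromSpecSections hV K m := by
  refine (K.map_smul (eqToHom hV.fromSpec_preimage_self.symm) (hV.fromSpec.app V a) m).trans ?_
  rw [Scheme.Modules.smul_Spec_def]
  refine congrArg (fun t : Γ(Spec Γ(X, V), ⊤) ↦ t • pushforwardFromSpecSections hV K m) ?_
  rw [hV.fromSpec_app_self]
  simp only [CommRingCat.comp_apply, ← Functor.map_comp_apply]
  rfl

/-- By adjunction, morphisms into the direct image are morphisms from the restriction of `M` to the
spectrum. That restriction is a tilde, so they amount to linear maps on global sections. -/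
theorem homsDeterminedOn_pushforward_fromSpec {V : X.Opens} (hV : IsAffineOpen V)
    (K : (Spec Γ(X, V)).Modules) :
    HomsDeterminedOn ((Scheme.Modules.pushforward hV.fromSpec).obj K) V := by
  intro M hM g hg
  let i := hV.fromSpec
  have : M.IsQuasicoherent := hM
  have hMr : (M.restrict i).IsQuasicoherent := Scheme.Modules.isQuasicoherent_restrictFunctor _ M
  let adj := Scheme.Modules.restrictAdjunction i
  let eM := restrictSections M hV ⊤ (image_top_fromSpec hV)
  let eK := pushforwardFromSpecSections hV K
  have heM (a : Γ(X, V)) (m : Γ(M.restrict i, ⊤)) : eM (a • m) = a • eM m := by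
    refine (restrictSections_smul M hV ⊤ _ le_rfl a m).trans ?_
    have e : homOfLE (le_refl V) = 𝟙 _ := rfl
    rw [e, op_id, X.presheaf.map_id]
    rfl
  have happ (ψ : M.restrict i ⟶ K) (m : Γ(M, V)) :
      eK ((adj.homEquiv _ _ ψ).app V m) = ψ.app ⊤ (eM.symm m) := by
    obtain ⟨m, rfl⟩ := eM.surjective m
    rw [AddEquiv.symm_apply_apply, Adjunction.homEquiv_unit]
    change K.presheaf.map (eqToHom hV.fromSpec_preimage_self.symm).op (ψ.app (i ⁻¹ᵁ V)
      (M.presheaf.map (homOfLE (i.image_preimage_le V)).op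
        (M.presheaf.map (eqToHom (image_top_fromSpec hV).symm).op m))) = _
    refine (app_map ψ _ _).symm.trans (congrArg (ψ.app ⊤) ?_)
    exact map_map_map_cancel M _ _ (i.opensFunctor.map (eqToHom hV.fromSpec_preimage_self.symm)) m
  have hg' (a : Γ(X, V)) (m : Γ(M.restrict i, ⊤)) :
      (eK.toAddMonoidHom.comp (g.comp eM.toAddMonoidHom)) (a • m) =
        a • (eK.toAddMonoidHom.comp (g.comp eM.toAddMonoidHom)) m := by
    change eK (g (eM (a • m))) = a • eK (g (eM m))
    rw [heM, hg]
    exact pushforwardFromSpecSections_smul hV K _ _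
  obtain ⟨ψ, hψ, huniq⟩ := existsUnique_app_top hMr _ hg'
  refine ⟨adj.homEquiv _ _ ψ, fun m ↦ eK.injective ?_, fun φ hφ ↦ ?_⟩
  · rw [happ, hψ]
    exact congrArg (fun t ↦ eK (g t)) (eM.apply_symm_apply m)
  · obtain ⟨φ, rfl⟩ := (adj.homEquiv _ _).surjective φ
    rw [huniq φ fun m ↦ ?_]
    have := happ φ (eM m)
    rw [eM.symm_apply_apply, hφ] at this
    exact this.symm

/-- Every structured arrow maps to the one given by the whole space. Finality is what makes pullback
carry the structure sheaf to the structure sheaf. -/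
theorem opensMap_final {X Y : TopCat.{u}} (f : X ⟶ Y) :
    (TopologicalSpace.Opens.map f).Final := by
  refine ⟨fun d ↦ ?_⟩
  have : Nonempty (StructuredArrow d (TopologicalSpace.Opens.map f)) :=
    ⟨StructuredArrow.mk (Y := ⊤) (homOfLE le_top)⟩
  refine zigzag_isConnected fun a b ↦ ?_
  let t : StructuredArrow d (TopologicalSpace.Opens.map f) :=
    StructuredArrow.mk (Y := ⊤) (homOfLE le_top)
  exact (Zigzag.of_hom (StructuredArrow.homMk (homOfLE le_top) : a ⟶ t)).trans
    (Zigzag.of_inv (StructuredArrow.homMk (homOfLE le_top) : b ⟶ t))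

/-- Pullback preserves colimits and the structure sheaf, so it carries a global presentation to a
global presentation. -/
theorem isQuasicoherent_pullback_Spec {R S : CommRingCat.{u}} (φ : R ⟶ S) (M : (Spec R).Modules)
    (hM : M.IsQuasicoherent) :
    ((Scheme.Modules.pullback (Spec.map φ)).obj M).IsQuasicoherent := by
  have hM' : IsIso M.fromTildeΓ := (isQuasicoherent_iff_isIso_fromTildeΓ _).mp hM
  let p0 : SheafOfModules.Presentation (tilde ((modulesSpecToSheaf.obj M).presheaf.obj (.op ⊤))) :=
    presentationTilde _ .univ (by simp) _ (Submodule.span_eq _)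
  let p1 : SheafOfModules.Presentation M :=
    @SheafOfModules.Presentation.ofIsIso _ _ _ _ _ _ _ _ M.fromTildeΓ hM' p0
  have : (TopologicalSpace.Opens.map (Spec.map φ).base).Final := opensMap_final _
  let F : SheafOfModules.{u} (Spec R).ringCatSheaf ⥤ SheafOfModules.{u} (Spec S).ringCatSheaf :=
    Scheme.Modules.pullback (Spec.map φ)
  have : PreservesColimitsOfSize.{u, u} F :=
    (Scheme.Modules.pullbackPushforwardAdjunction (Spec.map φ)).leftAdjoint_preservesColimits
  have : (SheafOfModules.pushforward.{u} (Spec.map φ).toRingCatSheafHom).IsRightAdjoint :=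
    (Scheme.Modules.pullbackPushforwardAdjunction (Spec.map φ)).isRightAdjoint
  have := @SheafOfModules.instIsIsoPullbackObjUnitToUnitOfFinal _ _ _ _ _ _ _ _ _ _
    (Spec.map φ).toRingCatSheafHom
  exact (p1.map F (asIso (SheafOfModules.pullbackObjUnitToUnit
    (Spec.map φ).toRingCatSheafHom)).symm).isQuasicoherent

end

/-! ### Sections of the inverse image as a base change -/

section

variable {X U : Scheme.{u}} (j : U ⟶ X)

/-- Both sides are pullbacks of `M` along the same composite from the spectrum of `Γ(U, W)` to `X`.
-/
def pullbackRestrictIso {V : X.Opens} (hV : IsAffineOpen V) {W : U.Opens} (hW : IsAffineOpen W)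
    (i : W ≤ j ⁻¹ᵁ V) (M : X.Modules) :
    (Scheme.Modules.pullback (Spec.map (j.appLE V W i))).obj (M.restrict hV.fromSpec) ≅
      ((Scheme.Modules.pullback j).obj M).restrict hW.fromSpec :=
  (Scheme.Modules.pullback _).mapIso ((Scheme.Modules.restrictFunctorIsoPullback _).app M) ≪≫
    (Scheme.Modules.pullbackComp _ _).app M ≪≫
    (Scheme.Modules.pullbackCongr (hV.SpecMap_appLE_fromSpec j hW i)).app M ≪≫
    (Scheme.Modules.pullbackComp _ _).symm.app M ≪≫
    (Scheme.Modules.restrictFunctorIsoPullback _).symm.app _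

theorem isQuasicoherent_pullback {M : X.Modules} (hM : M.IsQuasicoherent) {ι : Type u}
    (V : ι → X.Opens) (hV : ∀ i, IsAffineOpen (V i)) (hcov : ⨆ i, V i = ⊤)
    (hW : ∀ i, IsAffineOpen (j ⁻¹ᵁ V i)) : ((Scheme.Modules.pullback j).obj M).IsQuasicoherent := by
  refine isQuasicoherent_of_restrict _ (fun i ↦ j ⁻¹ᵁ V i) hW ?_ fun i ↦ ?_
  · rw [← Scheme.Hom.preimage_iSup, hcov, Scheme.Hom.preimage_top]
  · have : M.IsQuasicoherent := hM
    exact isQuasicoherent_of_iso (pullbackRestrictIso j (hV i) (hW i) le_rfl M)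
      (isQuasicoherent_pullback_Spec _ _ (Scheme.Modules.isQuasicoherent_restrictFunctor _ M))

theorem homsDeterminedOn_pushforward_pushforward {V : X.Opens} (hV : IsAffineOpen V) {W : U.Opens}
    (hW : IsAffineOpen W) (i : W ≤ j ⁻¹ᵁ V) (K : (Spec Γ(U, W)).Modules) :
    HomsDeterminedOn ((Scheme.Modules.pushforward j).obj
      ((Scheme.Modules.pushforward hW.fromSpec).obj K)) V :=
  (homsDeterminedOn_pushforward_fromSpec hV
    ((Scheme.Modules.pushforward (Spec.map (j.appLE V W i))).obj K)).of_iso <|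
    (Scheme.Modules.pushforwardComp _ _).app K ≪≫
    (Scheme.Modules.pushforwardCongr (hV.SpecMap_appLE_fromSpec j hW i)).app K ≪≫
    (Scheme.Modules.pushforwardComp _ _).symm.app K

/-- The adjunction unit on sections. -/
def unitSections (M : X.Modules) (V : X.Opens) :
    Γ(M, V) →+ Γ((Scheme.Modules.pullback j).obj M, j ⁻¹ᵁ V) :=
  (((Scheme.Modules.pullbackPushforwardAdjunction j).unit.app M).app V).hom

theorem unitSections_smul (M : X.Modules) (V : X.Opens) (a : Γ(X, V)) (m : Γ(M, V)) :
    unitSections j M V (a • m) = j.app V a • unitSections j M V m :=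
  Scheme.Modules.Hom.app_smul _ a m

theorem unitSections_map (M : X.Modules) {V V' : X.Opens} (i : V' ≤ V) (m : Γ(M, V)) :
    unitSections j M V' (M.presheaf.map (homOfLE i).op m) =
      ((Scheme.Modules.pullback j).obj M).presheaf.map
        (homOfLE (j.preimage_mono i)).op (unitSections j M V m) :=
  app_map ((Scheme.Modules.pullbackPushforwardAdjunction j).unit.app M) _ m

theorem unitSections_app {M N : X.Modules} (f : M ⟶ N) (V : X.Opens) (m : Γ(M, V)) :
    unitSections j N V (f.app V m) =
      ((Scheme.Modules.pullback j).map f).app (j ⁻¹ᵁ V) (unitSections j M V m) :=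
  congr(Scheme.Modules.Hom.app
    $((Scheme.Modules.pullbackPushforwardAdjunction j).unit.naturality f) V m)

def tildeSections {R : CommRingCat.{u}} (Q : ModuleCat.{u} R) : Γ(tilde Q, ⊤) ≃+ Q :=
  (asIso (tilde.toTildeΓNatIso.hom.app Q)).symm.toLinearEquiv.toAddEquiv

theorem tildeSections_smul {R : CommRingCat.{u}} (Q : ModuleCat.{u} R) (a : R) (m : Γ(tilde Q, ⊤)) :
    tildeSections Q (a • m) = a • tildeSections Q m :=
  (asIso (tilde.toTildeΓNatIso.hom.app Q)).symm.toLinearEquiv.map_smul a m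

/-- This is the universal property of base change from `Γ(X, V)` to `Γ(U, j ⁻¹ᵁ V)`. Realize `Q` as
the sections of a direct image `N` on `U`; linear maps into `Q` are then morphisms from `M` to the
direct image of `N` on `X`, hence by adjunction morphisms from the inverse image of `M` to `N`. -/
theorem existsUnique_factor_unitSections {M : X.Modules} (hM : M.IsQuasicoherent)
    (hjM : ((Scheme.Modules.pullback j).obj M).IsQuasicoherent)
    {V : X.Opens} (hV : IsAffineOpen V) (hW : IsAffineOpen (j ⁻¹ᵁ V))
    (Q : ModuleCat.{u} Γ(U, j ⁻¹ᵁ V)) (g : Γ(M, V) →+ Q)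
    (hg : ∀ (a : Γ(X, V)) (m : Γ(M, V)), g (a • m) = j.app V a • g m) :
    ∃! g' : Γ((Scheme.Modules.pullback j).obj M, j ⁻¹ᵁ V) →ₗ[Γ(U, j ⁻¹ᵁ V)] Q,
      ∀ m, g' (unitSections j M V m) = g m := by
  let K := tilde Q
  let N := (Scheme.Modules.pushforward hW.fromSpec).obj K
  let e : Γ(N, j ⁻¹ᵁ V) ≃+ Q := (pushforwardFromSpecSections hW K).trans (tildeSections Q)
  have he (a : Γ(U, j ⁻¹ᵁ V)) (n : Γ(N, j ⁻¹ᵁ V)) : e (a • n) = a • e n := by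
    change tildeSections Q (pushforwardFromSpecSections hW K (a • n)) = a • tildeSections Q _
    rw [pushforwardFromSpecSections_smul, tildeSections_smul]
    rfl
  have he' (a : Γ(U, j ⁻¹ᵁ V)) (q : Q) : e.symm (a • q) = a • e.symm q := by
    rw [AddEquiv.symm_apply_eq, he, AddEquiv.apply_symm_apply]
  let adj := Scheme.Modules.pullbackPushforwardAdjunction j
  have hadj (φ : (Scheme.Modules.pullback j).obj M ⟶ N) (m : Γ(M, V)) :
      (adj.homEquiv _ _ φ).app V m = φ.app (j ⁻¹ᵁ V) (unitSections j M V m) := by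
    rw [Adjunction.homEquiv_unit]
    rfl
  obtain ⟨ψ, hψ, huniq⟩ := homsDeterminedOn_pushforward_pushforward j hV hW le_rfl K M hM
    (e.symm.toAddMonoidHom.comp g) fun a m ↦ by
      change e.symm (g (a • m)) = _
      rw [hg, he']
      rfl
  obtain ⟨φ, rfl⟩ := (adj.homEquiv _ _).surjective ψ
  let gφ : Γ((Scheme.Modules.pullback j).obj M, j ⁻¹ᵁ V) →ₗ[Γ(U, j ⁻¹ᵁ V)] Q :=
    { toFun t := e (φ.app (j ⁻¹ᵁ V) t)
      map_add' t t' := by rw [map_add, map_add]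
      map_smul' a t := by rw [φ.app_smul, he, RingHom.id_apply] }
  refine ⟨gφ, fun m ↦ ?_, fun g' hg' ↦ ?_⟩
  · change e (φ.app (j ⁻¹ᵁ V) (unitSections j M V m)) = g m
    rw [← hadj, hψ]
    exact e.apply_symm_apply _
  -- For uniqueness, any competing linear map also comes from a morphism of sheaves, because the
  -- inverse image is quasi-coherent. The adjoints then agree on `Γ(M, V)`.
  · obtain ⟨φ', hφ', -⟩ := homsDeterminedOn_pushforward_fromSpec hW K _ hjM
      (e.symm.toAddMonoidHom.comp g'.toAddMonoidHom) fun a m ↦ by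
        change e.symm (g' (a • m)) = _
        rw [map_smul, he']
        rfl
    have : φ' = φ := by
      refine (adj.homEquiv _ _).injective (huniq _ fun m ↦ ?_)
      rw [hadj, hφ']
      exact congrArg e.symm (hg' m)
    subst this
    ext t
    exact (e.apply_symm_apply _).symm.trans (congrArg e (hφ' t).symm)

/-- The map `j` is a localization over the affine open `V` at the submonoid `S` of `Γ(X, V)`. -/
def IsLocalizationOver (V : X.Opens) (S : Submonoid Γ(X, V)) : Prop :=
  letI := (j.app V).hom.toAlgebra
  IsLocalization S Γ(U, j ⁻¹ᵁ V)

/-- Base change along a localization of rings is localization of modules; the two conclusions are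
its surjectivity and kernel statements. -/
theorem unitSections_localization {M : X.Modules} (hM : M.IsQuasicoherent)
    (hjM : ((Scheme.Modules.pullback j).obj M).IsQuasicoherent)
    {V : X.Opens} (hV : IsAffineOpen V) (hW : IsAffineOpen (j ⁻¹ᵁ V)) {S : Submonoid Γ(X, V)}
    (hS : IsLocalizationOver j V S) :
    (∀ t, ∃ s ∈ S, ∃ m, unitSections j M V m = j.app V s • t) ∧
      ∀ m, unitSections j M V m = 0 → ∃ s ∈ S, s • m = 0 := by
  let A := Γ(X, V)
  let B := Γ(U, j ⁻¹ᵁ V)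
  let MV : Type u := Γ(M, V)
  let T : Type u := Γ((Scheme.Modules.pullback j).obj M, j ⁻¹ᵁ V)
  let : Algebra A B := (j.app V).hom.toAlgebra
  let : Module A T := Module.compHom T (algebraMap A B)
  have : IsScalarTower A B T := .of_algebraMap_smul fun _ _ ↦ rfl
  have : IsLocalization S B := hS
  let η : MV →ₗ[A] T :=
    { toFun := unitSections j M V, map_add' := map_add _, map_smul' := unitSections_smul j M V }
  have : IsBaseChange B η := by
    refine IsBaseChange.of_lift_unique η fun Q _ _ _ _ g ↦ ?_
    let : AddCommGroup Q := Module.addCommMonoidToAddCommGroup B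
    obtain ⟨g', hg', huniq⟩ := existsUnique_factor_unitSections j hM hjM hV hW
      (ModuleCat.of B Q) g.toAddMonoidHom fun a m ↦ by
        change g (a • m) = algebraMap A B a • g m
        rw [map_smul, algebraMap_smul]
    exact ⟨g', LinearMap.ext hg', fun g'' h ↦ huniq g'' fun m ↦ congr($h m)⟩
  have : IsLocalizedModule S η := (isLocalizedModule_iff_isBaseChange S B η).mpr this
  refine ⟨fun t ↦ ?_, fun m hm ↦ ?_⟩
  · obtain ⟨⟨m, s⟩, h⟩ := IsLocalizedModule.surj S η t
    exact ⟨s, s.2, m, h.symm⟩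
  · obtain ⟨s, hs⟩ := (IsLocalizedModule.eq_zero_iff S η).mp hm
    exact ⟨s, s.2, hs⟩

end

/-! ### Twistable covers: exactness and faithfulness of the inverse image -/

section

theorem isUnit_res_basicOpen {X : Scheme.{u}} {V : X.Opens} (a : Γ(X, V)) (n : ℕ) :
    IsUnit (X.presheaf.map (homOfLE (X.basicOpen_le a)).op (a ^ n)) := by
  rw [map_pow]
  exact (RingedSpace.isUnit_res_basicOpen _ a).pow n

theorem exists_basicOpen {X : Scheme.{u}} {V : X.Opens} (hV : IsAffineOpen V) {O : X.Opens} {x : X}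
    (hxV : x ∈ V) (hxO : x ∈ O) : ∃ a : Γ(X, V), X.basicOpen a ≤ O ∧ x ∈ X.basicOpen a := by
  obtain ⟨a, h1, h2⟩ := hV.exists_basicOpen_le ⟨x, hxO⟩ hxV
  exact ⟨a, h1, h2⟩

/-- Near a point, a section over a basic open subset of a chart is, up to a unit, the restriction of
a section over the chart. -/
theorem isZero_of_sections {X : Scheme.{u}} {N : X.Modules} (hN : N.IsQuasicoherent) {ι : Type*}
    (V : ι → X.Opens) (hV : ∀ i, IsAffineOpen (V i)) (hcov : ⨆ i, V i = ⊤)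
    (h : ∀ i (m : Γ(N, V i)), m = 0) : IsZero N := by
  rw [IsZero.iff_id_eq_zero]
  ext O m
  refine section_ext N _ _ fun x hx ↦ ?_
  obtain ⟨i, hi⟩ := TopologicalSpace.Opens.mem_iSup.mp (hcov.symm ▸ trivial : x ∈ ⨆ i, V i)
  obtain ⟨a, hle, hxa⟩ := exists_basicOpen (hV i) hi hx
  refine ⟨_, hle, hxa, ?_⟩
  change N.presheaf.map _ m = N.presheaf.map _ 0
  obtain ⟨n, t, ht⟩ := (isLocalizingOn_of_isQuasicoherent N hN (hV i)).exists_lift a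
    (N.presheaf.map (homOfLE hle).op m)
  rw [h i t, map_zero] at ht
  rw [map_zero]
  exact (isUnit_res_basicOpen a n).smul_eq_zero.mp ht.symm

theorem mono_of_sections {X : Scheme.{u}} {M N : X.Modules} (hM : M.IsQuasicoherent)
    (hN : N.IsQuasicoherent) (f : M ⟶ N) {ι : Type*}
    (V : ι → X.Opens) (hV : ∀ i, IsAffineOpen (V i)) (hcov : ⨆ i, V i = ⊤)
    (h : ∀ i (m : Γ(M, V i)), f.app _ m = 0 → m = 0) : Mono f := by
  have hK : (kernel f).IsQuasicoherent :=
    isQuasicoherent_of_exact_of_mono (S := ShortComplex.mk (kernel.ι f) f (kernel.condition f))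
      (ShortComplex.exact_of_f_is_kernel _ (kernelIsKernel f)) hM hN
  have hz : IsZero (kernel f) := isZero_of_sections hK V hV hcov fun i m ↦ by
    refine app_injective (kernel.ι f) _ ?_
    rw [map_zero]
    exact h i _ congr(Scheme.Modules.Hom.app $(kernel.condition f) _ m)
  exact Preadditive.mono_of_kernel_zero (hz.eq_of_src _ _)

variable {X U : Scheme.{u}}

/-- An affine open cover of `X` over which `j` is a localization at non-zero-divisors, together
with the possibility of twisting: any choice of denominators on the members of the cover is
dominated by an invertible ideal sheaf which is trivial over `U`. -/
structure TwistableCover (j : U ⟶ X) where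
  ι : Type u
  V : ι → X.Opens
  isAffineOpen : ∀ i, IsAffineOpen (V i)
  iSup_eq_top : ⨆ i, V i = ⊤
  isAffineOpen_preimage : ∀ i, IsAffineOpen (j ⁻¹ᵁ V i)
  S : ∀ i, Submonoid Γ(X, V i)
  le_nonZeroDivisors : ∀ i, S i ≤ nonZeroDivisors Γ(X, V i)
  isLocalizationOver : ∀ i, IsLocalizationOver j (V i) (S i)
  exists_twist : ∀ s : ∀ i, Γ(X, V i), (∀ i, s i ∈ S i) →
    ∃ D : ∀ x : X, Ideal (X.presheaf.stalk x),
      (∀ x : X, ∃ (W : X.Opens) (_ : x ∈ W) (f : Γ(X, W)), ∀ (y : X) (hy : y ∈ W),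
        X.presheaf.germ W y hy f ∈ nonZeroDivisors (X.presheaf.stalk y) ∧
        D y = Ideal.span {X.presheaf.germ W y hy f}) ∧
      (∀ i (x : X) (hx : x ∈ V i), D x ≤ Ideal.span {X.presheaf.germ (V i) x hx (s i)}) ∧
      (∀ i, ∃ t ∈ S i, ∀ (x : X) (hx : x ∈ V i), X.presheaf.germ (V i) x hx t ∈ D x)

section

variable {j : U ⟶ X}

theorem TwistableCover.exists_mem (T : TwistableCover j) (x : X) : ∃ i, x ∈ T.V i :=
  TopologicalSpace.Opens.mem_iSup.mp (T.iSup_eq_top.symm ▸ trivial : x ∈ ⨆ i, T.V i)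

theorem TwistableCover.isQuasicoherent_pullback (T : TwistableCover j) {M : X.Modules}
    (hM : M.IsQuasicoherent) :
    ((Scheme.Modules.pullback j).obj M).IsQuasicoherent :=
  _root_.isQuasicoherent_pullback j hM T.V T.isAffineOpen T.iSup_eq_top T.isAffineOpen_preimage

theorem TwistableCover.iSup_preimage (T : TwistableCover j) : ⨆ i, j ⁻¹ᵁ T.V i = ⊤ := by
  rw [← Scheme.Hom.preimage_iSup, T.iSup_eq_top, Scheme.Hom.preimage_top]

theorem TwistableCover.isUnit_app (T : TwistableCover j) {i : T.ι} {s : Γ(X, T.V i)}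
    (hs : s ∈ T.S i) :
    IsUnit (j.app (T.V i) s) := by
  let _ := (j.app (T.V i)).hom.toAlgebra
  have : IsLocalization (T.S i) Γ(U, j ⁻¹ᵁ T.V i) := T.isLocalizationOver i
  exact IsLocalization.map_units Γ(U, j ⁻¹ᵁ T.V i) (⟨s, hs⟩ : T.S i)

theorem TwistableCover.localization (T : TwistableCover j) {M : X.Modules} (hM : M.IsQuasicoherent)
    (i : T.ι) :
    (∀ t, ∃ s ∈ T.S i, ∃ m, unitSections j M (T.V i) m = j.app (T.V i) s • t) ∧
      ∀ m, unitSections j M (T.V i) m = 0 → ∃ s ∈ T.S i, s • m = 0 :=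
  unitSections_localization j hM (T.isQuasicoherent_pullback hM) (T.isAffineOpen i)
    (T.isAffineOpen_preimage i) (T.isLocalizationOver i)

/-- Flatness of localization: clear the denominator of a section in the kernel, kill its image with
an element of `S i`, and use that elements of `S i` become units on `U`. -/
theorem TwistableCover.mono_pullback (T : TwistableCover j) {M N : X.Modules} (f : M ⟶ N) [Mono f]
    (hM : M.IsQuasicoherent) (hN : N.IsQuasicoherent) : Mono ((Scheme.Modules.pullback j).map f) :=
        by
  refine mono_of_sections (T.isQuasicoherent_pullback hM) (T.isQuasicoherent_pullback hN) _ _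
    T.isAffineOpen_preimage T.iSup_preimage fun i t ht ↦ ?_
  obtain ⟨s, hs, m, hm⟩ := (T.localization hM i).1 t
  have h0 : unitSections j N (T.V i) (f.app _ m) = 0 := by
    rw [unitSections_app, hm, Scheme.Modules.Hom.app_smul, ht, smul_zero]
  obtain ⟨s', hs', h'⟩ := (T.localization hN i).2 _ h0
  have hm0 : s' • m = 0 := app_injective f _ (by rw [Scheme.Modules.Hom.app_smul, h', map_zero])
  have : j.app (T.V i) s' • (j.app (T.V i) s • t) = 0 := by
    rw [← hm, ← unitSections_smul, hm0, map_zero]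
  exact (T.isUnit_app hs).smul_eq_zero.mp ((T.isUnit_app hs').smul_eq_zero.mp this)

/-- Inverse image is right exact and here also keeps `S.f` mono, so the vanishing of the third term
is exactly what is missing for an isomorphism. -/
theorem TwistableCover.isIso_pullback_iff (T : TwistableCover j) {S : ShortComplex X.Modules}
    (hS : S.ShortExact)
    (h₁ : S.X₁.IsQuasicoherent) (h₂ : S.X₂.IsQuasicoherent) :
    IsIso ((Scheme.Modules.pullback j).map S.f) ↔ IsZero ((Scheme.Modules.pullback j).obj S.X₃) :=
        by
  have := hS.mono_f
  have := hS.epi_g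
  have := T.mono_pullback S.f h₁ h₂
  have : PreservesFiniteColimits (Scheme.Modules.pullback j) := inferInstance
  have : Epi ((Scheme.Modules.pullback j).map S.g) := (Scheme.Modules.pullback j).map_epi S.g
  have hex := hS.exact.map_of_epi_of_preservesCokernel (Scheme.Modules.pullback j) inferInstance
    inferInstance
  constructor
  · intro h
    have : Epi (S.map (Scheme.Modules.pullback j)).f :=
      inferInstanceAs (Epi ((Scheme.Modules.pullback j).map S.f))
    have hg : (Scheme.Modules.pullback j).map S.g = 0 := hex.epi_f_iff.mp this
    exact IsZero.of_epi_eq_zero _ hg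
  · intro h
    have : Epi ((Scheme.Modules.pullback j).map S.f) := hex.epi_f (h.eq_of_tgt _ _)
    exact isIso_of_mono_of_epi _

/-- The stalk is a localization of `Γ(X, V)`, and non-zero-divisors survive localization. -/
theorem germ_mem_nonZeroDivisors {V : X.Opens} (hV : IsAffineOpen V) {s : Γ(X, V)}
    (hs : s ∈ nonZeroDivisors Γ(X, V)) (x : X) (hx : x ∈ V) :
    X.presheaf.germ V x hx s ∈ nonZeroDivisors (X.presheaf.stalk x) := by
  let _ := (X.presheaf.germ V x hx).hom.toAlgebra
  have := hV.isLocalization_stalk ⟨x, hx⟩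
  exact IsLocalization.map_nonZeroDivisors_le (hV.primeIdealOf ⟨x, hx⟩).asIdeal.primeCompl _
    (Submonoid.mem_map_of_mem (algebraMap Γ(X, V) (X.presheaf.stalk x)) hs)

theorem smul_eq_zero_of_projective {R M : Type*} [CommRing R] [AddCommGroup M] [Module R M]
    [Module.Projective R M] {r : R} (hr : r ∈ nonZeroDivisors R) {m : M} (h : r • m = 0) : m = 0 :=
        by
  have : Module.IsTorsionFree R M := inferInstance
  exact this.isSMulRegular (isRegular_iff_mem_nonZeroDivisors.mpr hr) (h.trans (smul_zero _).symm)

/-- All stalks of `M` are projective over the local rings. -/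
def StalksProjective (M : X.Modules) : Prop :=
  ∀ x : X, Module.Projective (X.presheaf.stalk x) (M.presheaf.stalk x)

theorem eq_zero_of_germ_eq_zero (M : X.Modules) {O : X.Opens} (m : Γ(M, O))
    (h : ∀ x (hx : x ∈ O), M.presheaf.germ O x hx m = 0) : m = 0 := by
  refine section_ext M _ _ fun x hx ↦ ?_
  obtain ⟨W, i, hxW, e⟩ := germ_eq_zero M x O hx m (h x hx)
  exact ⟨W, i, hxW, e.trans (map_zero _).symm⟩

theorem StalksProjective.smul_eq_zero {M : X.Modules} (hM : StalksProjective M) {V : X.Opens}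
    (hV : IsAffineOpen V) {s : Γ(X, V)} (hs : s ∈ nonZeroDivisors Γ(X, V)) {m : Γ(M, V)}
    (h : s • m = 0) : m = 0 := by
  refine eq_zero_of_germ_eq_zero M m fun x hx ↦ ?_
  have := hM x
  refine smul_eq_zero_of_projective (germ_mem_nonZeroDivisors hV hs x hx) ?_
  exact (stalk_germ_smul M x V hx s m).symm.trans (by rw [h, map_zero])

/-- Sections that die over `U` are, after extension to a chart, killed by an element of `S i`. Such
an element is a non-zero-divisor and acts injectively because the stalks are projective. -/
theorem TwistableCover.mono_unit (T : TwistableCover j) {M : X.Modules} (hM : M.IsQuasicoherent)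
    (hM' : StalksProjective M) :
    Mono ((Scheme.Modules.pullbackPushforwardAdjunction j).unit.app M) := by
  refine mono_of_injective _ fun O m hm ↦ section_ext M _ _ fun x hx ↦ ?_
  obtain ⟨i, hi⟩ := T.exists_mem x
  obtain ⟨a, hle, hxa⟩ := exists_basicOpen (T.isAffineOpen i) hi hx
  refine ⟨_, hle, hxa, ?_⟩
  have hloc := isLocalizingOn_of_isQuasicoherent M hM (T.isAffineOpen i)
  obtain ⟨n, t, ht⟩ := hloc.exists_lift a (M.presheaf.map (homOfLE hle).op m)
  have h1 : unitSections j M _ (M.presheaf.map (homOfLE (X.basicOpen_le a)).op t) = 0 := by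
    rw [ht, unitSections_smul, unitSections_map]
    change _ • ((Scheme.Modules.pullback j).obj M).presheaf.map _
      (((Scheme.Modules.pullbackPushforwardAdjunction j).unit.app M).app O m) = _
    rw [hm]
    exact (congrArg _ (map_zero _)).trans (smul_zero _)
  -- The preimage of the basic open subset of `a` is the basic open subset of the pulled-back
  -- function, so a power of that function kills the section over the whole preimage of the chart.
  have h2 : ∃ k : ℕ, (j.app (T.V i) a) ^ k • unitSections j M _ t = 0 := by
    refine (isLocalizingOn_of_isQuasicoherent _ (T.isQuasicoherent_pullback hM)
      (T.isAffineOpen_preimage i)).exists_pow_smul_eq_zero (j.app (T.V i) a) _ ?_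
    rw [unitSections_map] at h1
    have h3 := congrArg (((Scheme.Modules.pullback j).obj M).presheaf.map
      (homOfLE (j.preimage_basicOpen a).ge).op) h1
    rw [← Functor.map_comp_apply, map_zero] at h3
    exact h3
  obtain ⟨k, hk⟩ := h2
  rw [← map_pow, ← unitSections_smul] at hk
  obtain ⟨s, hs, hs0⟩ := (T.localization hM i).2 _ hk
  have h4 := hM'.smul_eq_zero (T.isAffineOpen i) (T.le_nonZeroDivisors i hs) hs0
  have h5 := congrArg (M.presheaf.map (homOfLE (X.basicOpen_le a)).op) h4
  rw [Scheme.Modules.map_smul, ht, map_zero] at h5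
  rw [map_zero]
  exact (isUnit_res_basicOpen a n).smul_eq_zero.mp ((isUnit_res_basicOpen a k).smul_eq_zero.mp h5)

end

end

/-! ### Submodules defined by stalks and twists by an invertible ideal -/

section

variable {X : Scheme.{u}}

section StalkwiseSubmodule

variable (M : X.Modules) (E : ∀ x : X, Submodule (X.presheaf.stalk x) (M.presheaf.stalk x))

/-- The presheaf of sections of `M` all of whose germs lie in given submodules of the stalks. -/
def stalkwisePresheaf : PresheafOfModules.Submodule M.val where
  obj O :=
    { carrier := {m | ∀ x (hx : x ∈ O.unop), M.presheaf.germ O.unop x hx m ∈ E x}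
      add_mem' := fun {m m'} hm hm' x hx ↦ by
        have e := map_add (M.presheaf.germ O.unop x hx).hom m m'
        exact (congrArg (· ∈ E x) e).mpr ((E x).add_mem (hm x hx) (hm' x hx))
      zero_mem' := fun x hx ↦ by
        have := (E x).zero_mem
        rwa [← map_zero (M.presheaf.germ O.unop x hx).hom] at this
      smul_mem' := fun r m hm x hx ↦ by
        have := (E x).smul_mem (X.presheaf.germ O.unop x hx r) (hm x hx)
        rwa [← stalk_germ_smul M x O.unop hx r m] at this }
  map {O O'} i := fun m hm x hx ↦ by
    have h := M.presheaf.germ_res_apply i.unop x hx m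
    exact h.symm ▸ hm x (leOfHom i.unop hx)

theorem stalkwisePresheaf_isSheaf :
    TopCat.Presheaf.IsSheaf (stalkwisePresheaf M E).toPresheafOfModules.presheaf := by
  rw [TopCat.Presheaf.isSheaf_iff_isSheafUniqueGluing]
  intro ι O sf hsf
  obtain ⟨s, hs, huniq⟩ := M.isSheaf.isSheafUniqueGluing O (fun i ↦ (sf i).val)
    fun i j ↦ congrArg Subtype.val (hsf i j)
  refine ⟨⟨s, fun x hx ↦ ?_⟩, fun i ↦ Subtype.ext (hs i), fun s' hs' ↦ Subtype.ext ?_⟩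
  · obtain ⟨i, hi⟩ := TopologicalSpace.Opens.mem_iSup.mp hx
    have h := (sf i).2 x hi
    have h' := M.presheaf.germ_res_apply (TopologicalSpace.Opens.leSupr O i) x hi s
    rw [hs i] at h'
    exact h' ▸ h
  · exact huniq _ fun i ↦ congrArg Subtype.val (hs' i)

/-- The submodule of `M` of the sections all of whose germs lie in given submodules of the
stalks. -/
def stalkwise : X.Modules :=
  { val := (stalkwisePresheaf M E).toPresheafOfModules
    isSheaf := stalkwisePresheaf_isSheaf M E }

def stalkwiseι : stalkwise M E ⟶ M :=
  SheafOfModules.Hom.mk (stalkwisePresheaf M E).ι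

variable {M E}

theorem stalkwiseι_germ_mem (O : X.Opens) (m : Γ(stalkwise M E, O)) (x : X) (hx : x ∈ O) :
    M.presheaf.germ O x hx ((stalkwiseι M E).app O m) ∈ E x :=
  m.2 x hx

theorem exists_stalkwiseι_eq (O : X.Opens) (m : Γ(M, O))
    (h : ∀ x (hx : x ∈ O), M.presheaf.germ O x hx m ∈ E x) :
    ∃ m', (stalkwiseι M E).app O m' = m :=
  ⟨⟨m, h⟩, rfl⟩

instance : Mono (stalkwiseι M E) :=
  mono_of_injective _ fun _ _ h ↦ Subtype.ext h

theorem exists_stalkwiseMap {N : X.Modules}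
    {E' : ∀ x : X, Submodule (X.presheaf.stalk x) (N.presheaf.stalk x)} (f : M ⟶ N)
    (h : ∀ x, E x ≤ (E' x).comap (stalkLinearMap f x)) :
    ∃ f' : stalkwise M E ⟶ stalkwise N E', f' ≫ stalkwiseι N E' = stalkwiseι M E ≫ f :=
  exists_lift_of_locally _ _ fun O m x hx ↦ ⟨O, le_rfl, hx, by
    refine exists_stalkwiseι_eq O _ fun y hy ↦ ?_
    have h1 := h y (stalkwiseι_germ_mem O ((stalkwise M E).presheaf.map (homOfLE le_rfl).op m) y hy)
    rw [Submodule.mem_comap, stalkLinearMap_germ] at h1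
    exact h1⟩

end StalkwiseSubmodule

section Twist

variable (D : ∀ x : X, Ideal (X.presheaf.stalk x))

/-- The family of ideals `D` of the local rings is locally generated by a non-zero-divisor. -/
def IsInvertibleFamily : Prop :=
  ∀ x : X, ∃ (W : X.Opens) (_ : x ∈ W) (f : Γ(X, W)), ∀ (y : X) (hy : y ∈ W),
    X.presheaf.germ W y hy f ∈ nonZeroDivisors (X.presheaf.stalk y) ∧
    D y = Ideal.span {X.presheaf.germ W y hy f}

/-- The submodule `D M` of `M`. -/
abbrev twist (M : X.Modules) : X.Modules := stalkwise M fun x ↦ D x • ⊤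

abbrev twistι (M : X.Modules) : twist D M ⟶ M := stalkwiseι M _

theorem exists_twistMap {M N : X.Modules} (f : M ⟶ N) :
    ∃ f' : twist D M ⟶ twist D N, f' ≫ twistι D N = twistι D M ≫ f :=
  exists_stalkwiseMap f fun x ↦ by
    rw [← Submodule.map_le_iff_le_comap, Submodule.map_smul'']
    exact Submodule.smul_mono le_rfl le_top

def twistMap {M N : X.Modules} (f : M ⟶ N) : twist D M ⟶ twist D N := (exists_twistMap D f).choose

theorem twistMap_twistι {M N : X.Modules} (f : M ⟶ N) :
    twistMap D f ≫ twistι D N = twistι D M ≫ f := (exists_twistMap D f).choose_spec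

theorem twistι_app_twistMap {M N : X.Modules} (f : M ⟶ N) (O : X.Opens) (m : Γ(twist D M, O)) :
    (twistι D N).app O ((twistMap D f).app O m) = f.app O ((twistι D M).app O m) :=
  congr(Scheme.Modules.Hom.app $(twistMap_twistι D f) O m)

theorem twistMap_id (M : X.Modules) : twistMap D (𝟙 M) = 𝟙 _ := by
  rw [← cancel_mono (twistι D M), twistMap_twistι, Category.id_comp, Category.comp_id]

theorem twistMap_comp {M N K : X.Modules} (f : M ⟶ N) (g : N ⟶ K) :
    twistMap D (f ≫ g) = twistMap D f ≫ twistMap D g := by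
  rw [← cancel_mono (twistι D K), twistMap_twistι, Category.assoc, twistMap_twistι,
    ← Category.assoc, ← Category.assoc, twistMap_twistι]

theorem mem_smul_top_of_span {R M : Type*} [CommRing R] [AddCommGroup M] [Module R M] {I : Ideal R}
    {r : R} (h : I = Ideal.span {r}) {m : M} : m ∈ I • (⊤ : Submodule R M) ↔ ∃ m', r • m' = m := by
  rw [h, Submodule.ideal_span_singleton_smul, Submodule.mem_smul_pointwise_iff_exists]
  simp

variable {D} {M : X.Modules}

/-- Multiplication by a local generator of `D`. -/
theorem existsUnique_smul_eq {W : X.Opens} {f : Γ(X, W)}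
    (hf : ∀ (y : X) (hy : y ∈ W), X.presheaf.germ W y hy f ∈ nonZeroDivisors (X.presheaf.stalk y) ∧
    D y = Ideal.span {X.presheaf.germ W y hy f}) (hM : StalksProjective M)
    {O : X.Opens} (hO : O ≤ W) (m : Γ(twist D M, O)) :
    ∃! p : Γ(M, O), X.presheaf.map (homOfLE hO).op f • p = (twistι D M).app O m := by
  -- Division by `f` is unique since its germs are non-zero-divisors acting on projective stalks.
  -- This gives both the compatibility needed to glue local quotients and the final uniqueness.
  have huniq (O' : X.Opens) (hO' : O' ≤ W) (p p' : Γ(M, O'))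
      (h : X.presheaf.map (homOfLE hO').op f • p = X.presheaf.map (homOfLE hO').op f • p') :
      p = p' := by
    rw [← sub_eq_zero, ← smul_sub] at h
    rw [← sub_eq_zero]
    refine eq_zero_of_germ_eq_zero M _ fun x hx ↦ ?_
    have := hM x
    refine smul_eq_zero_of_projective (hf x (hO' hx)).1 ?_
    have h1 := stalk_germ_smul M x O' hx (X.presheaf.map (homOfLE hO').op f) (p - p')
    rw [h, map_zero, X.presheaf.germ_res_apply] at h1
    exact h1.symm
  have hloc (x : O) : ∃ (O' : X.Opens) (hO' : O' ≤ O) (_ : x.1 ∈ O') (p : Γ(M, O')),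
      X.presheaf.map (homOfLE (hO'.trans hO)).op f • p =
        M.presheaf.map (homOfLE hO').op ((twistι D M).app O m) := by
    obtain ⟨p, hp⟩ := (mem_smul_top_of_span (hf x (hO x.2)).2).mp (stalkwiseι_germ_mem O m x x.2)
    obtain ⟨O₁, hx₁, hO₁, p, rfl⟩ := exists_germ_eq_of_affine M x.1 p O x.2
    have h1 := stalk_germ_smul M x O₁.1 hx₁ (X.presheaf.map (homOfLE (hO₁.trans hO)).op f) p
    rw [X.presheaf.germ_res_apply, hp, ← germ_map M hO₁ hx₁, ← sub_eq_zero, ← map_sub] at h1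
    obtain ⟨O', hO', hx', h'⟩ := germ_eq_zero M x.1 O₁.1 hx₁ _ h1
    refine ⟨O', hO'.trans hO₁, hx', M.presheaf.map (homOfLE hO').op p, ?_⟩
    rw [map_sub, Scheme.Modules.map_smul, sub_eq_zero, ← Functor.map_comp_apply,
      ← Functor.map_comp_apply] at h'
    exact h'
  choose O' hO' hx' p hp using hloc
  have hsup : ⨆ x, O' x = O := by
    refine le_antisymm (iSup_le hO') fun x hx ↦ ?_
    exact TopologicalSpace.Opens.mem_iSup.mpr ⟨⟨x, hx⟩, hx' ⟨x, hx⟩⟩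
  obtain ⟨q, hq, -⟩ := M.isSheaf.isSheafUniqueGluing O' p fun x y ↦ by
    refine huniq _ (inf_le_left.trans ((hO' x).trans hO)) _ _ ?_
    have h1 := congrArg (M.presheaf.map (TopologicalSpace.Opens.infLELeft (O' x) (O' y)).op) (hp x)
    have h2 := congrArg (M.presheaf.map (TopologicalSpace.Opens.infLERight (O' x) (O' y)).op) (hp y)
    rw [Scheme.Modules.map_smul, ← Functor.map_comp_apply, ← Functor.map_comp_apply] at h1 h2
    exact h1.trans h2.symm
  let q' : Γ(M, O) := M.presheaf.map (homOfLE hsup.ge).op q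
  have hq' (x : O) : M.presheaf.map (homOfLE (hO' x)).op q' = p x := by
    rw [← hq x, ← Functor.map_comp_apply]
    rfl
  refine ⟨q', section_ext M _ _ fun x hx ↦ ⟨O' ⟨x, hx⟩, hO' _, hx' ⟨x, hx⟩, ?_⟩, fun p' hp' ↦ ?_⟩
  · rw [Scheme.Modules.map_smul, hq', ← hp, ← Functor.map_comp_apply]
    rfl
  · refine section_ext M _ _ fun x hx ↦ ⟨O' ⟨x, hx⟩, hO' _, hx' ⟨x, hx⟩, ?_⟩
    refine huniq _ ((hO' _).trans hO) _ _ ?_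
    rw [hq', hp, ← hp', Scheme.Modules.map_smul, ← Functor.map_comp_apply]
    rfl

theorem exists_twistι_eq_smul {W : X.Opens} {f : Γ(X, W)}
    (hf : ∀ (y : X) (hy : y ∈ W), X.presheaf.germ W y hy f ∈ nonZeroDivisors (X.presheaf.stalk y) ∧
    D y = Ideal.span {X.presheaf.germ W y hy f})
    {O : X.Opens} (hO : O ≤ W) (p : Γ(M, O)) :
    ∃ m, (twistι D M).app O m = X.presheaf.map (homOfLE hO).op f • p := by
  refine exists_stalkwiseι_eq O _ fun x hx ↦ (mem_smul_top_of_span (hf x (hO hx)).2).mpr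
    ⟨M.presheaf.germ O x hx p, ?_⟩
  have h1 := stalk_germ_smul M x O hx (X.presheaf.map (homOfLE hO).op f) p
  rw [X.presheaf.germ_res_apply] at h1
  exact h1.symm

end Twist

end

/-! ### Twists of locally projective modules -/

section

variable {X : Scheme.{u}}

section

variable {D : ∀ x : X, Ideal (X.presheaf.stalk x)}

/-- Multiplication by the local generator `f` identifies `M` with its twist over `V`, so the
property is inherited from `M`. -/
theorem isLocalizingOn_twist {M : X.Modules} (hM : M.IsQuasicoherent) (hM' : StalksProjective M)
    {W : X.Opens} {f : Γ(X, W)}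
    (hf : ∀ (y : X) (hy : y ∈ W), X.presheaf.germ W y hy f ∈ nonZeroDivisors (X.presheaf.stalk y) ∧
    D y = Ideal.span {X.presheaf.germ W y hy f}) {V : X.Opens} (hV : IsAffineOpen V) (hVW : V ≤ W) :
    IsLocalizingOn (twist D M) V := by
  have hloc := isLocalizingOn_of_isQuasicoherent M hM hV
  constructor
  · intro a s
    obtain ⟨p, hp, -⟩ := existsUnique_smul_eq hf hM' ((X.basicOpen_le a).trans hVW) s
    obtain ⟨n, t, ht⟩ := hloc.exists_lift a p
    obtain ⟨t', ht'⟩ := exists_twistι_eq_smul hf hVW t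
    refine ⟨n, t', app_injective (twistι D M) _ ?_⟩
    rw [app_map, ht', Scheme.Modules.map_smul, ht, Scheme.Modules.Hom.app_smul, ← hp, smul_comm,
      ← Functor.map_comp_apply]
    rfl
  · intro a t ht
    have h1 := congrArg ((twistι D M).app _) ht
    rw [app_map, map_zero] at h1
    obtain ⟨n, hn⟩ := hloc.exists_pow_smul_eq_zero a _ h1
    refine ⟨n, app_injective (twistι D M) _ ?_⟩
    rw [Scheme.Modules.Hom.app_smul, hn, map_zero]

theorem isQuasicoherent_twist (hD : IsInvertibleFamily D) {M : X.Modules} (hM : M.IsQuasicoherent)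
    (hM' : StalksProjective M) : (twist D M).IsQuasicoherent := by
  have h (x : X) : ∃ V : X.Opens, IsAffineOpen V ∧ x ∈ V ∧ IsLocalizingOn (twist D M) V := by
    obtain ⟨W, hxW, f, hf⟩ := hD x
    obtain ⟨_, ⟨V, hV, rfl⟩, hxV, hVW⟩ :=
      X.isBasis_affineOpens.exists_subset_of_mem_open (show x ∈ (W : Set X) from hxW) W.2
    exact ⟨V, hV, hxV, isLocalizingOn_twist hM hM' hf hV hVW⟩
  choose V hV hxV hloc using h
  exact isQuasicoherent_of_isLocalizingOn _ V hV
    (eq_top_iff.mpr fun x _ ↦ TopologicalSpace.Opens.mem_iSup.mpr ⟨x, hxV x⟩) hloc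

theorem isCoherentModule_twist [IsLocallyNoetherian X] (hD : IsInvertibleFamily D) {M : X.Modules}
    (hM : IsCoherentModule M) (hM' : StalksProjective M) : IsCoherentModule (twist D M) :=
  ⟨isQuasicoherent_twist hD hM.1 hM', finite_sections_of_mono (twistι D M) hM.2⟩

/-- Locally the twisted sequence is the original one multiplied by a generator of `D`.
Torsion-freeness of the quotient is what makes the part of `S.X₁` lying in the twist of `S.X₂` equal
to the twist of `S.X₁`. -/
theorem shortExact_twist (hD : IsInvertibleFamily D) {S : ShortComplex X.Modules}
    (hS : S.ShortExact) (h₃ : StalksProjective S.X₃)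
    (hq₂ : S.X₂.IsQuasicoherent) (hq₃ : S.X₃.IsQuasicoherent)
    (w : twistMap D S.f ≫ twistMap D S.g = 0) :
    (ShortComplex.mk (twistMap D S.f) (twistMap D S.g) w).ShortExact := by
  have := hS.mono_f
  have := hS.epi_g
  refine shortExact_of_sections _ (fun O m hm ↦ ?_) (fun O m hm ↦ ?_) (fun O n x hx ↦ ?_)
  · change (twistMap D S.f).app O m = 0 at hm
    refine app_injective (twistι D S.X₁) _ (app_injective S.f _ ?_)
    rw [← twistι_app_twistMap, hm, map_zero, map_zero, map_zero]
  · change (twistMap D S.g).app O m = 0 at hm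
    change ∃ m', (twistMap D S.f).app O m' = m
    have h1 : S.g.app O ((twistι D S.X₂).app O m) = 0 := by
      rw [← twistι_app_twistMap, hm, map_zero]
    obtain ⟨k, hk⟩ := (sections_exact hS.exact O _).mp h1
    -- At `x` the image of `k` is a generator times some `p`. The image of `p` in the quotient is
    -- killed by the generator, hence is zero, so `p` comes from `S.X₁`.
    obtain ⟨k', rfl⟩ := exists_stalkwiseι_eq (E := fun x ↦ D x • ⊤) O k fun x hx ↦ by
      obtain ⟨W, hxW, f, hf⟩ := hD x
      have hfx := hf x hxW
      rw [mem_smul_top_of_span hfx.2]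
      obtain ⟨p, hp⟩ := (mem_smul_top_of_span hfx.2).mp (stalkwiseι_germ_mem O m x hx)
      have h2 : stalkLinearMap S.g x p = 0 := by
        have := h₃ x
        refine smul_eq_zero_of_projective hfx.1 ?_
        rw [← map_smul, hp, stalkLinearMap_germ, h1, map_zero]
      obtain ⟨q, hq⟩ := (stalkLinearMap_exact hS.exact x p).mp h2
      refine ⟨q, stalkLinearMap_injective S.f x ?_⟩
      rw [map_smul, hq, hp, stalkLinearMap_germ, hk]
    refine ⟨k', app_injective (twistι D S.X₂) _ ?_⟩
    rw [twistι_app_twistMap]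
    exact hk
  · obtain ⟨W, hxW, f, hf⟩ := hD x
    obtain ⟨_, ⟨V, hV, rfl⟩, hxV, hVW⟩ :=
      X.isBasis_affineOpens.exists_subset_of_mem_open
        (show x ∈ ((W ⊓ O : X.Opens) : Set X) from ⟨hxW, hx⟩) (W ⊓ O).2
    have hVO : V ≤ O := fun y hy ↦ (hVW hy).2
    have hVW' : V ≤ W := fun y hy ↦ (hVW hy).1
    obtain ⟨p, hp, -⟩ := existsUnique_smul_eq hf h₃ hVW'
        ((twist D S.X₃).presheaf.map (homOfLE hVO).op n)
    obtain ⟨q, rfl⟩ := app_surjective_of_epi S.g hq₂ hq₃ hV p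
    obtain ⟨m, hm⟩ := exists_twistι_eq_smul hf hVW' q
    refine ⟨V, hVO, hxV, m, ?_⟩
    change (twistMap D S.g).app V m = (twist D S.X₃).presheaf.map (homOfLE hVO).op n
    refine app_injective (twistι D S.X₃) _ ?_
    rw [twistι_app_twistMap, hm, Scheme.Modules.Hom.app_smul, hp]

theorem range_stalkLinearMap_twistι (M : X.Modules) (hD : IsInvertibleFamily D) (x : X) :
    LinearMap.range (stalkLinearMap (twistι D M) x) = D x • ⊤ := by
  ext p
  constructor
  · rintro ⟨m, rfl⟩
    obtain ⟨O, hx, m, rfl⟩ := (twist D M).presheaf.exists_germ_eq m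
    rw [stalkLinearMap_germ]
    exact stalkwiseι_germ_mem O m x hx
  · obtain ⟨W, hxW, f, hf⟩ := hD x
    rw [mem_smul_top_of_span (hf x hxW).2]
    rintro ⟨q, rfl⟩
    obtain ⟨O, hx, hOW, q, rfl⟩ := exists_germ_eq_of_affine M x q W hxW
    obtain ⟨m, hm⟩ := exists_twistι_eq_smul hf hOW q
    refine ⟨(twist D M).presheaf.germ O.1 x hx m, ?_⟩
    rw [stalkLinearMap_germ, hm]
    have h1 := stalk_germ_smul M x O hx (X.presheaf.map (homOfLE hOW).op f) q
    rw [X.presheaf.germ_res_apply] at h1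
    exact h1

variable {G : Type v} [Group G]

theorem locProj.stalksProjective {P : Action X.Modules G} (hP : locProj X G P) :
    StalksProjective P.V := fun x ↦ projective_of_projective_asModule (stalkRep P x) (hP.2 x)

variable (D) in
/-- The `𝒪_X G`-submodule `D P` of `P`. -/
def twistOG (P : Action X.Modules G) : Action X.Modules G where
  V := twist D P.V
  ρ :=
    { toFun g := twistMap D (P.ρ g)
      map_one' := by
        rw [map_one]
        exact twistMap_id D P.V
      map_mul' g h := by
        rw [map_mul]
        exact twistMap_comp D _ _ }

variable (D) in
def twistOGι (P : Action X.Modules G) : twistOG D P ⟶ P where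
  hom := twistι D P.V
  comm g := twistMap_twistι D (P.ρ g)

variable (D) in
def twistOGMap {P Q : Action X.Modules G} (f : P ⟶ Q) : twistOG D P ⟶ twistOG D Q where
  hom := twistMap D f.hom
  comm g := by
    change twistMap D (P.ρ g) ≫ twistMap D f.hom = twistMap D f.hom ≫ twistMap D (Q.ρ g)
    rw [← twistMap_comp, ← twistMap_comp, f.comm]

theorem twistOGMap_twistOGι {P Q : Action X.Modules G} (f : P ⟶ Q) :
    twistOGMap D f ≫ twistOGι D Q = twistOGι D P ≫ f := by
  ext1
  exact twistMap_twistι D f.hom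

instance (P : Action X.Modules G) : Mono (twistOGι D P) :=
  (Action.forget X.Modules G).mono_of_mono_map (inferInstanceAs (Mono (twistι D P.V)))

/-- On stalks, multiplication by the generator of `D x` is an equivariant isomorphism onto the stalk
of the twist. -/
theorem locProj_twistOG [IsLocallyNoetherian X] (hD : IsInvertibleFamily D) {P : Action X.Modules G}
    (hP : locProj X G P) : locProj X G (twistOG D P) := by
  refine ⟨isCoherentModule_twist hD hP.1 hP.stalksProjective, fun x ↦ ?_⟩
  have hmono : Mono (twistOGι D P).hom := inferInstanceAs (Mono (twistι D P.V))
  have hinj := stalkLinearMap_injective (twistOGι D P).hom x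
  have hrange : LinearMap.range (stalkLinearMap (twistOGι D P).hom x) = D x • ⊤ :=
    range_stalkLinearMap_twistι P.V hD x
  obtain ⟨W, hxW, f, hf⟩ := hD x
  set r := X.presheaf.germ W x hxW f
  have hproj := hP.stalksProjective x
  have h (p : P.V.presheaf.stalk x) : ∃ q, stalkLinearMap (twistOGι D P).hom x q = r • p := by
    change r • p ∈ LinearMap.range (stalkLinearMap (twistOGι D P).hom x)
    rw [hrange, mem_smul_top_of_span (hf x hxW).2]
    exact ⟨p, rfl⟩
  choose e he using h
  let e' : P.V.presheaf.stalk x →ₗ[X.presheaf.stalk x] (twistOG D P).V.presheaf.stalk x :=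
    { toFun := e
      map_add' p p' := hinj (by rw [map_add, he, he, he, smul_add])
      map_smul' a p := hinj (by rw [RingHom.id_apply, map_smul, he, he, smul_comm]) }
  refine projective_asModule_of_bijective (stalkRep P x) (stalkRep (twistOG D P) x) e'
    (fun a p ↦ hinj ?_) ⟨fun p p' h ↦ ?_, fun q ↦ ?_⟩ (hP.2 x)
  · rw [stalkLinearMap_comm]
    change stalkLinearMap (twistOGι D P).hom x (e _) =
      stalkRep P x a (stalkLinearMap (twistOGι D P).hom x (e p))
    rw [he, he, map_smul]
  · have h1 : r • p = r • p' := by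
      rw [← he, ← he]
      exact congrArg _ h
    rw [← sub_eq_zero] at h1 ⊢
    rw [← smul_sub] at h1
    exact smul_eq_zero_of_projective (hf x hxW).1 h1
  · have h1 : stalkLinearMap (twistOGι D P).hom x q ∈ D x •
      (⊤ : Submodule (X.presheaf.stalk x) (P.V.presheaf.stalk x)) := by
      rw [← hrange]
      exact ⟨q, rfl⟩
    obtain ⟨p, hp⟩ := (mem_smul_top_of_span (hf x hxW).2).mp h1
    exact ⟨p, hinj ((he p).trans hp)⟩

theorem shortExact_twistOG (hD : IsInvertibleFamily D) {S : ShortComplex (Action X.Modules G)}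
    (hS : S.ShortExact) (h₂ : locProj X G S.X₂) (h₃ : locProj X G S.X₃) :
    ∃ w, (ShortComplex.mk (twistOGMap D S.f) (twistOGMap D S.g) w).ShortExact := by
  have hV := shortExact_V hS
  have w : twistOGMap D S.f ≫ twistOGMap D S.g = 0 := by
    rw [← cancel_mono (twistOGι D S.X₃), Category.assoc, twistOGMap_twistOGι, ← Category.assoc,
      twistOGMap_twistOGι, Category.assoc, S.zero, comp_zero, zero_comp]
  exact ⟨w, shortExact_of_V (shortExact_twist hD hV h₃.stalksProjective h₂.1.1
    h₃.1.1 congr(Action.Hom.hom $w))⟩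

end

end

/-! ### Clearing denominators -/

section

/-- Compatibilities known over `U` pass to the lifts `k₁`, `k₂` after applying `F`; faithfulness
then brings them back to `X`. This yields equivariance of lifts and morphisms of short complexes. -/
theorem map_comp_eq_of_factor {C : Type*} {D : Type*} [Category* C] [Category* D] (F : C ⥤ D)
    {R₁ R₂ A₁ A₂ B₁ B₂ : C} {r : R₁ ⟶ R₂} {i₁ : R₁ ⟶ A₁} {i₂ : R₂ ⟶ A₂} {f : A₁ ⟶ A₂} {f' : B₁ ⟶ B₂}
    {k₁ : R₁ ⟶ B₁} {k₂ : R₂ ⟶ B₂} {α₁ : F.obj A₁ ⟶ F.obj B₁} {α₂ : F.obj A₂ ⟶ F.obj B₂}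
    (w : r ≫ i₂ = i₁ ≫ f) (h₁ : F.map k₁ = F.map i₁ ≫ α₁) (h₂ : F.map k₂ = F.map i₂ ≫ α₂)
    (h : F.map f ≫ α₂ = α₁ ≫ F.map f') : F.map (r ≫ k₂) = F.map (k₁ ≫ f') := by
  rw [F.map_comp, F.map_comp, h₁, h₂, Category.assoc, ← h, ← Category.assoc, ← F.map_comp, w,
    F.map_comp, Category.assoc]

variable {X U : Scheme.{u}} {j : U ⟶ X}

section

variable {D : ∀ x : X, Ideal (X.presheaf.stalk x)}

/-- On each chart an element `t` of `S i` with germs in `D` kills the cokernel of the inclusion; as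
`t` becomes a unit on `U`, the inverse image of that cokernel vanishes. -/
theorem TwistableCover.isIso_pullback_twistι (T : TwistableCover j) (hD : IsInvertibleFamily D)
    (ht : ∀ i, ∃ t ∈ T.S i, ∀ (x : X) (hx : x ∈ T.V i), X.presheaf.germ (T.V i) x hx t ∈ D x)
    {M : X.Modules} (hM : M.IsQuasicoherent) (hM' : StalksProjective M) :
    IsIso ((Scheme.Modules.pullback j).map (twistι D M)) := by
  let S : ShortComplex X.Modules := ShortComplex.mk (twistι D M) (cokernel.π (twistι D M))
    (cokernel.condition _)
  have hS : S.ShortExact :=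
    { exact := ShortComplex.exact_of_g_is_cokernel _ (cokernelIsCokernel _)
      mono_f := inferInstanceAs (Mono (twistι D M))
      epi_g := inferInstanceAs (Epi (cokernel.π (twistι D M))) }
  have := hS.epi_g
  have h₁ : S.X₁.IsQuasicoherent := isQuasicoherent_twist hD hM hM'
  have h₃ : S.X₃.IsQuasicoherent := isQuasicoherent_of_exact_of_epi hS.exact h₁ hM
  refine (T.isIso_pullback_iff hS h₁ hM).mpr ?_
  refine isZero_of_sections (T.isQuasicoherent_pullback h₃) _ T.isAffineOpen_preimage
    T.iSup_preimage fun i n ↦ ?_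
  obtain ⟨s, hs, c, hc⟩ := (T.localization h₃ i).1 n
  obtain ⟨t, ht, htD⟩ := ht i
  have htc : t • c = 0 := by
    obtain ⟨m, rfl⟩ := app_surjective_of_epi S.g hM h₃ (T.isAffineOpen i) c
    obtain ⟨m', hm'⟩ := exists_stalkwiseι_eq (E := fun x ↦ D x • ⊤) (T.V i) (t • m) fun x hx ↦ by
      have h1 := stalk_germ_smul M x (T.V i) hx t m
      exact h1 ▸ Submodule.smul_mem_smul (htD x hx) trivial
    rw [← Scheme.Modules.Hom.app_smul]
    refine (congrArg (S.g.app _) hm'.symm).trans ?_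
    exact congr(Scheme.Modules.Hom.app $(S.zero) _ m')
  have h0 : j.app (T.V i) t • (j.app (T.V i) s • n) = 0 := by
    rw [← hc, ← unitSections_smul, htc, map_zero]
  exact (T.isUnit_app hs).smul_eq_zero.mp ((T.isUnit_app ht).smul_eq_zero.mp h0)

/-- `s` is a common denominator of a morphism to `j_* j^* N` on the sections over the members of the
cover. -/
def TwistableCover.IsDenominator (T : TwistableCover j) {M N : X.Modules}
    (α : (Scheme.Modules.pullback j).obj M ⟶ (Scheme.Modules.pullback j).obj N)
    (s : ∀ i, Γ(X, T.V i)) : Prop :=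
  ∀ i (m : Γ(M, T.V i)), ∃ q : Γ(N, T.V i),
    ((Scheme.Modules.pullbackPushforwardAdjunction j).unit.app N).app _ q =
      s i • ((Scheme.Modules.pullbackPushforwardAdjunction j).homEquiv _ _ α).app _ m

theorem TwistableCover.IsDenominator.mul_left {T : TwistableCover j} {M N : X.Modules}
    {α : (Scheme.Modules.pullback j).obj M ⟶ (Scheme.Modules.pullback j).obj N}
    {s : ∀ i, Γ(X, T.V i)} (h : T.IsDenominator α s) (s' : ∀ i, Γ(X, T.V i)) :
    T.IsDenominator α (s' * s) := by
  intro i m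
  obtain ⟨q, hq⟩ := h i m
  exact ⟨s' i • q, by rw [Scheme.Modules.Hom.app_smul, hq, Pi.mul_apply, mul_smul]⟩

/-- The product of the denominators of a finite generating set of the sections over a chart works
for all of them. -/
theorem TwistableCover.exists_isDenominator (T : TwistableCover j) {M N : X.Modules}
    (hM : IsCoherentModule M) (hN : N.IsQuasicoherent)
    (α : (Scheme.Modules.pullback j).obj M ⟶ (Scheme.Modules.pullback j).obj N) :
    ∃ s : ∀ i, Γ(X, T.V i), (∀ i, s i ∈ T.S i) ∧ T.IsDenominator α s := by
  suffices h : ∀ i, ∃ s ∈ T.S i, ∀ m : Γ(M, T.V i), ∃ q : Γ(N, T.V i),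
      ((Scheme.Modules.pullbackPushforwardAdjunction j).unit.app N).app _ q =
        s • ((Scheme.Modules.pullbackPushforwardAdjunction j).homEquiv _ _ α).app _ m by
    choose s hs h using h
    exact ⟨s, hs, h⟩
  intro i
  let β := sectionsLinearMap ((Scheme.Modules.pullbackPushforwardAdjunction j).homEquiv _ _ α)
      (T.V i)
  let η := sectionsLinearMap ((Scheme.Modules.pullbackPushforwardAdjunction j).unit.app N) (T.V i)
  have h1 (m : Γ(M, T.V i)) : ∃ s ∈ T.S i, s • β m ∈ LinearMap.range η := by
    obtain ⟨s, hs, q, hq⟩ := (T.localization hN i).1 (β m)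
    exact ⟨s, hs, q, hq⟩
  choose d hd hd' using h1
  obtain ⟨F, hF⟩ := (hM.2 ⟨T.V i, T.isAffineOpen i⟩).fg_top
  classical
  refine ⟨∏ m ∈ F, d m, prod_mem fun m _ ↦ hd m, fun m ↦ ?_⟩
  have h2 : (⊤ : Submodule Γ(X, T.V i) Γ(M, T.V i)) ≤
      (LinearMap.range η).comap ((∏ m ∈ F, d m) • β) := by
    refine hF.ge.trans (Submodule.span_le.mpr fun m hm ↦ ?_)
    change (∏ m ∈ F, d m) • β m ∈ LinearMap.range η
    rw [← Finset.prod_erase_mul F d hm, mul_smul]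
    exact Submodule.smul_mem _ _ (hd' m)
  exact h2 (Submodule.mem_top (x := m))

/-- Locally a section of the twist is `s i` times a section of `M`, and `s i` clears the denominator
of `α`. Since `N` embeds in the direct image of its inverse image, being in `N` is a local
condition. -/
theorem TwistableCover.exists_lift_twist (T : TwistableCover j) {M N : X.Modules}
    (hM : M.IsQuasicoherent) (hN : N.IsQuasicoherent) (hN' : StalksProjective N)
    {α : (Scheme.Modules.pullback j).obj M ⟶ (Scheme.Modules.pullback j).obj N}
    {s : ∀ i, Γ(X, T.V i)} (hs : T.IsDenominator α s)
    (hD : ∀ i (x : X) (hx : x ∈ T.V i), D x ≤ Ideal.span {X.presheaf.germ (T.V i) x hx (s i)}) :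
    ∃ k : twist D M ⟶ N, (Scheme.Modules.pullback j).map k =
      (Scheme.Modules.pullback j).map (twistι D M) ≫ α := by
  let adj := Scheme.Modules.pullbackPushforwardAdjunction j
  let N' := (Scheme.Modules.pushforward j).obj ((Scheme.Modules.pullback j).obj N)
  let β : M ⟶ N' := adj.homEquiv _ _ α
  let η : N ⟶ N' := adj.unit.app N
  have : Mono η := T.mono_unit hN hN'
  obtain ⟨k, hk⟩ := exists_lift_of_locally (twistι D M ≫ β) η fun O m x hx ↦ by
    obtain ⟨i, hi⟩ := T.exists_mem x
    obtain ⟨p, hp⟩ := (mem_smul_top_of_span rfl).mp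
      (Submodule.smul_mono_left (hD i x hi) (stalkwiseι_germ_mem O m x hx))
    obtain ⟨O₁, hx₁, hO₁, p, rfl⟩ := exists_germ_eq_of_affine M x p (O ⊓ T.V i) ⟨hx, hi⟩
    have hO : O₁.1 ≤ O := fun y hy ↦ (hO₁ hy).1
    have hV : O₁.1 ≤ T.V i := fun y hy ↦ (hO₁ hy).2
    have h1 := stalk_germ_smul M x O₁.1 hx₁ (X.presheaf.map (homOfLE hV).op (s i)) p
    rw [X.presheaf.germ_res_apply, hp, ← germ_map M hO hx₁, ← sub_eq_zero, ← map_sub] at h1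
    obtain ⟨O', hO', hx', h'⟩ := germ_eq_zero M x O₁.1 hx₁ _ h1
    obtain ⟨a, hle, hxa⟩ := exists_basicOpen (T.isAffineOpen i) hi hx'
    have h2 : X.presheaf.map (homOfLE (X.basicOpen_le a)).op (s i) •
        M.presheaf.map (homOfLE (hle.trans hO')).op p =
        M.presheaf.map (homOfLE ((hle.trans hO').trans hO)).op ((twistι D M).app O m) := by
      have h3 := congrArg (M.presheaf.map (homOfLE hle).op) h'
      rw [map_zero, map_sub, map_sub, sub_eq_zero, Scheme.Modules.map_smul,
        Scheme.Modules.map_smul, ← Functor.map_comp_apply, ← Functor.map_comp_apply,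
        ← Functor.map_comp_apply, ← Functor.map_comp_apply, ← Functor.map_comp_apply] at h3
      exact h3
    -- The denominator is only known to work for sections over the whole chart, so `p` is extended
    -- to it up to a power of `a`, which is divided out again on the basic open subset.
    obtain ⟨n, t, ht⟩ := (isLocalizingOn_of_isQuasicoherent M hM (T.isAffineOpen i)).exists_lift a
      (M.presheaf.map (homOfLE (hle.trans hO')).op p)
    obtain ⟨q, hq⟩ : ∃ q, η.app _ q = s i • β.app _ t := hs i t
    obtain ⟨b, hb⟩ := isUnit_res_basicOpen a n
    refine ⟨X.basicOpen a, (hle.trans hO').trans hO, hxa,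
      b⁻¹ • N.presheaf.map (homOfLE (X.basicOpen_le a)).op q, ?_⟩
    have h4 : η.app _ (N.presheaf.map (homOfLE (X.basicOpen_le a)).op q) =
        b • (twistι D M ≫ β).app (X.basicOpen a)
          ((twist D M).presheaf.map (homOfLE ((hle.trans hO').trans hO)).op m) := by
      have hc (z) : (twistι D M ≫ β).app (X.basicOpen a) z =
        β.app (X.basicOpen a) ((twistι D M).app (X.basicOpen a) z) := rfl
      rw [hc]
      rw [app_map (twistι D M), ← h2, app_map η, hq, Scheme.Modules.map_smul, ← app_map, ht,
        Units.smul_def, hb, Scheme.Modules.Hom.app_smul, Scheme.Modules.Hom.app_smul, smul_comm]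
    rw [Units.smul_def, Scheme.Modules.Hom.app_smul, h4, ← Units.smul_def, inv_smul_smul]
  refine ⟨k, (adj.homEquiv _ _).injective ?_⟩
  rw [adj.homEquiv_naturality_left, ← hk, adj.homEquiv_unit]
  exact (adj.unit.naturality k).symm

end

section

variable {G : Type v} [Group G]

theorem isZero_of_V {A : Action X.Modules G} (h : IsZero A.V) : IsZero A := by
  rw [IsZero.iff_id_eq_zero] at h ⊢
  ext1
  exact h

theorem TwistableCover.isIso_pullbackOG_iff (T : TwistableCover j)
    {S : ShortComplex (Action X.Modules G)} (hS : S.ShortExact)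
    (h₁ : IsCoherentOG S.X₁) (h₂ : IsCoherentOG S.X₂) :
    IsIso ((pullbackOG G j).map S.f) ↔ IsZero ((pullbackOG G j).obj S.X₃) := by
  have h := T.isIso_pullback_iff (shortExact_V hS) h₁.1 h₂.1
  constructor
  · intro hf
    refine isZero_of_V (h.mp ?_)
    exact inferInstanceAs (IsIso ((Action.forget U.Modules G).map ((pullbackOG G j).map S.f)))
  · intro hz
    have : IsIso ((pullbackOG G j).map S.f).hom :=
      h.mpr ((Action.forget U.Modules G).map_isZero hz)
    exact Action.isIso_of_hom_isIso _

/-- By naturality, the composite of a morphism with the mono unit of `Q` depends only on its inverse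
image. -/
theorem TwistableCover.pullbackOG_map_injective (T : TwistableCover j) {P Q : Action X.Modules G}
    (hQ : locProj X G Q) {f f' : P ⟶ Q} (h : (pullbackOG G j).map f = (pullbackOG G j).map f') :
    f = f' := by
  let adj := Scheme.Modules.pullbackPushforwardAdjunction j
  have := T.mono_unit hQ.1.1 hQ.stalksProjective
  have h' : (Scheme.Modules.pullback j).map f.hom = (Scheme.Modules.pullback j).map f'.hom :=
    congr(Action.Hom.hom $h)
  ext1
  rw [← cancel_mono (adj.unit.app Q.V)]
  refine (adj.unit.naturality f.hom).trans (Eq.trans ?_ (adj.unit.naturality f'.hom).symm)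
  simp only [Functor.comp_map, h']

/-- The mono unit of `P` followed by the isomorphism induced by `f` factors through `f`. -/
theorem TwistableCover.mono_of_isIso_pullbackOG (T : TwistableCover j) {P Q : Action X.Modules G}
    (hP : locProj X G P) (f : P ⟶ Q) [IsIso ((pullbackOG G j).map f)] : Mono f := by
  let adj := Scheme.Modules.pullbackPushforwardAdjunction j
  have := T.mono_unit hP.1.1 hP.stalksProjective
  have h' : IsIso ((Scheme.Modules.pullback j).map f.hom) :=
    inferInstanceAs (IsIso ((Action.forget U.Modules G).map ((pullbackOG G j).map f)))
  have h := adj.unit.naturality f.hom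
  have hm : Mono (adj.unit.app P.V ≫
    (Scheme.Modules.pullback j ⋙ Scheme.Modules.pushforward j).map f.hom) :=
    mono_comp' this (inferInstanceAs (Mono ((Scheme.Modules.pushforward j).map
      ((Scheme.Modules.pullback j).map f.hom))))
  rw [← h] at hm
  have : Mono ((𝟭 X.Modules).map f.hom) := mono_of_mono _ (adj.unit.app Q.V)
  exact (Action.forget X.Modules G).mono_of_mono_map this

theorem TwistableCover.exists_lift_twistOG (T : TwistableCover j)
    {D : ∀ x : X, Ideal (X.presheaf.stalk x)} {P Q : Action X.Modules G}
    (hP : locProj X G P) (hQ : locProj X G Q) {α : (pullbackOG G j).obj P ⟶ (pullbackOG G j).obj Q}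
    {s : ∀ i, Γ(X, T.V i)} (hs : T.IsDenominator α.hom s)
    (hD : ∀ i (x : X) (hx : x ∈ T.V i), D x ≤ Ideal.span {X.presheaf.germ (T.V i) x hx (s i)}) :
    ∃ k : twistOG D P ⟶ Q, (pullbackOG G j).map k =
      (pullbackOG G j).map (twistOGι D P) ≫ α := by
  let adj := Scheme.Modules.pullbackPushforwardAdjunction j
  have := T.mono_unit hQ.1.1 hQ.stalksProjective
  obtain ⟨k, hk⟩ := T.exists_lift_twist hP.1.1 hQ.1.1 hQ.stalksProjective hs hD
  refine ⟨⟨k, fun g ↦ ?_⟩, Action.Hom.ext hk⟩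
  have hinj {A : X.Modules} {f f' : A ⟶ Q.V} (h : (Scheme.Modules.pullback j).map f =
      (Scheme.Modules.pullback j).map f') : f = f' := by
    rw [← cancel_mono (adj.unit.app Q.V)]
    refine (adj.unit.naturality f).trans (Eq.trans ?_ (adj.unit.naturality f').symm)
    simp only [Functor.comp_map, h]
  exact hinj (map_comp_eq_of_factor (Scheme.Modules.pullback j) ((twistOGι D P).comm g) hk hk
    (α.comm g))

theorem TwistableCover.isIso_pullbackOG_twistOGι (T : TwistableCover j)
    {D : ∀ x : X, Ideal (X.presheaf.stalk x)} (hD : IsInvertibleFamily D)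
    (ht : ∀ i, ∃ t ∈ T.S i, ∀ (x : X) (hx : x ∈ T.V i), X.presheaf.germ (T.V i) x hx t ∈ D x)
    {P : Action X.Modules G} (hP : locProj X G P) :
    IsIso ((pullbackOG G j).map (twistOGι D P)) := by
  have : IsIso ((pullbackOG G j).map (twistOGι D P)).hom :=
    T.isIso_pullback_twistι hD ht hP.1.1 hP.stalksProjective
  exact Action.isIso_of_hom_isIso _

/-- A morphism `j^* P ⟶ j^* Q` becomes the difference of two morphisms defined over `X`. -/
theorem TwistableCover.exists_refinement [IsLocallyNoetherian X] (T : TwistableCover j)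
    {P Q : Action X.Modules G} (hP : locProj X G P) (hQ : locProj X G Q)
    (α : (pullbackOG G j).obj P ⟶ (pullbackOG G j).obj Q) :
    ∃ (R : Action X.Modules G) (i : R ⟶ P) (h : R ⟶ Q), locProj X G R ∧
      IsIso ((pullbackOG G j).map i) ∧ (pullbackOG G j).map h = (pullbackOG G j).map i ≫ α := by
  obtain ⟨s, hs, hs'⟩ := T.exists_isDenominator hP.1 hQ.1.1 α.hom
  obtain ⟨D, hD, hDs, ht⟩ := T.exists_twist s hs
  obtain ⟨k, hk⟩ := T.exists_lift_twistOG hP hQ hs' hDs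
  exact ⟨twistOG D P, twistOGι D P, k, locProj_twistOG hD hP, T.isIso_pullbackOG_twistOGι hD ht hP,
      hk⟩

/-- Short exact sequences of triples can be refined simultaneously. -/
theorem TwistableCover.exists_refinement_shortExact [IsLocallyNoetherian X] (T : TwistableCover j)
    {S S' : ShortComplex (Action X.Modules G)} (hS : S.ShortExact)
    (h₁ : locProj X G S.X₁) (h₂ : locProj X G S.X₂) (h₃ : locProj X G S.X₃)
    (h₁' : locProj X G S'.X₁) (h₂' : locProj X G S'.X₂) (h₃' : locProj X G S'.X₃)
    {α₁ : (pullbackOG G j).obj S.X₁ ⟶ (pullbackOG G j).obj S'.X₁}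
    {α₂ : (pullbackOG G j).obj S.X₂ ⟶ (pullbackOG G j).obj S'.X₂}
    {α₃ : (pullbackOG G j).obj S.X₃ ⟶ (pullbackOG G j).obj S'.X₃}
    (hα₁₂ : (pullbackOG G j).map S.f ≫ α₂ = α₁ ≫ (pullbackOG G j).map S'.f)
    (hα₂₃ : (pullbackOG G j).map S.g ≫ α₃ = α₂ ≫ (pullbackOG G j).map S'.g) :
    ∃ (R : ShortComplex (Action X.Modules G)) (i : R ⟶ S) (h : R ⟶ S'), R.ShortExact ∧
      (locProj X G R.X₁ ∧ locProj X G R.X₂ ∧ locProj X G R.X₃) ∧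
      (IsIso ((pullbackOG G j).map i.τ₁) ∧ IsIso ((pullbackOG G j).map i.τ₂) ∧
        IsIso ((pullbackOG G j).map i.τ₃)) ∧
      (pullbackOG G j).map h.τ₁ = (pullbackOG G j).map i.τ₁ ≫ α₁ ∧
      (pullbackOG G j).map h.τ₂ = (pullbackOG G j).map i.τ₂ ≫ α₂ ∧
      (pullbackOG G j).map h.τ₃ = (pullbackOG G j).map i.τ₃ ≫ α₃ := by
  obtain ⟨s₁, hs₁, hs₁'⟩ := T.exists_isDenominator h₁.1 h₁'.1.1 α₁.hom
  obtain ⟨s₂, hs₂, hs₂'⟩ := T.exists_isDenominator h₂.1 h₂'.1.1 α₂.hom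
  obtain ⟨s₃, hs₃, hs₃'⟩ := T.exists_isDenominator h₃.1 h₃'.1.1 α₃.hom
  -- A common multiple of the three denominators, so that one ideal `D` twists all terms and the
  -- twisted sequence stays exact.
  obtain ⟨D, hD, hDs, ht⟩ := T.exists_twist (s₃ * s₂ * s₁) fun i ↦
    mul_mem (mul_mem (hs₃ i) (hs₂ i)) (hs₁ i)
  obtain ⟨k₁, hk₁⟩ := T.exists_lift_twistOG h₁ h₁' (hs₁'.mul_left (s₃ * s₂)) hDs
  obtain ⟨k₂, hk₂⟩ := T.exists_lift_twistOG h₂ h₂' (hs₂'.mul_left (s₃ * s₁))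
    (by convert hDs using 1; rw [mul_right_comm])
  obtain ⟨k₃, hk₃⟩ := T.exists_lift_twistOG h₃ h₃' (hs₃'.mul_left (s₂ * s₁))
    (by convert hDs using 1; rw [mul_comm, mul_assoc])
  obtain ⟨w, hR⟩ := shortExact_twistOG hD hS h₂ h₃
  refine ⟨_, ⟨twistOGι D S.X₁, twistOGι D S.X₂, twistOGι D S.X₃, (twistOGMap_twistOGι _).symm,
    (twistOGMap_twistOGι _).symm⟩, ⟨k₁, k₂, k₃, T.pullbackOG_map_injective h₂' ?_,
    T.pullbackOG_map_injective h₃' ?_⟩, hR, ⟨locProj_twistOG hD h₁, locProj_twistOG hD h₂,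
    locProj_twistOG hD h₃⟩, ⟨T.isIso_pullbackOG_twistOGι hD ht h₁,
    T.isIso_pullbackOG_twistOGι hD ht h₂, T.isIso_pullbackOG_twistOGι hD ht h₃⟩, hk₁, hk₂, hk₃⟩
  · exact (map_comp_eq_of_factor _ (twistOGMap_twistOGι _) hk₁ hk₂ hα₁₂).symm
  · exact (map_comp_eq_of_factor _ (twistOGMap_twistOGι _) hk₂ hk₃ hα₂₃).symm

end

end

/-! ### Exact sequences in abelian categories and universal properties of the two groups -/

section

section Abelian

variable {C : Type w} [Category.{v} C] [Abelian C]

theorem shortExact_of_exists_lift {A B E : C} (f : A ⟶ B) (g : B ⟶ E) (w : f ≫ g = 0) [Mono f]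
    [Epi g] (h : ∀ ⦃Z : C⦄ (z : Z ⟶ B), z ≫ g = 0 → ∃ l, l ≫ f = z) :
    (ShortComplex.mk f g w).ShortExact where
  exact := by
    rw [ShortComplex.exact_iff_exact_up_to_refinements]
    intro Z z hz
    obtain ⟨l, hl⟩ := h z hz
    exact ⟨Z, 𝟙 Z, inferInstance, l, by rw [Category.id_comp]; exact hl.symm⟩
  mono_f := ‹_›
  epi_g := ‹_›

theorem shortExact_of_exists_desc {A B E : C} (f : A ⟶ B) (g : B ⟶ E) (w : f ≫ g = 0) [Mono f]
    [Epi g] (h : ∀ ⦃Z : C⦄ (z : B ⟶ Z), f ≫ z = 0 → ∃ l, g ≫ l = z) :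
    (ShortComplex.mk f g w).ShortExact where
  exact := ShortComplex.exact_of_g_is_cokernel _
    (CokernelCofork.IsColimit.ofπ' _ _ fun z hz ↦ ⟨(h z hz).choose, (h z hz).choose_spec⟩)
  mono_f := ‹_›
  epi_g := ‹_›

theorem shortExact_kernel {A B : C} (g : A ⟶ B) [Epi g] :
    (ShortComplex.mk (kernel.ι g) g (kernel.condition g)).ShortExact :=
  shortExact_of_exists_lift _ _ _ fun _ z hz ↦ ⟨kernel.lift g z hz, kernel.lift_ι g z hz⟩

theorem shortExact_cokernel {A B : C} (f : A ⟶ B) [Mono f] :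
    (ShortComplex.mk f (cokernel.π f) (cokernel.condition f)).ShortExact :=
  shortExact_of_exists_lift _ _ _ fun _ z hz ↦
      ⟨Abelian.monoLift f z hz, Abelian.monoLift_comp f z hz⟩

theorem CategoryTheory.ShortComplex.ShortExact.exists_lift {S : ShortComplex C} (hS : S.ShortExact)
    {Z : C} (z : Z ⟶ S.X₂) (hz : z ≫ S.g = 0) : ∃ l, l ≫ S.f = z := by
  have := hS.mono_f
  exact ⟨hS.exact.lift z hz, hS.exact.lift_f z hz⟩

/-- An epimorphism of extensions of the same object has the same kernel as its middle component. -/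
theorem exists_shortExact_kernel {S₁ S₂ : ShortComplex C} (h₁ : S₁.ShortExact)
    (h₂ : S₂.ShortExact) (p : S₁.X₁ ⟶ S₂.X₁) (q : S₁.X₂ ⟶ S₂.X₂) [Epi q] (r : S₁.X₃ ⟶ S₂.X₃)
        [Mono r]
    (hpq : p ≫ S₂.f = S₁.f ≫ q) (hq : q ≫ S₂.g = S₁.g ≫ r) :
    ∃ (k : kernel q ⟶ S₁.X₁) (w : k ≫ p = 0), k ≫ S₁.f = kernel.ι q ∧
      (ShortComplex.mk k p w).ShortExact := by
  have := h₁.mono_f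
  have := h₂.mono_f
  obtain ⟨k, hk⟩ := h₁.exists_lift (kernel.ι q) (by
    rw [← cancel_mono r, Category.assoc, ← hq, kernel.condition_assoc, zero_comp, zero_comp])
  have w : k ≫ p = 0 := by
    rw [← cancel_mono S₂.f, Category.assoc, hpq, ← Category.assoc, hk, kernel.condition, zero_comp]
  have : Mono k := mono_of_mono_fac hk
  have : Epi p := by
    rw [epi_iff_surjective_up_to_refinements]
    intro A y
    obtain ⟨A', π, hπ, x, hx⟩ := surjective_up_to_refinements_of_epi q (y ≫ S₂.f)
    obtain ⟨x', hx'⟩ := h₁.exists_lift x (by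
      rw [← cancel_mono r, Category.assoc, ← hq, ← Category.assoc, ← hx, Category.assoc,
        Category.assoc, S₂.zero, comp_zero, comp_zero, zero_comp])
    refine ⟨A', π, hπ, x', ?_⟩
    rw [← cancel_mono S₂.f, Category.assoc, Category.assoc, hx, hpq, ← Category.assoc, hx']
  refine ⟨k, w, hk, shortExact_of_exists_lift _ _ _ fun Z z hz ↦ ?_⟩
  refine ⟨kernel.lift q (z ≫ S₁.f) ?_, ?_⟩
  · rw [Category.assoc, ← hpq, ← Category.assoc, hz, zero_comp]
  · rw [← cancel_mono S₁.f, Category.assoc, hk, kernel.lift_ι]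

theorem shortExact_pullback_fst {S : ShortComplex C} (hS : S.ShortExact) {Q : C} (g : Q ⟶ S.X₃) :
    ∃ (k : S.X₁ ⟶ pullback g S.g) (w : k ≫ pullback.fst g S.g = 0),
      (ShortComplex.mk k (pullback.fst g S.g) w).ShortExact := by
  have := hS.mono_f
  have := hS.epi_g
  have w : pullback.lift (f := g) 0 S.f (by rw [zero_comp, S.zero]) ≫ pullback.fst g S.g = 0 :=
    pullback.lift_fst _ _ _
  have : Mono (pullback.lift (f := g) 0 S.f (by rw [zero_comp, S.zero])) :=
    mono_of_mono_fac (pullback.lift_snd _ _ _)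
  refine ⟨_, w, shortExact_of_exists_lift _ _ _ fun Z z hz ↦ ?_⟩
  obtain ⟨l, hl⟩ := hS.exists_lift (z ≫ pullback.snd _ _) (by
    rw [Category.assoc, ← pullback.condition, ← Category.assoc, hz, zero_comp])
  refine ⟨l, pullback.hom_ext ?_ ?_⟩
  · rw [Category.assoc, pullback.lift_fst, comp_zero, hz]
  · rw [Category.assoc, pullback.lift_snd, hl]

theorem shortExact_pullback_snd {S : ShortComplex C} (hS : S.ShortExact) {Q : C} (g : Q ⟶ S.X₃) :
    ∃ (k : S.X₁ ⟶ pullback S.g g) (w : k ≫ pullback.snd S.g g = 0),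
      (ShortComplex.mk k (pullback.snd S.g g) w).ShortExact := by
  have := hS.mono_f
  have := hS.epi_g
  have w : pullback.lift (g := g) S.f 0 (by rw [zero_comp, S.zero]) ≫ pullback.snd S.g g = 0 :=
    pullback.lift_snd _ _ _
  have : Mono (pullback.lift (g := g) S.f 0 (by rw [zero_comp, S.zero])) :=
    mono_of_mono_fac (pullback.lift_fst _ _ _)
  refine ⟨_, w, shortExact_of_exists_lift _ _ _ fun Z z hz ↦ ?_⟩
  obtain ⟨l, hl⟩ := hS.exists_lift (z ≫ pullback.fst _ _) (by
    rw [Category.assoc, pullback.condition, ← Category.assoc, hz, zero_comp])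
  refine ⟨l, pullback.hom_ext ?_ ?_⟩
  · rw [Category.assoc, pullback.lift_fst, hl]
  · rw [Category.assoc, pullback.lift_snd, comp_zero, hz]

/-- Exhibits the fibre product as a kernel of a map from a direct sum, which is how its coherence is
obtained. -/
theorem shortExact_pullback_biprod {A B V : C} (f : A ⟶ V) (g : B ⟶ V) [Epi g] :
    ∃ w, (ShortComplex.mk (biprod.lift (pullback.fst f g) (pullback.snd f g))
      (biprod.desc f (-g)) w).ShortExact := by
  have w : biprod.lift (pullback.fst f g) (pullback.snd f g) ≫ biprod.desc f (-g) = 0 := by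
    rw [biprod.lift_desc, pullback.condition, Preadditive.comp_neg, add_neg_cancel]
  have : Mono (biprod.lift (pullback.fst f g) (pullback.snd f g)) := by
    refine ⟨fun x y h ↦ pullback.hom_ext ?_ ?_⟩
    · simpa using congrArg (· ≫ biprod.fst) h
    · simpa using congrArg (· ≫ biprod.snd) h
  have : Epi (biprod.desc f (-g)) := by
    have : Epi (-g) := ⟨fun x y h ↦ by simpa [cancel_epi] using h⟩
    exact epi_of_epi_fac (biprod.inr_desc f (-g))
  refine ⟨w, shortExact_of_exists_lift _ _ _ fun Z z hz ↦ ?_⟩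
  have hz' : (z ≫ biprod.fst) ≫ f = (z ≫ biprod.snd) ≫ g := by
    rw [← sub_eq_zero, ← hz]
    have e : z = biprod.lift (z ≫ biprod.fst) (z ≫ biprod.snd) := by ext <;> simp
    conv_rhs => rw [e]
    rw [biprod.lift_desc, Preadditive.comp_neg, sub_eq_add_neg]
  refine ⟨pullback.lift _ _ hz', biprod.hom_ext _ _ ?_ ?_⟩
  · rw [Category.assoc, biprod.lift_fst]
    exact pullback.lift_fst _ _ _
  · rw [Category.assoc, biprod.lift_snd]
    exact pullback.lift_snd _ _ _

/-- The third isomorphism theorem. Injectivity on the left is where `g` must be mono: an element of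
`B` whose image lies in the image of `f ≫ g` already lies in the image of `f`. -/
theorem shortExact_cokernel_comp {A B E : C} (f : A ⟶ B) (g : B ⟶ E) [Mono g] :
    ∃ (a : cokernel f ⟶ cokernel (f ≫ g)) (b : cokernel (f ≫ g) ⟶ cokernel g) (w : a ≫ b = 0),
      (ShortComplex.mk a b w).ShortExact := by
  let a : cokernel f ⟶ cokernel (f ≫ g) := cokernel.map f (f ≫ g) (𝟙 _) g (by simp)
  let b : cokernel (f ≫ g) ⟶ cokernel g := cokernel.map (f ≫ g) g f (𝟙 _) (by simp)
  have ha : cokernel.π f ≫ a = g ≫ cokernel.π (f ≫ g) := cokernel.π_desc _ _ _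
  have hb : cokernel.π (f ≫ g) ≫ b = cokernel.π g := by simp [b]
  have w : a ≫ b = 0 := by
    rw [← cancel_epi (cokernel.π f), ← Category.assoc, ha, Category.assoc, hb, cokernel.condition,
      comp_zero]
  have hepi : Epi b := epi_of_epi_fac hb
  have hmono : Mono a := by
    refine Preadditive.mono_of_cancel_zero _ fun {Z} y hy ↦ ?_
    obtain ⟨Z', p, hp, x, hx⟩ := surjective_up_to_refinements_of_epi (cokernel.π f) y
    have h1 : (x ≫ g) ≫ cokernel.π (f ≫ g) = 0 := by
      rw [Category.assoc, ← ha, ← Category.assoc, ← hx, Category.assoc, hy, comp_zero]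
    obtain ⟨Z'', p', hp', r, hr⟩ : ∃ (Z'' : C) (p' : Z'' ⟶ Z') (_ : Epi p') (r : Z'' ⟶ A),
        p' ≫ x ≫ g = r ≫ f ≫ g :=
      (ShortComplex.cokernelSequence_exact (f ≫ g)).exact_up_to_refinements _ h1
    have h2 : p' ≫ x = r ≫ f := by
      rw [← cancel_mono g, Category.assoc, Category.assoc, hr]
    have hpp : Epi (p' ≫ p) := epi_comp _ _
    rw [← cancel_epi (p' ≫ p), comp_zero, Category.assoc, hx, ← Category.assoc, h2, Category.assoc,
      cokernel.condition, comp_zero]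
  refine ⟨a, b, w, shortExact_of_exists_desc _ _ _ fun Z z hz ↦ ?_⟩
  have hz' : g ≫ cokernel.π (f ≫ g) ≫ z = 0 := by
    rw [← Category.assoc, ← ha, Category.assoc]
    rw [hz, comp_zero]
  exact ⟨cokernel.desc g _ hz', by
    rw [← cancel_epi (cokernel.π (f ≫ g))]
    rw [← Category.assoc, hb, cokernel.π_desc]⟩

/-- The end of the snake sequence; the connecting map vanishes because `i.τ₃` has no kernel. -/
theorem shortExact_cokernel_map {R S : ShortComplex C} (hR : R.ShortExact) (hS : S.ShortExact)
    (i : R ⟶ S) [Mono i.τ₂] [Mono i.τ₃] :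
    ∃ (a : cokernel i.τ₁ ⟶ cokernel i.τ₂) (b : cokernel i.τ₂ ⟶ cokernel i.τ₃) (w : a ≫ b = 0),
      (ShortComplex.mk a b w).ShortExact := by
  let a : cokernel i.τ₁ ⟶ cokernel i.τ₂ := cokernel.map _ _ R.f S.f i.comm₁₂
  let b : cokernel i.τ₂ ⟶ cokernel i.τ₃ := cokernel.map _ _ R.g S.g i.comm₂₃
  have ha : cokernel.π i.τ₁ ≫ a = S.f ≫ cokernel.π i.τ₂ := cokernel.π_desc _ _ _
  have hb : cokernel.π i.τ₂ ≫ b = S.g ≫ cokernel.π i.τ₃ := cokernel.π_desc _ _ _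
  have := hS.mono_f
  have := hS.epi_g
  have := hR.epi_g
  have w : a ≫ b = 0 := by
    rw [← cancel_epi (cokernel.π i.τ₁), ← Category.assoc, ha, Category.assoc, hb, ← Category.assoc,
      S.zero, zero_comp, comp_zero]
  have hepi : Epi b := by
    have : Epi (cokernel.π i.τ₂ ≫ b) := by
      rw [hb]
      exact epi_comp _ _
    exact epi_of_epi (cokernel.π i.τ₂) b
  have hmono : Mono a := by
    refine Preadditive.mono_of_cancel_zero _ fun {Z} y hy ↦ ?_
    obtain ⟨Z', p, hp, x, hx⟩ := surjective_up_to_refinements_of_epi (cokernel.π i.τ₁) y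
    obtain ⟨r, hr⟩ := (shortExact_cokernel i.τ₂).exists_lift (x ≫ S.f) (by
      change (x ≫ S.f) ≫ cokernel.π i.τ₂ = 0
      rw [Category.assoc, ← ha, ← Category.assoc, ← hx, Category.assoc, hy, comp_zero])
    change r ≫ i.τ₂ = x ≫ S.f at hr
    obtain ⟨r', hr'⟩ := hR.exists_lift r (by
      rw [← cancel_mono i.τ₃, Category.assoc, ← i.comm₂₃, ← Category.assoc, hr, Category.assoc,
        S.zero, comp_zero, zero_comp])
    have h2 : r' ≫ i.τ₁ = x := by
      rw [← cancel_mono S.f, Category.assoc, i.comm₁₂, ← Category.assoc, hr', hr]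
    rw [← cancel_epi p, comp_zero, hx, ← h2, Category.assoc, cokernel.condition, comp_zero]
  refine ⟨a, b, w, shortExact_of_exists_desc _ _ _ fun Z z hz ↦ ?_⟩
  have hz' : S.f ≫ cokernel.π i.τ₂ ≫ z = 0 := by
    rw [← Category.assoc, ← ha, Category.assoc]
    rw [hz, comp_zero]
  obtain ⟨t, ht⟩ : ∃ t, S.g ≫ t = cokernel.π i.τ₂ ≫ z :=
      ⟨hS.exact.desc _ hz', hS.exact.g_desc _ hz'⟩
  have ht' : i.τ₃ ≫ t = 0 := by
    rw [← cancel_epi R.g, ← Category.assoc, ← i.comm₂₃, Category.assoc, ht, ← Category.assoc,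
      cokernel.condition, zero_comp, comp_zero]
  exact ⟨cokernel.desc _ t ht', by
    rw [← cancel_epi (cokernel.π i.τ₂)]
    rw [← Category.assoc, hb, Category.assoc, cokernel.π_desc, ht]⟩

end Abelian

section K0

variable {C : Type w} [Category.{v} C] [Abelian C] (H : ObjectProperty C)

theorem K0.mk_eq_add {S : ShortComplex C} (hS : S.ShortExact) (h₁ : H S.X₁) (h₂ : H S.X₂)
    (h₃ : H S.X₃) : K0.mk H ⟨S.X₂, h₂⟩ = K0.mk H ⟨S.X₁, h₁⟩ + K0.mk H ⟨S.X₃, h₃⟩ := by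
  have h : (QuotientAddGroup.mk _ : K0 H) = 0 := (QuotientAddGroup.eq_zero_iff _).mpr
    (AddSubgroup.subset_closure ⟨S, hS, h₁, h₂, h₃, rfl⟩)
  rw [QuotientAddGroup.mk_sub, QuotientAddGroup.mk_sub, sub_sub, sub_eq_zero] at h
  exact h

theorem K0.hom_ext {A : Type*} [AddCommGroup A] {φ φ' : K0 H →+ A}
    (h : ∀ V, φ (K0.mk H V) = φ' (K0.mk H V)) : φ = φ' :=
  QuotientAddGroup.addMonoidHom_ext _ (FreeAbelianGroup.lift_ext _ _ fun V ↦ h V)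

/-- The universal property of the Grothendieck group. -/
def K0.lift {A : Type*} [AddCommGroup A] (φ : H.FullSubcategory → A)
    (h : ∀ (S : ShortComplex C) (_ : S.ShortExact) (h₁ : H S.X₁) (h₂ : H S.X₂) (h₃ : H S.X₃),
      φ ⟨S.X₂, h₂⟩ = φ ⟨S.X₁, h₁⟩ + φ ⟨S.X₃, h₃⟩) : K0 H →+ A :=
  QuotientAddGroup.lift _ (FreeAbelianGroup.lift φ) <| (AddSubgroup.closure_le _).mpr <| by
    rintro _ ⟨S, hS, h₁, h₂, h₃, rfl⟩
    simp only [SetLike.mem_coe, AddMonoidHom.mem_ker, map_sub, FreeAbelianGroup.lift_apply_of]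
    rw [h S hS h₁ h₂ h₃]
    abel

theorem K0.lift_mk {A : Type*} [AddCommGroup A] (φ : H.FullSubcategory → A) (h) (V) :
    K0.lift H φ h (K0.mk H V) = φ V :=
  FreeAbelianGroup.lift_apply_of _ _

end K0

section RelK0

variable {X U : Scheme.{u}} {G : Type v} [Group G] {j : U ⟶ X}

theorem RelK0.mk_trans {P Q R : Action X.Modules G} (hP : locProj X G P) (hQ : locProj X G Q)
    (hR : locProj X G R) (α : (pullbackOG G j).obj P ≅ (pullbackOG G j).obj Q)
    (β : (pullbackOG G j).obj Q ≅ (pullbackOG G j).obj R) :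
    RelK0.mk G j ⟨P, R, hP, hR, α ≪≫ β⟩ =
      RelK0.mk G j ⟨P, Q, hP, hQ, α⟩ + RelK0.mk G j ⟨Q, R, hQ, hR, β⟩ := by
  have h : (QuotientAddGroup.mk _ : RelK0 G j) = 0 := (QuotientAddGroup.eq_zero_iff _).mpr
    (AddSubgroup.subset_closure (Or.inr ⟨P, Q, R, hP, hQ, hR, α, β, rfl⟩))
  rw [QuotientAddGroup.mk_sub, QuotientAddGroup.mk_sub, sub_sub, sub_eq_zero] at h
  exact h

/-- The identity composed with itself is the identity, so the class equals twice itself. -/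
theorem RelK0.mk_refl {P : Action X.Modules G} (hP : locProj X G P) :
    RelK0.mk G j ⟨P, P, hP, hP, Iso.refl _⟩ = 0 := by
  have h := RelK0.mk_trans hP hP hP (Iso.refl ((pullbackOG G j).obj P)) (Iso.refl _)
  rw [Iso.refl_trans] at h
  exact left_eq_add.mp h

theorem RelK0.mk_eq_add (T' T T'' : RelTriple G j) {a : T'.P ⟶ T.P} {b : T.P ⟶ T''.P}
    {c : T'.Q ⟶ T.Q} {d : T.Q ⟶ T''.Q} {hab : a ≫ b = 0} {hcd : c ≫ d = 0}
    (h : (ShortComplex.mk a b hab).ShortExact) (h' : (ShortComplex.mk c d hcd).ShortExact)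
    (hac : (pullbackOG G j).map a ≫ T.α.hom = T'.α.hom ≫ (pullbackOG G j).map c)
    (hbd : (pullbackOG G j).map b ≫ T''.α.hom = T.α.hom ≫ (pullbackOG G j).map d) :
    RelK0.mk G j T = RelK0.mk G j T' + RelK0.mk G j T'' := by
  have h : (QuotientAddGroup.mk _ : RelK0 G j) = 0 := (QuotientAddGroup.eq_zero_iff _).mpr
    (AddSubgroup.subset_closure (Or.inl ⟨T', T, T'', a, b, c, d, hab, hcd, h, h', hac, hbd, rfl⟩))
  rw [QuotientAddGroup.mk_sub, QuotientAddGroup.mk_sub, sub_sub, sub_eq_zero] at h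
  exact h

theorem RelK0.hom_ext {A : Type*} [AddCommGroup A] {φ φ' : RelK0 G j →+ A}
    (h : ∀ T, φ (RelK0.mk G j T) = φ' (RelK0.mk G j T)) : φ = φ' :=
  QuotientAddGroup.addMonoidHom_ext _ (FreeAbelianGroup.lift_ext _ _ fun V ↦ h V)

/-- The universal property of the relative Grothendieck group. -/
def RelK0.lift {A : Type*} [AddCommGroup A] (φ : RelTriple G j → A)
    (h : ∀ (T' T T'' : RelTriple G j)
      (a : T'.P ⟶ T.P) (b : T.P ⟶ T''.P) (c : T'.Q ⟶ T.Q) (d : T.Q ⟶ T''.Q)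
      (hab : a ≫ b = 0) (hcd : c ≫ d = 0),
      (ShortComplex.mk a b hab).ShortExact → (ShortComplex.mk c d hcd).ShortExact →
      (pullbackOG G j).map a ≫ T.α.hom = T'.α.hom ≫ (pullbackOG G j).map c →
      (pullbackOG G j).map b ≫ T''.α.hom = T.α.hom ≫ (pullbackOG G j).map d →
      φ T = φ T' + φ T'')
    (h' : ∀ (P Q R : Action X.Modules G) (hP : locProj X G P) (hQ : locProj X G Q)
      (hR : locProj X G R) (α : (pullbackOG G j).obj P ≅ (pullbackOG G j).obj Q)
      (β : (pullbackOG G j).obj Q ≅ (pullbackOG G j).obj R),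
      φ ⟨P, R, hP, hR, α ≪≫ β⟩ = φ ⟨P, Q, hP, hQ, α⟩ + φ ⟨Q, R, hQ, hR, β⟩) : RelK0 G j →+ A :=
  QuotientAddGroup.lift _ (FreeAbelianGroup.lift φ) <| (AddSubgroup.closure_le _).mpr <| by
    rintro _ (⟨T', T, T'', a, b, c, d, hab, hcd, h₁, h₂, h₃, h₄, rfl⟩ |
      ⟨P, Q, R, hP, hQ, hR, α, β, rfl⟩)
    · simp only [SetLike.mem_coe, AddMonoidHom.mem_ker, map_sub, FreeAbelianGroup.lift_apply_of]
      rw [h T' T T'' a b c d hab hcd h₁ h₂ h₃ h₄]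
      abel
    · simp only [SetLike.mem_coe, AddMonoidHom.mem_ker, map_sub, FreeAbelianGroup.lift_apply_of]
      rw [h' P Q R hP hQ hR α β]
      abel

theorem RelK0.lift_mk {A : Type*} [AddCommGroup A] (φ : RelTriple G j → A) (h) (h') (T) :
    RelK0.lift φ h h' (RelK0.mk G j T) = φ T :=
  FreeAbelianGroup.lift_apply_of _ _

end RelK0

end

/-! ### Construction of the homomorphism from resolutions -/

section

variable {X U : Scheme.{u}} {G : Type v} [Group G] {j : U ⟶ X}

section HomClass

/-- The class of a morphism which becomes an isomorphism over `U`. -/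
def homClass {P Q : Action X.Modules G} (hP : locProj X G P) (hQ : locProj X G Q) (f : P ⟶ Q)
    (hf : IsIso ((pullbackOG G j).map f)) : RelK0 G j :=
  RelK0.mk G j ⟨P, Q, hP, hQ, asIso ((pullbackOG G j).map f)⟩

theorem mk_eq_homClass {P Q : Action X.Modules G} (hP : locProj X G P) (hQ : locProj X G Q)
    (f : P ⟶ Q)
    (hf : IsIso ((pullbackOG G j).map f)) (α : (pullbackOG G j).obj P ≅ (pullbackOG G j).obj Q)
    (hα : α.hom = (pullbackOG G j).map f) : RelK0.mk G j ⟨P, Q, hP, hQ, α⟩ = homClass hP hQ f hf :=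
        by
  have : α = asIso ((pullbackOG G j).map f) := Iso.ext hα
  rw [this]
  rfl

theorem homClass_comp {P Q R : Action X.Modules G} (hP : locProj X G P) (hQ : locProj X G Q)
    (hR : locProj X G R) {f : P ⟶ Q} {g : Q ⟶ R} {k : P ⟶ R} (e : f ≫ g = k)
    (hf : IsIso ((pullbackOG G j).map f)) (hg : IsIso ((pullbackOG G j).map g))
    (hk : IsIso ((pullbackOG G j).map k)) :
    homClass hP hR k hk = homClass hP hQ f hf + homClass hQ hR g hg := by
  refine Eq.trans ?_ (RelK0.mk_trans hP hQ hR (asIso ((pullbackOG G j).map f))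
    (asIso ((pullbackOG G j).map g)))
  refine (mk_eq_homClass hP hR k hk _ ?_).symm
  rw [Iso.trans_hom, asIso_hom, asIso_hom, ← Functor.map_comp, e]

theorem IsPsi.eq {ψ ψ' : K0T G j →+ RelK0 G j} (h : IsPsi G j ψ) (h' : IsPsi G j ψ') : ψ = ψ' := by
  refine K0.hom_ext _ fun V ↦ ?_
  obtain ⟨hc, hz, P, Q, f, g, w, hP, hQ, hex⟩ := V.property
  obtain ⟨α, hα, e⟩ := h V P Q hP hQ f g w hex
  obtain ⟨α', hα', e'⟩ := h' V P Q hP hQ f g w hex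
  rw [e, e', Iso.ext (hα.trans hα'.symm)]

variable [IsLocallyNoetherian X] (T : TwistableCover j)

/-- The induced map of first terms has the same kernel as `q`, so the two triples differ by the
identity triple of that kernel, whose class is zero. -/
theorem homClass_eq_of_epi {S₁ S₂ : ShortComplex (Action X.Modules G)} (h₁ : S₁.ShortExact)
    (h₂ : S₂.ShortExact) (hP₁ : locProj X G S₁.X₁) (hQ₁ : locProj X G S₁.X₂)
    (hP₂ : locProj X G S₂.X₁) (hQ₂ : locProj X G S₂.X₂)
    (hf₁ : IsIso ((pullbackOG G j).map S₁.f)) (hf₂ : IsIso ((pullbackOG G j).map S₂.f))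
    (q : S₁.X₂ ⟶ S₂.X₂) [Epi q] (r : S₁.X₃ ⟶ S₂.X₃) [Mono r] (hq : q ≫ S₂.g = S₁.g ≫ r) :
    homClass hP₁ hQ₁ S₁.f hf₁ = homClass hP₂ hQ₂ S₂.f hf₂ := by
  obtain ⟨p, hpq⟩ := h₂.exists_lift (S₁.f ≫ q) (by
    rw [Category.assoc, hq, ← Category.assoc, S₁.zero, zero_comp])
  obtain ⟨k, w, hk, hkp⟩ := exists_shortExact_kernel h₁ h₂ p q r hpq hq
  have hK : locProj X G (kernel q) := locProj_left (shortExact_kernel q) hQ₁ hQ₂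
  have h := RelK0.mk_eq_add (j := j) ⟨_, _, hK, hK, Iso.refl _⟩
    ⟨_, _, hP₁, hQ₁, asIso ((pullbackOG G j).map S₁.f)⟩
    ⟨_, _, hP₂, hQ₂, asIso ((pullbackOG G j).map S₂.f)⟩ hkp (shortExact_kernel q)
    (by rw [Iso.refl_hom, Category.id_comp, asIso_hom, ← Functor.map_comp, hk])
    (by rw [asIso_hom, asIso_hom, ← Functor.map_comp, ← Functor.map_comp, hpq])
  rw [RelK0.mk_refl, zero_add] at h
  exact h

/-- The fibre product is an extension of `Q` by `S.X₁`; its coherence comes from being a kernel of a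
map out of the sum of `Q` and `S.X₂`. -/
theorem locProj_pullback {S : ShortComplex (Action X.Modules G)} (hS : S.ShortExact)
    (h₁ : locProj X G S.X₁) (h₂ : locProj X G S.X₂) (h₃ : IsCoherentOG S.X₃)
    {Q : Action X.Modules G} (hQ : locProj X G Q) (g : Q ⟶ S.X₃) :
    locProj X G (pullback g S.g) := by
  have := hS.epi_g
  obtain ⟨w, hw⟩ := shortExact_pullback_biprod g S.g
  obtain ⟨k, w', hk⟩ := shortExact_pullback_fst hS g
  exact locProj_middle hk h₁ hQ (isCoherentOG_left hw (isCoherentOG_biprod hQ.1 h₂.1) h₃)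

/-- This kernel is an extension of `S.X₁` by the kernel of `q`, and both are locally projective. -/
theorem locProj_kernel_comp {S : ShortComplex (Action X.Modules G)} (hS : S.ShortExact)
    (h₁ : locProj X G S.X₁) (h₂ : locProj X G S.X₂) (h₃ : IsCoherentOG S.X₃)
    {R : Action X.Modules G} (hR : locProj X G R) (q : R ⟶ S.X₂) [Epi q] :
    locProj X G (kernel (q ≫ S.g)) := by
  have := hS.epi_g
  have hex := shortExact_kernel (q ≫ S.g)
  obtain ⟨p, hp⟩ := hS.exists_lift (kernel.ι (q ≫ S.g) ≫ q) (by
    rw [Category.assoc, kernel.condition])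
  obtain ⟨k, w, -, hk⟩ := exists_shortExact_kernel hex hS p q (𝟙 _) hp (Category.comp_id _).symm
  have hK : locProj X G (kernel q) := locProj_left (shortExact_kernel q) hR h₂
  exact locProj_middle hk hK h₁ (isCoherentOG_left hex hR.1 h₃)

/-- The fibre product of `Q₁` and `Q₂` over `V` maps onto both and starts a third resolution, which
is compared with each of the given ones. -/
theorem homClass_eq_of_resolutions (T : TwistableCover j) {V P₁ Q₁ P₂ Q₂ : Action X.Modules G}
    (hV : IsCoherentOG V)
    (hV' : IsZero ((pullbackOG G j).obj V))
    {f₁ : P₁ ⟶ Q₁} {g₁ : Q₁ ⟶ V} {w₁ : f₁ ≫ g₁ = 0} (h₁ : (ShortComplex.mk f₁ g₁ w₁).ShortExact)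
    {f₂ : P₂ ⟶ Q₂} {g₂ : Q₂ ⟶ V} {w₂ : f₂ ≫ g₂ = 0} (h₂ : (ShortComplex.mk f₂ g₂ w₂).ShortExact)
    (hP₁ : locProj X G P₁) (hQ₁ : locProj X G Q₁) (hP₂ : locProj X G P₂) (hQ₂ : locProj X G Q₂)
    (hf₁ : IsIso ((pullbackOG G j).map f₁)) (hf₂ : IsIso ((pullbackOG G j).map f₂)) :
    homClass hP₁ hQ₁ f₁ hf₁ = homClass hP₂ hQ₂ f₂ hf₂ := by
  have hR := locProj_pullback h₂ hP₂ hQ₂ hV hQ₁ g₁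
  obtain ⟨_, _, hfst⟩ := shortExact_pullback_fst h₂ g₁
  obtain ⟨_, _, hsnd⟩ := shortExact_pullback_snd h₁ g₂
  let q₁ : pullback g₁ g₂ ⟶ Q₁ := pullback.fst g₁ g₂
  let q₂ : pullback g₁ g₂ ⟶ Q₂ := pullback.snd g₁ g₂
  have : Epi q₁ := hfst.epi_g
  have : Epi q₂ := hsnd.epi_g
  have : Epi g₁ := h₁.epi_g
  have hK : locProj X G (kernel (q₁ ≫ g₁)) := locProj_kernel_comp h₁ hP₁ hQ₁ hV hR q₁
  have hex := shortExact_kernel (q₁ ≫ g₁)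
  have hι := (T.isIso_pullbackOG_iff hex hK.1 hR.1).mpr hV'
  have e₁ := homClass_eq_of_epi hex h₁ hK hR hP₁ hQ₁ hι hf₁ q₁ (𝟙 V) (Category.comp_id _).symm
  have e₂ := homClass_eq_of_epi hex h₂ hK hR hP₂ hQ₂ hι hf₂ q₂ (𝟙 V)
    (pullback.condition.symm.trans (Category.comp_id _).symm)
  exact e₁.symm.trans e₂

/-- Schanuel's argument: the fibre product of `Q` with the middle term `Q₂` of a given resolution is
locally projective, and projects onto `Q₂` with kernel that of `g`. -/
theorem locProj_kernel {V : Action X.Modules G} (hV : torsionModules G j V) {Q : Action X.Modules G}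
    (hQ : locProj X G Q) (g : Q ⟶ V) [Epi g] : locProj X G (kernel g) := by
  obtain ⟨hc, -, P₂, Q₂, f₂, g₂, w, hP₂, hQ₂, h⟩ := hV
  obtain ⟨_, _, hsnd⟩ := shortExact_pullback_snd (shortExact_kernel g) g₂
  exact locProj_left hsnd (locProj_pullback h hP₂ hQ₂ hc hQ g) hQ₂

theorem exists_resolutionClass (T : TwistableCover j) (V : (torsionModules G j).FullSubcategory) :
    ∃ c : RelK0 G j, ∀ (P Q : Action X.Modules G) (hP : locProj X G P) (hQ : locProj X G Q)
      (f : P ⟶ Q) (g : Q ⟶ V.obj) (w : f ≫ g = 0) (hf : IsIso ((pullbackOG G j).map f)),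
      (ShortComplex.mk f g w).ShortExact → homClass hP hQ f hf = c := by
  obtain ⟨hc, hz, P₂, Q₂, f₂, g₂, w₂, hP₂, hQ₂, h₂⟩ := V.property
  exact ⟨homClass hP₂ hQ₂ f₂ ((T.isIso_pullbackOG_iff h₂ hP₂.1 hQ₂.1).mpr hz),
    fun P Q hP hQ f g w hf h ↦ homClass_eq_of_resolutions T hc hz h h₂ hP hQ hP₂ hQ₂ hf _⟩

/-- The class of a resolution of a torsion module. -/
def resolutionClass (V : (torsionModules G j).FullSubcategory) : RelK0 G j :=
  (exists_resolutionClass T V).choose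

theorem homClass_eq_resolutionClass (V : (torsionModules G j).FullSubcategory)
    {P Q : Action X.Modules G} (hP : locProj X G P) (hQ : locProj X G Q)
    {f : P ⟶ Q} {g : Q ⟶ V.obj} {w : f ≫ g = 0} (h : (ShortComplex.mk f g w).ShortExact)
    (hf : IsIso ((pullbackOG G j).map f)) :
    homClass hP hQ f hf = resolutionClass T V :=
  (exists_resolutionClass T V).choose_spec P Q hP hQ f g w hf h

/-- No horseshoe is needed. With `P ⟶ Q` resolving the middle term and `L` the kernel of `Q ⟶ S.X₃`,
the maps `P ⟶ L` and `L ⟶ Q` resolve `S.X₁` and `S.X₃`, and their composite is the resolution of the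
middle term. -/
theorem resolutionClass_eq_add {S : ShortComplex (Action X.Modules G)} (hS : S.ShortExact)
    (h₁ : torsionModules G j S.X₁) (h₂ : torsionModules G j S.X₂) (h₃ : torsionModules G j S.X₃) :
    resolutionClass T ⟨S.X₂, h₂⟩ = resolutionClass T ⟨S.X₁, h₁⟩ + resolutionClass T ⟨S.X₃, h₃⟩ := by
  have h₂' := h₂
  obtain ⟨-, hz, P, Q, f, g, w, hP, hQ, h⟩ := h₂'
  have := hS.mono_f
  have := hS.epi_g
  have : Epi g := h.epi_g
  have : Mono f := h.mono_f
  have hL := locProj_kernel h₃ hQ (g ≫ S.g)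
  have hex := shortExact_kernel (g ≫ S.g)
  obtain ⟨n, hn⟩ := hS.exists_lift (kernel.ι (g ≫ S.g) ≫ g)
      (by rw [Category.assoc, kernel.condition])
  have hm : f ≫ g ≫ S.g = 0 := by rw [← Category.assoc, w, zero_comp]
  let m := kernel.lift (g ≫ S.g) f hm
  have hmι : m ≫ kernel.ι (g ≫ S.g) = f := kernel.lift_ι _ _ _
  have hmn : m ≫ n = 0 := by
    rw [← cancel_mono S.f, Category.assoc, hn, ← Category.assoc, hmι, w, zero_comp]
  have : Mono m := mono_of_mono_fac hmι
  have : Epi n := by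
    rw [epi_iff_surjective_up_to_refinements]
    intro A y
    obtain ⟨A', π, hπ, x, hx⟩ := surjective_up_to_refinements_of_epi g (y ≫ S.f)
    have hx₀ : x ≫ g ≫ S.g = 0 := by
      rw [← Category.assoc, ← hx, Category.assoc, Category.assoc, S.zero, comp_zero, comp_zero]
    refine ⟨A', π, hπ, kernel.lift (g ≫ S.g) x hx₀, ?_⟩
    rw [← cancel_mono S.f, Category.assoc, Category.assoc, hn, kernel.lift_ι_assoc]
    exact hx
  have hex' : (ShortComplex.mk m n hmn).ShortExact := by
    refine shortExact_of_exists_lift _ _ _ fun Z z hz ↦ ?_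
    obtain ⟨l, hl⟩ := h.exists_lift (z ≫ kernel.ι (g ≫ S.g)) (by
      change (z ≫ kernel.ι (g ≫ S.g)) ≫ g = 0
      rw [Category.assoc, ← hn, ← Category.assoc, hz, zero_comp])
    refine ⟨l, ?_⟩
    rw [← cancel_mono (kernel.ι (g ≫ S.g)), Category.assoc, hmι]
    exact hl
  have hf' := (T.isIso_pullbackOG_iff h hP.1 hQ.1).mpr hz
  have hm' := (T.isIso_pullbackOG_iff hex' hP.1 hL.1).mpr h₁.2.1
  have hι' := (T.isIso_pullbackOG_iff hex hL.1 hQ.1).mpr h₃.2.1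
  rw [← homClass_eq_resolutionClass T ⟨S.X₂, h₂⟩ hP hQ h hf',
    ← homClass_eq_resolutionClass T ⟨S.X₁, h₁⟩ hP hL hex' hm',
    ← homClass_eq_resolutionClass T ⟨S.X₃, h₃⟩ hL hQ hex hι']
  exact homClass_comp hP hL hQ hmι _ _ _

/-- The homomorphism `ψ`. -/
def psi : K0T G j →+ RelK0 G j :=
  K0.lift _ (resolutionClass T) fun _ hS h₁ h₂ h₃ ↦ resolutionClass_eq_add T hS h₁ h₂ h₃

theorem psi_mk (V : (torsionModules G j).FullSubcategory) :
    psi T (K0.mk (torsionModules G j) V) = resolutionClass T V :=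
  K0.lift_mk _ _ _ _

theorem isPsi_psi : IsPsi G j (psi T) := by
  intro V P Q hP hQ f g w h
  have hf := (T.isIso_pullbackOG_iff h hP.1 hQ.1).mpr V.property.2.1
  refine ⟨asIso ((pullbackOG G j).map f), rfl, ?_⟩
  rw [psi_mk, ← homClass_eq_resolutionClass T V hP hQ h hf]
  rfl

end HomClass

/-! ### Classes of cokernels -/

section CokernelClass

/-- The class of the cokernel of a morphism. -/
def cokernelClass {P Q : Action X.Modules G} (f : P ⟶ Q) (h : torsionModules G j (cokernel f)) :
    K0T G j := K0.mk (torsionModules G j) ⟨cokernel f, h⟩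

theorem torsionModules_cokernel (T : TwistableCover j) {P Q : Action X.Modules G}
    (hP : locProj X G P)
    (hQ : locProj X G Q) (f : P ⟶ Q) (hf : IsIso ((pullbackOG G j).map f)) :
    torsionModules G j (cokernel f) := by
  have := T.mono_of_isIso_pullbackOG hP f
  have hex := shortExact_cokernel f
  exact ⟨isCoherentOG_right hex hP.1 hQ.1, (T.isIso_pullbackOG_iff hex hP.1 hQ.1).mp hf, P, Q, f, _,
    _, hP, hQ, hex⟩

theorem cokernelClass_comp (T : TwistableCover j) {P Q R : Action X.Modules G} (hQ : locProj X G Q)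
    {f : P ⟶ Q} {g : Q ⟶ R} {k : P ⟶ R} (e : f ≫ g = k) (hg : IsIso ((pullbackOG G j).map g))
    (tk : torsionModules G j (cokernel k)) (tf : torsionModules G j (cokernel f))
    (tg : torsionModules G j (cokernel g)) :
    cokernelClass k tk = cokernelClass f tf + cokernelClass g tg := by
  subst e
  have := T.mono_of_isIso_pullbackOG hQ g
  obtain ⟨a, b, w, h⟩ := shortExact_cokernel_comp f g
  exact K0.mk_eq_add _ h tf tk tg

theorem cokernelClass_id (T : TwistableCover j) {P : Action X.Modules G} (hP : locProj X G P)
    (t : torsionModules G j (cokernel (𝟙 P))) : cokernelClass (𝟙 P) t = 0 :=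
  left_eq_add.mp (cokernelClass_comp T hP (Category.id_comp (𝟙 P)) inferInstance t t t)

theorem mk_eq_cokernelClass (T : TwistableCover j) (V : (torsionModules G j).FullSubcategory)
    {P Q : Action X.Modules G}
    (hP : locProj X G P) {f : P ⟶ Q} {g : Q ⟶ V.obj} {w : f ≫ g = 0}
    (h : (ShortComplex.mk f g w).ShortExact) (t : torsionModules G j (cokernel f)) :
    K0.mk (torsionModules G j) V = cokernelClass f t := by
  have : Epi g := h.epi_g
  have t₀ := torsionModules_cokernel T hP hP (𝟙 P) inferInstance
  have hz : IsZero (cokernel (𝟙 P)) := isZero_cokernel_of_epi (𝟙 P)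
  let e : V.obj ≅ cokernel f := ((cokernelIsCokernel f).coconePointUniqueUpToIso h.gIsCokernel).symm
  -- Isomorphic objects are compared by an exact sequence ending in zero; the zero object is taken
  -- to be a cokernel of an identity, which is known to be a torsion module of class zero.
  have : Epi (0 : cokernel f ⟶ cokernel (𝟙 P)) := ⟨fun _ _ _ ↦ hz.eq_of_src _ _⟩
  have hex : (ShortComplex.mk e.hom (0 : cokernel f ⟶ cokernel (𝟙 P)) comp_zero).ShortExact :=
    shortExact_of_exists_lift _ _ _ fun _ z _ ↦ ⟨z ≫ e.inv, by simp⟩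
  have := K0.mk_eq_add (torsionModules G j) hex V.property t t₀
  have h0 := cokernelClass_id T hP t₀
  change K0.mk (torsionModules G j) ⟨cokernel (𝟙 P), t₀⟩ = 0 at h0
  rw [h0, add_zero] at this
  exact this.symm

variable [IsLocallyNoetherian X] (T : TwistableCover j)

theorem psi_cokernelClass {P Q : Action X.Modules G} (hP : locProj X G P) (hQ : locProj X G Q)
    (f : P ⟶ Q) (hf : IsIso ((pullbackOG G j).map f)) (t : torsionModules G j (cokernel f)) :
    psi T (cokernelClass f t) = homClass hP hQ f hf := by
  have := T.mono_of_isIso_pullbackOG hP f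
  refine (psi_mk T _).trans (homClass_eq_resolutionClass T ⟨cokernel f, t⟩ hP hQ
    (shortExact_cokernel f) hf).symm

end CokernelClass

/-! ### The inverse homomorphism -/

section Inverse

/-- `R` is a lattice in `P` on which the isomorphism of a triple is defined over `X`. -/
structure IsRefinement (t : RelTriple G j) {R : Action X.Modules G} (i : R ⟶ t.P) (h : R ⟶ t.Q) :
    Prop where
  locProj : locProj X G R
  isIso_left : IsIso ((pullbackOG G j).map i)
  fac : (pullbackOG G j).map h = (pullbackOG G j).map i ≫ t.α.hom

theorem IsRefinement.isIso_right {t : RelTriple G j} {R : Action X.Modules G} {i : R ⟶ t.P}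
    {h : R ⟶ t.Q} (r : IsRefinement t i h) : IsIso ((pullbackOG G j).map h) := by
  have := r.isIso_left
  rw [r.fac]
  infer_instance

variable [IsLocallyNoetherian X] (T : TwistableCover j)

/-- The difference of the classes of the cokernels of a refinement. -/
def IsRefinement.diff {t : RelTriple G j} {R : Action X.Modules G} {i : R ⟶ t.P}
    {h : R ⟶ t.Q} (r : IsRefinement t i h) : K0T G j :=
  cokernelClass h (torsionModules_cokernel T r.locProj t.hQ h r.isIso_right) -
    cokernelClass i (torsionModules_cokernel T r.locProj t.hP i r.isIso_left)

/-- Both lattices are dominated by a common one with maps `a`, `b`. The two factorizations of its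
map to `t.P` and of its map to `t.Q` give two identities in which the classes of `a` and `b` cancel.
-/
theorem IsRefinement.diff_eq {t : RelTriple G j} {R₁ R₂ : Action X.Modules G} {i₁ : R₁ ⟶ t.P}
    {h₁ : R₁ ⟶ t.Q} {i₂ : R₂ ⟶ t.P} {h₂ : R₂ ⟶ t.Q} (r₁ : IsRefinement t i₁ h₁)
    (r₂ : IsRefinement t i₂ h₂) : r₁.diff T = r₂.diff T := by
  have := r₁.isIso_left
  have := r₂.isIso_left
  obtain ⟨R, a, b, hR, ha, hab⟩ := T.exists_refinement r₁.locProj r₂.locProj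
    ((pullbackOG G j).map i₁ ≫ inv ((pullbackOG G j).map i₂))
  have hb : IsIso ((pullbackOG G j).map b) := by
    rw [hab]
    infer_instance
  have e : (pullbackOG G j).map b ≫ (pullbackOG G j).map i₂ =
      (pullbackOG G j).map a ≫ (pullbackOG G j).map i₁ := by
    rw [hab, Category.assoc, Category.assoc, IsIso.inv_hom_id, Category.comp_id]
  have ei : b ≫ i₂ = a ≫ i₁ := T.pullbackOG_map_injective t.hP (by
    rw [Functor.map_comp, Functor.map_comp, e])
  have eh : b ≫ h₂ = a ≫ h₁ := T.pullbackOG_map_injective t.hQ (by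
    rw [Functor.map_comp, Functor.map_comp, r₁.fac, r₂.fac, ← Category.assoc, e, Category.assoc])
  have ta := torsionModules_cokernel T hR r₁.locProj a ha
  have tb := torsionModules_cokernel T hR r₂.locProj b hb
  have hai : IsIso ((pullbackOG G j).map (a ≫ i₁)) := by
    rw [Functor.map_comp]
    infer_instance
  have hah : IsIso ((pullbackOG G j).map (a ≫ h₁)) := by
    have := r₁.isIso_right
    rw [Functor.map_comp]
    infer_instance
  have tai := torsionModules_cokernel T hR t.hP (a ≫ i₁) hai
  have tah := torsionModules_cokernel T hR t.hQ (a ≫ h₁) hah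
  have c₁ := cokernelClass_comp T r₁.locProj rfl r₁.isIso_left tai ta
    (torsionModules_cokernel T r₁.locProj t.hP i₁ r₁.isIso_left)
  have c₂ := cokernelClass_comp T r₂.locProj ei r₂.isIso_left tai tb
    (torsionModules_cokernel T r₂.locProj t.hP i₂ r₂.isIso_left)
  have c₃ := cokernelClass_comp T r₁.locProj rfl r₁.isIso_right tah ta
    (torsionModules_cokernel T r₁.locProj t.hQ h₁ r₁.isIso_right)
  have c₄ := cokernelClass_comp T r₂.locProj eh r₂.isIso_right tah tb
    (torsionModules_cokernel T r₂.locProj t.hQ h₂ r₂.isIso_right)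
  unfold IsRefinement.diff
  rw [sub_eq_sub_iff_add_eq_add]
  have k₁ := c₁.symm.trans c₂
  have k₃ := c₃.symm.trans c₄
  refine add_left_cancel (a := cokernelClass a ta + cokernelClass b tb) ?_
  calc _ = (cokernelClass a ta + cokernelClass h₁ _) + (cokernelClass b tb + cokernelClass i₂ _) :=
      by abel
    _ = (cokernelClass b tb + cokernelClass h₂ _) + (cokernelClass a ta + cokernelClass i₁ _) := by
      rw [k₃, k₁]
    _ = _ := by abel

theorem exists_isRefinement (T : TwistableCover j) (t : RelTriple G j) :
    ∃ (R : Action X.Modules G) (i : R ⟶ t.P) (h : R ⟶ t.Q), IsRefinement t i h := by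
  obtain ⟨R, i, h, hR, hi, hh⟩ := T.exists_refinement t.hP t.hQ t.α.hom
  exact ⟨R, i, h, hR, hi, hh⟩

/-- The value of the inverse of `ψ` on a triple. -/
def tripleClass (t : RelTriple G j) : K0T G j :=
  (exists_isRefinement T t).choose_spec.choose_spec.choose_spec.diff T

theorem IsRefinement.diff_eq_tripleClass {t : RelTriple G j} {R : Action X.Modules G} {i : R ⟶ t.P}
    {h : R ⟶ t.Q} (r : IsRefinement t i h) : r.diff T = tripleClass T t :=
  r.diff_eq T _

/-- As in a calculus of fractions, a lattice `C` over `A` and `B` with equal maps to `Q` refines the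
composite. The terms over `Q` cancel because `b ≫ k = a ≫ h`. -/
theorem tripleClass_trans {P Q R : Action X.Modules G} (hP : locProj X G P) (hQ : locProj X G Q)
    (hR : locProj X G R) (α : (pullbackOG G j).obj P ≅ (pullbackOG G j).obj Q)
    (β : (pullbackOG G j).obj Q ≅ (pullbackOG G j).obj R) :
    tripleClass T ⟨P, R, hP, hR, α ≪≫ β⟩ =
      tripleClass T ⟨P, Q, hP, hQ, α⟩ + tripleClass T ⟨Q, R, hQ, hR, β⟩ := by
  obtain ⟨A, i, h, hA⟩ := exists_isRefinement T ⟨P, Q, hP, hQ, α⟩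
  obtain ⟨B, k, l, hB⟩ := exists_isRefinement T ⟨Q, R, hQ, hR, β⟩
  have := hA.isIso_left
  have := hA.isIso_right
  have := hB.isIso_left
  have := hB.isIso_right
  obtain ⟨C, a, b, hC, ha, hab⟩ := T.exists_refinement hA.locProj hB.locProj
    ((pullbackOG G j).map h ≫ inv ((pullbackOG G j).map k))
  have hb : IsIso ((pullbackOG G j).map b) := by
    rw [hab]
    infer_instance
  have e : (pullbackOG G j).map b ≫ (pullbackOG G j).map k =
      (pullbackOG G j).map a ≫ (pullbackOG G j).map h := by
    rw [hab, Category.assoc, Category.assoc, IsIso.inv_hom_id, Category.comp_id]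
  have ek : b ≫ k = a ≫ h := T.pullbackOG_map_injective hQ (by
    rw [Functor.map_comp, Functor.map_comp, e])
  have hai : IsIso ((pullbackOG G j).map (a ≫ i)) := by
    rw [Functor.map_comp]
    infer_instance
  have hah : IsIso ((pullbackOG G j).map (a ≫ h)) := by
    rw [Functor.map_comp]
    infer_instance
  have hC' : IsRefinement ⟨P, R, hP, hR, α ≪≫ β⟩ (a ≫ i) (b ≫ l) := by
    refine ⟨hC, hai, ?_⟩
    have f₁ : (pullbackOG G j).map h = (pullbackOG G j).map i ≫ α.hom := hA.fac
    have f₂ : (pullbackOG G j).map l = (pullbackOG G j).map k ≫ β.hom := hB.fac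
    rw [Functor.map_comp, f₂, ← Category.assoc, e, f₁, Functor.map_comp, Iso.trans_hom]
    simp only [Category.assoc]
  have ta := torsionModules_cokernel T hC hA.locProj a ha
  have tb := torsionModules_cokernel T hC hB.locProj b hb
  have tah := torsionModules_cokernel T hC hQ (a ≫ h) hah
  have c₁ := cokernelClass_comp T hA.locProj rfl hA.isIso_left
    (torsionModules_cokernel T hC hP _ hai) ta
        (torsionModules_cokernel T hA.locProj hP i hA.isIso_left)
  have c₂ := cokernelClass_comp T hB.locProj rfl hB.isIso_right
    (torsionModules_cokernel T hC hR _ hC'.isIso_right) tb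
    (torsionModules_cokernel T hB.locProj hR l hB.isIso_right)
  have c₃ := cokernelClass_comp T hA.locProj rfl hA.isIso_right tah ta
    (torsionModules_cokernel T hA.locProj hQ h hA.isIso_right)
  have c₄ := cokernelClass_comp T hB.locProj ek hB.isIso_left tah tb
    (torsionModules_cokernel T hB.locProj hQ k hB.isIso_left)
  rw [← hC'.diff_eq_tripleClass T, ← hA.diff_eq_tripleClass T, ← hB.diff_eq_tripleClass T]
  unfold IsRefinement.diff
  rw [c₁, c₂]
  have k₃ := c₃.symm.trans c₄
  rw [← sub_eq_zero]
  refine Eq.trans ?_ (sub_eq_zero.mpr k₃.symm)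
  abel

/-- Refining the sequence by a single twist makes the cokernels towards `P` and those towards `Q`
into two short exact sequences. -/
theorem tripleClass_eq_add (T' T₀ T'' : RelTriple G j) {a : T'.P ⟶ T₀.P} {b : T₀.P ⟶ T''.P}
    {c : T'.Q ⟶ T₀.Q} {d : T₀.Q ⟶ T''.Q} {hab : a ≫ b = 0} {hcd : c ≫ d = 0}
    (h : (ShortComplex.mk a b hab).ShortExact) (h' : (ShortComplex.mk c d hcd).ShortExact)
    (hac : (pullbackOG G j).map a ≫ T₀.α.hom = T'.α.hom ≫ (pullbackOG G j).map c)
    (hbd : (pullbackOG G j).map b ≫ T''.α.hom = T₀.α.hom ≫ (pullbackOG G j).map d) :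
    tripleClass T T₀ = tripleClass T T' + tripleClass T T'' := by
  obtain ⟨R, i, k, hR, ⟨hR₁, hR₂, hR₃⟩, ⟨hi₁, hi₂, hi₃⟩, hk₁, hk₂, hk₃⟩ :=
    T.exists_refinement_shortExact (S' := ShortComplex.mk c d hcd) h T'.hP T₀.hP T''.hP
      T'.hQ T₀.hQ T''.hQ hac hbd
  have r' : IsRefinement T' i.τ₁ k.τ₁ := ⟨hR₁, hi₁, hk₁⟩
  have r : IsRefinement T₀ i.τ₂ k.τ₂ := ⟨hR₂, hi₂, hk₂⟩
  have r'' : IsRefinement T'' i.τ₃ k.τ₃ := ⟨hR₃, hi₃, hk₃⟩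
  have := r.isIso_right
  have := r''.isIso_right
  have := T.mono_of_isIso_pullbackOG hR₂ i.τ₂
  have := T.mono_of_isIso_pullbackOG hR₃ i.τ₃
  have := T.mono_of_isIso_pullbackOG hR₂ k.τ₂
  have := T.mono_of_isIso_pullbackOG hR₃ k.τ₃
  obtain ⟨_, _, _, ei⟩ := shortExact_cokernel_map hR h i
  obtain ⟨_, _, _, ek⟩ := shortExact_cokernel_map hR h' k
  have c₁ := K0.mk_eq_add (torsionModules G j) ei
    (torsionModules_cokernel T hR₁ T'.hP i.τ₁ hi₁) (torsionModules_cokernel T hR₂ T₀.hP i.τ₂ hi₂)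
    (torsionModules_cokernel T hR₃ T''.hP i.τ₃ hi₃)
  have c₂ := K0.mk_eq_add (torsionModules G j) ek
    (torsionModules_cokernel T hR₁ T'.hQ k.τ₁ r'.isIso_right)
    (torsionModules_cokernel T hR₂ T₀.hQ k.τ₂ r.isIso_right)
    (torsionModules_cokernel T hR₃ T''.hQ k.τ₃ r''.isIso_right)
  rw [← r.diff_eq_tripleClass T, ← r'.diff_eq_tripleClass T, ← r''.diff_eq_tripleClass T]
  unfold IsRefinement.diff cokernelClass
  refine (congrArg₂ (· - ·) c₂ c₁).trans ?_
  exact add_sub_add_comm _ _ _ _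

/-- The inverse of `ψ`. -/
def psiInv : RelK0 G j →+ K0T G j :=
  RelK0.lift (tripleClass T) (fun _ _ _ _ _ _ _ _ _ h h' hac hbd ↦ tripleClass_eq_add T _ _ _ h h'
      hac hbd)
    fun _ _ _ hP hQ hR α β ↦ tripleClass_trans T hP hQ hR α β

theorem psiInv_mk (t : RelTriple G j) : psiInv T (RelK0.mk G j t) = tripleClass T t :=
  RelK0.lift_mk _ _ _ _

/-- Over `U` the map `h` is `i` followed by the isomorphism of `t`, so the composition relation
gives the difference of the classes of `h` and `i`. -/
theorem psi_tripleClass (t : RelTriple G j) : psi T (tripleClass T t) = RelK0.mk G j t := by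
  obtain ⟨R, i, h, r⟩ := exists_isRefinement T t
  have := r.isIso_left
  rw [← r.diff_eq_tripleClass T, IsRefinement.diff, map_sub,
    psi_cokernelClass T r.locProj t.hQ h r.isIso_right,
    psi_cokernelClass T r.locProj t.hP i r.isIso_left, sub_eq_iff_eq_add']
  refine Eq.trans ?_ (RelK0.mk_trans r.locProj t.hP t.hQ (asIso ((pullbackOG G j).map i)) t.α)
  refine (mk_eq_homClass _ _ _ r.isIso_right _ ?_).symm
  rw [Iso.trans_hom, asIso_hom, r.fac]

theorem psiInv_psi_mk (V : (torsionModules G j).FullSubcategory) :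
    psiInv T (psi T (K0.mk (torsionModules G j) V)) = K0.mk (torsionModules G j) V := by
  obtain ⟨hc, hz, P, Q, f, g, w, hP, hQ, hex⟩ := V.property
  have hf := (T.isIso_pullbackOG_iff hex hP.1 hQ.1).mpr hz
  have tf := torsionModules_cokernel T hP hQ f hf
  rw [mk_eq_cokernelClass T V hP hex tf, psi_cokernelClass T hP hQ f hf, homClass, psiInv_mk]
  -- A triple coming from a morphism over `X` needs no denominator, so `P` itself serves as the
  -- lattice.
  have r : IsRefinement ⟨P, Q, hP, hQ, asIso ((pullbackOG G j).map f)⟩ (𝟙 P) f :=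
    ⟨hP, inferInstance, by rw [asIso_hom, (pullbackOG G j).map_id]; exact (Category.id_comp _).symm⟩
  rw [← r.diff_eq_tripleClass T, IsRefinement.diff]
  refine Eq.trans ?_ (sub_zero _)
  exact congrArg (cokernelClass f tf - ·) (cokernelClass_id T hP _)

theorem psiBijective_of_twistableCover (T : TwistableCover j) : PsiBijective G j := by
  refine ⟨⟨psi T, isPsi_psi T, fun ψ hψ ↦ hψ.eq (isPsi_psi T)⟩, fun ψ hψ ↦ ?_⟩
  rw [hψ.eq (isPsi_psi T)]
  have h₁ : (psi T).comp (psiInv T) = AddMonoidHom.id (RelK0 G j) := RelK0.hom_ext fun t ↦ by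
    change psi T (psiInv T (RelK0.mk G j t)) = _
    rw [psiInv_mk, psi_tripleClass]
    rfl
  have h₂ : (psiInv T).comp (psi T) = AddMonoidHom.id (K0T G j) := K0.hom_ext _ (psiInv_psi_mk T)
  exact Function.bijective_iff_has_inverse.mpr
    ⟨psiInv T, fun x ↦ congr($h₂ x), fun x ↦ congr($h₁ x)⟩

end Inverse

end

/-! ### The affine case -/

section

theorem IsLocalization.comap_ringEquiv {A B A' B' : Type*} [CommRing A] [CommRing B] [CommRing A']
    [CommRing B'] [Algebra A B] [Algebra A' B'] (S : Submonoid A') [IsLocalization S B']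
    (e : A ≃+* A') (e' : B ≃+* B') (h : ∀ a, e' (algebraMap A B a) = algebraMap A' B' (e a)) :
    IsLocalization (S.comap e) B := by
  refine (isLocalization_iff _ _).mpr ⟨fun ⟨y, hy⟩ ↦ ?_, fun z ↦ ?_, fun {x y} hxy ↦ ?_⟩
  · rw [← MulEquiv.isUnit_map e', h]
    exact map_units B' (⟨e y, hy⟩ : S)
  · obtain ⟨⟨a, s⟩, ha⟩ := surj S (e' z)
    refine ⟨⟨e.symm a, e.symm s, ?_⟩, e'.injective ?_⟩
    · change e (e.symm s) ∈ S
      rw [e.apply_symm_apply]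
      exact s.2
    · change e' (z * algebraMap A B (e.symm s)) = e' (algebraMap A B (e.symm a))
      rw [map_mul, h, h, e.apply_symm_apply, e.apply_symm_apply]
      exact ha
  · obtain ⟨c, hc⟩ := exists_of_eq (M := S) (S := B')
      ((h x).symm.trans ((congrArg e' hxy).trans (h y)))
    refine ⟨⟨e.symm c, ?_⟩, e.injective ?_⟩
    · change e (e.symm c) ∈ S
      rw [e.apply_symm_apply]
      exact c.2
    · change e (e.symm c * x) = e (e.symm c * y)
      rw [map_mul, map_mul, e.apply_symm_apply]
      exact hc

theorem comap_ringEquiv_le_nonZeroDivisors {A A' : Type*} [CommRing A] [CommRing A'] (e : A ≃+* A')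
    {S : Submonoid A'} (hS : S ≤ nonZeroDivisors A') : S.comap e ≤ nonZeroDivisors A := by
  intro s hs
  obtain ⟨t, ht, h⟩ := (MulEquivClass.map_nonZeroDivisors e).symm.le (hS hs)
  exact e.injective h ▸ ht

section Affine

variable {A F : Type u} [CommRing A] [CommRing F] [Algebra A F]

theorem isLocalizationOver_specMap (S : Submonoid A) [IsLocalization S F] :
    IsLocalizationOver (Spec.map (CommRingCat.ofHom (algebraMap A F))) ⊤
      (S.comap (Scheme.ΓSpecIso (.of A)).commRingCatIsoToRingEquiv) := by
  let : Algebra Γ(Spec (.of A), ⊤) Γ(Spec (.of F), ⊤) :=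
    ((Spec.map (CommRingCat.ofHom (algebraMap A F))).app ⊤).hom.toAlgebra
  refine IsLocalization.comap_ringEquiv (B := Γ(Spec (.of F), ⊤)) S _
    (Scheme.ΓSpecIso (.of F)).commRingCatIsoToRingEquiv fun a ↦ ?_
  exact congr($(Scheme.ΓSpecIso_naturality (CommRingCat.ofHom (algebraMap A F))).hom a)

/-- The twistable cover of an affine scheme given by a localization at non-zero-divisors. -/
def twistableCoverSpecMap (S : Submonoid A) (hS : S ≤ nonZeroDivisors A) [IsLocalization S F] :
    TwistableCover (Spec.map (CommRingCat.ofHom (algebraMap A F))) where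
  ι := PUnit
  V _ := ⊤
  isAffineOpen _ := isAffineOpen_top _
  iSup_eq_top := by simp
  isAffineOpen_preimage _ := isAffineOpen_top _
  S _ := S.comap (Scheme.ΓSpecIso (.of A)).commRingCatIsoToRingEquiv
  le_nonZeroDivisors _ := comap_ringEquiv_le_nonZeroDivisors _ hS
  isLocalizationOver _ := isLocalizationOver_specMap S
  exists_twist s hs := by
    have hnzd := comap_ringEquiv_le_nonZeroDivisors _ hS (hs ⟨⟩)
    -- With a single chart the denominator itself generates the required ideal.
    refine ⟨fun x ↦ Ideal.span {(Spec (.of A)).presheaf.germ ⊤ x trivial (s ⟨⟩)}, fun x ↦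
      ⟨⊤, trivial, s ⟨⟩, fun y hy ↦ ⟨germ_mem_nonZeroDivisors (isAffineOpen_top _) hnzd y hy, rfl⟩⟩,
      fun i x hx ↦ le_rfl, fun i ↦ ⟨s i, hs i, fun x hx ↦ Ideal.mem_span_singleton_self _⟩⟩

theorem psiBijective_specMap (G : Type v) [Group G] [IsNoetherianRing A] (S : Submonoid A)
    (hS : S ≤ nonZeroDivisors A) [IsLocalization S F] :
    PsiBijective G (Spec.map (CommRingCat.ofHom (algebraMap A F))) :=
  have : IsNoetherianRing (CommRingCat.of A) := ‹_›
  psiBijective_of_twistableCover (twistableCoverSpecMap S hS)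

end Affine

end

/-! ### The case of an open immersion -/

section

variable {X : Scheme.{u}}

/-- The stalk of an ideal sheaf. -/
def stalkIdeal (I : X.IdealSheafData) (x : X) : Ideal (X.presheaf.stalk x) :=
  ⨆ (V : X.affineOpens) (hx : x ∈ V.1), (I.ideal V).map (X.presheaf.germ V.1 x hx).hom

/-- Any other affine neighbourhood is compared with `V` on a smaller affine open contained in both,
where the ideal is generated by the restriction of `f`. -/
theorem stalkIdeal_eq_span {I : X.IdealSheafData} {V : X.affineOpens} {f : Γ(X, V)}
    (h : I.ideal V = Ideal.span {f}) {x : X} (hx : x ∈ V.1) :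
    stalkIdeal I x = Ideal.span {X.presheaf.germ V.1 x hx f} := by
  refine le_antisymm (iSup₂_le fun V' hx' ↦ Ideal.map_le_iff_le_comap.mpr fun s hs ↦ ?_) ?_
  · obtain ⟨W, hW, hxW, hle⟩ := X.isBasis_affineOpens.exists_subset_of_mem_open
      (show x ∈ V.1 ⊓ V'.1 from ⟨hx, hx'⟩) (V.1 ⊓ V'.1).2
    obtain ⟨W, hW, rfl⟩ := hW
    have hWV : (⟨W, hW⟩ : X.affineOpens) ≤ V := fun y hy ↦ (hle hy).1
    have hWV' : (⟨W, hW⟩ : X.affineOpens) ≤ V' := fun y hy ↦ (hle hy).2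
    have hs' := Ideal.mem_map_of_mem (X.presheaf.map (homOfLE hWV').op).hom hs
    rw [I.map_ideal hWV', ← I.map_ideal hWV, h, Ideal.map_span, Set.image_singleton] at hs'
    have := Ideal.mem_map_of_mem (X.presheaf.germ W x hxW).hom hs'
    rw [Ideal.map_span, Set.image_singleton] at this
    have h₁ := X.presheaf.germ_res_apply (homOfLE hWV') x hxW s
    have h₂ := X.presheaf.germ_res_apply (homOfLE hWV) x hxW f
    refine (congrArg₂ (fun a b ↦ a ∈ Ideal.span {b}) h₁ h₂).mp this
  · rw [Ideal.span_singleton_le_iff_mem]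
    exact Ideal.mem_iSup_of_mem V (Ideal.mem_iSup_of_mem hx
      (Ideal.mem_map_of_mem _ (h ▸ Ideal.mem_span_singleton_self f)))

section OpenImmersion

variable {U : Scheme.{u}} (j : U ⟶ X) [IsOpenImmersion j]

theorem preimage_eq_preimage_basicOpen {V : X.Opens} {f : Γ(X, V)}
    (h : V ⊓ j.opensRange ≤ X.basicOpen f) : j ⁻¹ᵁ V = j ⁻¹ᵁ X.basicOpen f :=
  le_antisymm (fun y hy ↦ h ⟨hy, y, rfl⟩) fun _ hy ↦ X.basicOpen_le f hy

theorem isAffineOpen_preimage_of_basicOpen {V : X.Opens} (hV : IsAffineOpen V) {f : Γ(X, V)}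
    (h : V ⊓ j.opensRange = X.basicOpen f) : IsAffineOpen (j ⁻¹ᵁ V) := by
  rw [preimage_eq_preimage_basicOpen j h.le]
  exact (hV.basicOpen f).preimage_of_isOpenImmersion j (h.ge.trans inf_le_right)

theorem isLocalizationOver_of_basicOpen {V : X.Opens} (hV : IsAffineOpen V) {f : Γ(X, V)}
    (h : V ⊓ j.opensRange = X.basicOpen f) : IsLocalizationOver j V (.powers f) := by
  let : Algebra Γ(X, V) Γ(U, j ⁻¹ᵁ V) := (j.app V).hom.toAlgebra
  have := hV.isLocalization_basicOpen f
  have : IsIso (j.app (X.basicOpen f)) := j.isIso_app _ (h.ge.trans inf_le_right)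
  let e := U.presheaf.mapIso (eqToIso (preimage_eq_preimage_basicOpen j h.le)).op.symm ≪≫
    (asIso (j.app (X.basicOpen f))).symm
  refine IsLocalization.comap_ringEquiv (B := Γ(U, j ⁻¹ᵁ V)) (.powers f) (RingEquiv.refl _)
    e.commRingCatIsoToRingEquiv fun a ↦ ?_
  have : j.app V ≫ e.hom = X.presheaf.map (homOfLE (X.basicOpen_le f)).op := by
    simp only [e, Iso.trans_hom, Iso.symm_hom, asIso_inv, ← Category.assoc, IsIso.comp_inv_eq]
    exact (j.naturality (homOfLE (X.basicOpen_le f)).op).symm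
  exact congr($(this).hom a)

end OpenImmersion

theorem inf_opensRange_eq_basicOpen {U : Scheme.{u}} (j : U ⟶ X) [IsOpenImmersion j]
    {I : X.IdealSheafData} (hI : (I.support : Set X) = (Set.range j)ᶜ) {V : X.affineOpens}
    {f : Γ(X, V)} (h : I.ideal V = Ideal.span {f}) : V.1 ⊓ j.opensRange = X.basicOpen f := by
  have key (x) (hx : x ∈ V.1) : x ∈ Set.range j ↔ x ∈ X.basicOpen f := by
    rw [← not_iff_not]
    have := I.mem_support_iff_of_mem hx
    rw [h, Scheme.zeroLocus_span] at this
    rw [← Set.mem_compl_iff, ← hI]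
    refine this.trans ?_
    simp
  ext x
  exact ⟨fun hx ↦ (key x hx.1).mp hx.2, fun hx ↦
    ⟨X.basicOpen_le f hx, (key x (X.basicOpen_le f hx)).mpr hx⟩⟩

theorem exists_fintype_cover [CompactSpace X] (V : X → X.Opens) (hV : ∀ x, x ∈ V x) :
    ∃ t : Finset X, ⨆ i : t, V i = ⊤ := by
  obtain ⟨t, ht⟩ := CompactSpace.elim_nhds_subcover (fun x ↦ (V x : Set X)) fun x ↦
    (V x).2.mem_nhds (hV x)
  refine ⟨t, top_le_iff.mp fun x _ ↦ ?_⟩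
  obtain ⟨i, hi, hx⟩ := Set.mem_iUnion₂.mp (ht.ge (Set.mem_univ x) : x ∈ _)
  exact TopologicalSpace.Opens.mem_iSup.mpr ⟨⟨i, hi⟩, hx⟩

/-- On each chart `U` is the basic open subset of a generator of `I`, so denominators are powers of
generators. A power of `I` with the largest exponent, which exists because the cover is finite, is
contained in all the ideals they generate. -/
theorem nonempty_twistableCover_of_isOpenImmersion [CompactSpace X] {U : Scheme.{u}} (j : U ⟶ X)
    [IsOpenImmersion j] {I : X.IdealSheafData} (hI : (I.support : Set X) = (Set.range j)ᶜ)
    (h : IsLocallyGeneratedByNonZeroDivisor I) : Nonempty (TwistableCover j) := by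
  choose V hxV f hf hIf using h
  obtain ⟨t, ht⟩ := exists_fintype_cover (fun x ↦ (V x).1) hxV
  have hr (i : X) := inf_opensRange_eq_basicOpen j hI (hIf i)
  refine ⟨⟨t, fun i ↦ V i, fun i ↦ (V i).2, ht,
    fun i ↦ isAffineOpen_preimage_of_basicOpen j (V i).2 (hr i), fun i ↦ .powers (f i),
    fun i ↦ Submonoid.powers_le.mpr (hf i),
    fun i ↦ isLocalizationOver_of_basicOpen j (V i).2 (hr i), fun s hs ↦ ?_⟩⟩
  choose n hn using hs
  have hD (N : ℕ) (i : X) (x : X) (hx : x ∈ (V i).1) :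
      stalkIdeal I x ^ N = Ideal.span {X.presheaf.germ _ x hx (f i ^ N)} := by
    rw [stalkIdeal_eq_span (hIf i) hx, Ideal.span_singleton_pow, map_pow]
  refine ⟨fun x ↦ stalkIdeal I x ^ (Finset.univ.sup n), fun x ↦ ?_, fun i x hx ↦ ?_, fun i ↦ ?_⟩
  · exact ⟨(V x).1, hxV x, f x ^ (Finset.univ.sup n), fun y hy ↦
      ⟨germ_mem_nonZeroDivisors (V x).2 (pow_mem (hf x) _) y hy, hD _ x y hy⟩⟩
  · have : stalkIdeal I x ^ n i = Ideal.span {X.presheaf.germ _ x hx (s i)} := by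
      rw [hD _ i x hx]
      exact congrArg (fun a ↦ Ideal.span {X.presheaf.germ _ x hx a}) (hn i)
    rw [← this]
    exact Ideal.pow_le_pow_right (Finset.le_sup (Finset.mem_univ i))
  · refine ⟨f i ^ (Finset.univ.sup n), ⟨_, rfl⟩, fun x hx ↦ ?_⟩
    exact (hD _ i x hx).ge (Ideal.mem_span_singleton_self _)

end

/-! ### Regular local rings and spaces of dimension at most one -/

section

section RegularLocalRing

variable (R : Type*) [CommRing R] [IsRegularLocalRing R]

open IsLocalRing

/-- A minimal prime `p` is shown to be zero. If it is maximal, the dimension is zero and regularity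
makes the maximal ideal zero. Otherwise the maximal ideal is generated by some `π` outside `p`, so
`p` equals its product with the maximal ideal, and Nakayama applies. -/
theorem isDomain_of_ringKrullDim_le_one (h : ringKrullDim R ≤ 1) : IsDomain R := by
  have hfg := (isNoetherianRing_iff_ideal_fg R).mp inferInstance (maximalIdeal R)
  have hrk : (maximalIdeal R).spanFinrank = ringKrullDim R :=
    IsRegularLocalRing.spanFinrank_maximalIdeal
  obtain ⟨p, hp, hpm⟩ := Ideal.exists_minimalPrimes_le (bot_le (a := maximalIdeal R))
  have hprime : p.IsPrime := hp.1.1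
  suffices hbot : p = ⊥ by
    rw [hbot] at hprime
    exact IsDomain.of_bot_isPrime R
  by_cases hpm' : p = maximalIdeal R
  · have hht : (maximalIdeal R).height = 0 := Ideal.height_eq_zero_iff.mpr (hpm' ▸ hp)
    have := maximalIdeal_height_eq_ringKrullDim (R := R)
    rw [hht, ← hrk] at this
    rw [hpm']
    exact (Submodule.spanFinrank_eq_zero_iff_eq_bot hfg).mp (by exact_mod_cast this.symm)
  · have hle : (maximalIdeal R).spanFinrank ≤ 1 := by
      rw [← hrk] at h
      exact_mod_cast h
    have hpr : (maximalIdeal R).IsPrincipal := by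
      obtain h0 | h1 := Nat.le_one_iff_eq_zero_or_eq_one.mp hle
      · rw [(Submodule.spanFinrank_eq_zero_iff_eq_bot hfg).mp h0]
        exact bot_isPrincipal
      · exact ((Submodule.spanFinrank_eq_one_iff _).mp h1).1
    obtain ⟨π, hπ⟩ := hpr
    have hπp : π ∉ p := fun hmem ↦ hpm' (le_antisymm hpm (hπ.trans_le
      ((Ideal.span_singleton_le_iff_mem _).mpr hmem)))
    refine Submodule.eq_bot_of_le_smul_of_le_jacobson_bot (maximalIdeal R) p
      ((isNoetherianRing_iff_ideal_fg R).mp inferInstance p) (fun x hx ↦ ?_)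
      (maximalIdeal_le_jacobson _)
    obtain ⟨y, rfl⟩ := Ideal.mem_span_singleton'.mp (hπ.le (hpm hx))
    have hy : y ∈ p := (hprime.mem_or_mem hx).resolve_right hπp
    rw [mul_comm, ← smul_eq_mul]
    exact Submodule.smul_mem_smul (hπ.ge (Ideal.mem_span_singleton_self π)) hy

end RegularLocalRing

section Topology

open TopologicalSpace

variable {X : Type*} [TopologicalSpace X] [T0Space X]

/-- A proper irreducible closed subset lies below the whole space and is therefore minimal. All its
points then have the same closure, and the T0 axiom identifies them. -/
theorem subsingleton_of_topologicalKrullDim_le_one [IrreducibleSpace X]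
    (h : topologicalKrullDim X ≤ 1) {Z : Set X} (hZ : IsClosed Z) (hirr : IsIrreducible Z)
    (hne : Z ≠ Set.univ) : Z.Subsingleton := by
  let z : IrreducibleCloseds X := ⟨Z, hirr, hZ⟩
  let t : IrreducibleCloseds X := ⟨Set.univ, IrreducibleSpace.isIrreducible_univ X, isClosed_univ⟩
  have hmin : IsMin z := by
    refine (Order.krullDim_le_one_iff.mp h z).resolve_right fun hmax ↦ hne ?_
    have hzt : z ≤ t := Set.subset_univ Z
    exact Set.univ_subset_iff.mp (hmax hzt)
  have hcl (x) (hx : x ∈ Z) : closure {x} = Z := by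
    let c : IrreducibleCloseds X := ⟨closure {x}, isIrreducible_singleton.closure, isClosed_closure⟩
    have hcz : c ≤ z := closure_minimal (Set.singleton_subset_iff.mpr hx) hZ
    exact Set.Subset.antisymm hcz (hmin hcz)
  intro x hx y hy
  exact (inseparable_iff_closure_eq.mpr ((hcl x hx).trans (hcl y hy).symm)).eq

theorem finite_of_topologicalKrullDim_le_one [IrreducibleSpace X] [NoetherianSpace X]
    (h : topologicalKrullDim X ≤ 1) {Z : Set X} (hZ : IsClosed Z) (hne : Z ≠ Set.univ) :
    Z.Finite := by
  obtain ⟨S, hfin, hcl, hirr, hS⟩ := NoetherianSpace.exists_finite_set_isClosed_irreducible hZ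
  rw [hS]
  refine hfin.sUnion fun Y hY ↦ (subsingleton_of_topologicalKrullDim_le_one h (hcl Y hY)
    (hirr Y hY) fun hu ↦ hne ?_).finite
  exact Set.univ_subset_iff.mp (hu ▸ hS ▸ Set.subset_sUnion_of_mem hY)

theorem isClosed_of_topologicalKrullDim_le_one [IrreducibleSpace X] [NoetherianSpace X]
    (h : topologicalKrullDim X ≤ 1) {Z Y : Set X} (hZ : IsClosed Z) (hne : Z ≠ Set.univ)
    (hY : Y ⊆ Z) : IsClosed Y := by
  have hfin := (finite_of_topologicalKrullDim_le_one h hZ hne).subset hY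
  rw [← Set.biUnion_of_singleton Y]
  refine hfin.isClosed_biUnion fun y hy ↦ ?_
  have hle : closure {y} ⊆ Z := closure_minimal (Set.singleton_subset_iff.mpr (hY hy)) hZ
  have hsub := subsingleton_of_topologicalKrullDim_le_one h (isClosed_closure (s := {y}))
    isIrreducible_singleton.closure fun hu ↦ hne (Set.univ_subset_iff.mp (hu ▸ hle))
  rw [← hsub.eq_singleton_of_mem (subset_closure rfl)]
  exact isClosed_closure

end Topology

instance isIntegral_of_isDedekindScheme (X : Scheme.{u}) [IsDedekindScheme X] :
    AlgebraicGeometry.IsIntegral X := by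
  have (x : X) : _root_.IsReduced (X.presheaf.stalk x) := by
    have := IsDedekindScheme.regular x
    have : IsDomain (X.presheaf.stalk x) := by
      refine isDomain_of_ringKrullDim_le_one _ ?_
      rw [← PrimeSpectrum.topologicalKrullDim_eq_ringKrullDim,
        ← IsDedekindScheme.dim_eq_one (X := X)]
      -- The spectrum of a local ring embeds topologically in `X`, so its dimension is at most one.
      exact (X.fromSpecStalk x).isEmbedding.isInducing.topologicalKrullDim_le
    infer_instance
  have : AlgebraicGeometry.IsReduced X := isReduced_of_isReduced_stalk X
  exact (isIntegral_iff_irreducibleSpace_and_isReduced X).mpr ⟨inferInstance, this⟩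

end

/-! ### The case of a Dedekind scheme -/

section

section InvertibleFamily

variable {X : Scheme.{u}}

theorem IsInvertibleFamily.top : IsInvertibleFamily fun x : X ↦ (⊤ : Ideal (X.presheaf.stalk x)) :=
  fun _ ↦ ⟨⊤, trivial, 1, fun y hy ↦ by
    rw [map_one]
    exact ⟨one_mem _, Ideal.span_singleton_one.symm⟩⟩

theorem IsInvertibleFamily.mul {D E : ∀ x : X, Ideal (X.presheaf.stalk x)}
    (hD : IsInvertibleFamily D) (hE : IsInvertibleFamily E) :
    IsInvertibleFamily fun x ↦ D x * E x := by
  intro x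
  obtain ⟨W, hxW, f, hf⟩ := hD x
  obtain ⟨W', hxW', f', hf'⟩ := hE x
  refine ⟨W ⊓ W', ⟨hxW, hxW'⟩, X.presheaf.map (homOfLE inf_le_left).op f *
    X.presheaf.map (homOfLE inf_le_right).op f', fun y hy ↦ ?_⟩
  have h₁ := X.presheaf.germ_res_apply (homOfLE (inf_le_left : W ⊓ W' ≤ W)) y hy f
  have h₂ := X.presheaf.germ_res_apply (homOfLE (inf_le_right : W ⊓ W' ≤ W')) y hy f'
  rw [map_mul, h₁, h₂]
  refine ⟨mul_mem (hf y hy.1).1 (hf' y hy.2).1, ?_⟩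
  change D y * E y = _
  rw [(hf y hy.1).2, (hf' y hy.2).2, Ideal.span_singleton_mul_span_singleton]

theorem IsInvertibleFamily.prod {ι : Type*} (s : Finset ι)
    {D : ι → ∀ x : X, Ideal (X.presheaf.stalk x)} (hD : ∀ i, IsInvertibleFamily (D i)) :
    IsInvertibleFamily fun x ↦ ∏ i ∈ s, D i x := by
  classical
  induction s using Finset.induction_on with
  | empty =>
    simp only [Finset.prod_empty, Ideal.one_eq_top]
    exact .top
  | insert a s ha ih =>
    simp only [Finset.prod_insert ha]
    exact (hD a).mul ih

open Classical in
/-- The ideals generated by a section on an open subset, and the unit ideal at the other points. -/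
def extendSpan {V : X.Opens} (s : Γ(X, V)) (x : X) : Ideal (X.presheaf.stalk x) :=
  if hx : x ∈ V then Ideal.span {X.presheaf.germ V x hx s} else ⊤

theorem extendSpan_of_mem {V : X.Opens} (s : Γ(X, V)) {x : X} (hx : x ∈ V) :
    extendSpan s x = Ideal.span {X.presheaf.germ V x hx s} := dif_pos hx

theorem extendSpan_of_notMem {V : X.Opens} (s : Γ(X, V)) {x : X}
    (hx : x ∈ V → x ∈ X.basicOpen s) : extendSpan s x = ⊤ := by
  by_cases h : x ∈ V
  · rw [extendSpan_of_mem s h, Ideal.span_singleton_eq_top]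
    exact (X.mem_basicOpen s x h).mp (hx h)
  · exact dif_neg h

end InvertibleFamily

section Dedekind

variable {X : Scheme.{u}} [IsDedekindScheme X]

theorem germ_ne_zero {V : X.Opens} {s : Γ(X, V)} (hs : s ∈ nonZeroDivisors Γ(X, V)) (x : X)
    (hx : x ∈ V) : X.presheaf.germ V x hx s ≠ 0 := by
  have : Nonempty V := ⟨⟨x, hx⟩⟩
  intro h
  exact nonZeroDivisors.ne_zero hs (germ_injective_of_isIntegral X x hx (h.trans (map_zero _).symm))

theorem compl_basicOpen_ne_univ {V : X.Opens} [Nonempty V] {s : Γ(X, V)}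
    (hs : s ∈ nonZeroDivisors Γ(X, V)) : ((X.basicOpen s : Set X)ᶜ) ≠ Set.univ := by
  intro h
  have : X.basicOpen s = ⊥ := by
    ext1
    exact Set.compl_univ_iff.mp h
  exact nonZeroDivisors.ne_zero hs ((basicOpen_eq_bot_iff s).mp this)

/-- The zeros of `s` in `V` form a closed subset of all of `X`, since every subset of a proper
closed set is closed. Away from them the constant section 1 generates the family. -/
theorem isInvertibleFamily_extendSpan {V : X.Opens} {s : Γ(X, V)}
    (hs : s ∈ nonZeroDivisors Γ(X, V)) : IsInvertibleFamily (extendSpan s) := by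
  intro x
  by_cases hx : x ∈ V
  · exact ⟨V, hx, s, fun y hy ↦ ⟨mem_nonZeroDivisors_of_ne_zero (germ_ne_zero hs y hy),
      extendSpan_of_mem s hy⟩⟩
  · have hcl : IsClosed ((V : Set X) \ X.basicOpen s) := by
      obtain hV | hV := isEmpty_or_nonempty V
      · have : (V : Set X) = ∅ := Set.isEmpty_coe_sort.mp hV
        rw [this, Set.empty_sdiff]
        exact isClosed_empty
      · exact isClosed_of_topologicalKrullDim_le_one IsDedekindScheme.dim_eq_one.le
          (X.basicOpen s).2.isClosed_compl (compl_basicOpen_ne_univ hs) fun y hy ↦ hy.2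
    refine ⟨⟨_, hcl.isOpen_compl⟩, fun h ↦ hx h.1, 1, fun y hy ↦ ?_⟩
    rw [map_one, Ideal.span_singleton_one]
    exact ⟨one_mem _, extendSpan_of_notMem s fun hyV ↦ by_contra fun h ↦ hy ⟨hyV, h⟩⟩

/-- The germ of `s` is a fraction of sections over `V` whose denominator is a unit at `x`; its
numerator serves as `t`. -/
theorem exists_germ_mem_span {V W : X.Opens} (hV : IsAffineOpen V) {s : Γ(X, W)}
    (hs : s ∈ nonZeroDivisors Γ(X, W)) (x : X) (hx : x ∈ V) :
    ∃ t ∈ nonZeroDivisors Γ(X, V), X.presheaf.germ V x hx t ∈ extendSpan s x := by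
  have : Nonempty V := ⟨⟨x, hx⟩⟩
  by_cases hxW : x ∈ W
  · let _ := (X.presheaf.germ V x hx).hom.toAlgebra
    have := hV.isLocalization_stalk ⟨x, hx⟩
    obtain ⟨⟨a, b⟩, hab⟩ := IsLocalization.surj (hV.primeIdealOf ⟨x, hx⟩).asIdeal.primeCompl
      (X.presheaf.germ W x hxW s)
    have hu := IsLocalization.map_units (X.presheaf.stalk x) b
    refine ⟨a, mem_nonZeroDivisors_of_ne_zero fun h0 ↦ ?_, ?_⟩
    · rw [h0, map_zero] at hab
      exact germ_ne_zero hs x hxW ((hu.mul_left_eq_zero).mp hab)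
    · rw [extendSpan_of_mem s hxW]
      exact Ideal.mem_span_singleton'.mpr ⟨_, (mul_comm _ _).trans hab⟩
  · exact ⟨1, one_mem _, by rw [extendSpan_of_notMem s fun h ↦ absurd h hxW]; trivial⟩

/-- Only finitely many points lie outside the basic open subset of `s`; the product of the pointwise
choices over them satisfies the condition everywhere. -/
theorem exists_forall_germ_mem_span {V W : X.Opens} (hV : IsAffineOpen V) {s : Γ(X, W)}
    (hs : s ∈ nonZeroDivisors Γ(X, W)) : ∃ t ∈ nonZeroDivisors Γ(X, V), ∀ (x : X) (hx : x ∈ V),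
      X.presheaf.germ V x hx t ∈ extendSpan s x := by
  obtain hW | hW := isEmpty_or_nonempty W
  · exact ⟨1, one_mem _, fun x hx ↦ by
      rw [extendSpan_of_notMem s fun h ↦ (hW.false ⟨x, h⟩).elim]; trivial⟩
  have hfin := finite_of_topologicalKrullDim_le_one (X := X) IsDedekindScheme.dim_eq_one.le
    (X.basicOpen s).2.isClosed_compl (compl_basicOpen_ne_univ hs)
  have h (x : X) : ∃ t ∈ nonZeroDivisors Γ(X, V), ∀ hx : x ∈ V,
      X.presheaf.germ V x hx t ∈ extendSpan s x := by
    by_cases hx : x ∈ V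
    · obtain ⟨t, ht, h⟩ := exists_germ_mem_span hV hs x hx
      exact ⟨t, ht, fun _ ↦ h⟩
    · exact ⟨1, one_mem _, fun h ↦ absurd h hx⟩
  choose t ht htx using h
  refine ⟨∏ z ∈ hfin.toFinset, t z, prod_mem fun z _ ↦ ht z, fun x hx ↦ ?_⟩
  by_cases hxs : x ∈ X.basicOpen s
  · rw [extendSpan_of_notMem s fun _ ↦ hxs]
    trivial
  · rw [map_prod]
    exact Ideal.mem_of_dvd _ (Finset.dvd_prod_of_mem _ (hfin.mem_toFinset.mpr hxs)) (htx x hx)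

variable (X) in
-- Points in the image specialize to the generic point, so they lie in every open set containing it.
theorem preimage_fromSpecStalk_genericPoint (V : X.Opens) [hV : Nonempty V] :
    X.fromSpecStalk (genericPoint X) ⁻¹ᵁ V = ⊤ := by
  refine top_le_iff.mp fun y _ ↦ ?_
  have hy : X.fromSpecStalk (genericPoint X) y ⤳ genericPoint X :=
    Scheme.range_fromSpecStalk.le ⟨y, rfl⟩
  exact hy.mem_open V.2 (((genericPoint_spec X).mem_open_set_iff V.2).mpr (by
    simpa using ⟨hV.some.1, hV.some.2⟩))

theorem isLocalizationOver_fromSpecStalk_genericPoint {V : X.Opens} (hV : IsAffineOpen V)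
    [Nonempty V] :
    IsLocalizationOver (X.fromSpecStalk (genericPoint X)) V (nonZeroDivisors Γ(X, V)) := by
  let j := X.fromSpecStalk (genericPoint X)
  let : Algebra Γ(X, V) Γ(Spec X.functionField, j ⁻¹ᵁ V) := (j.app V).hom.toAlgebra
  have := functionField_isFractionRing_of_isAffineOpen X V hV
  let e := (Spec X.functionField).presheaf.mapIso
    (eqToIso (preimage_fromSpecStalk_genericPoint X V)).op.symm ≪≫ Scheme.ΓSpecIso X.functionField
  refine IsLocalization.comap_ringEquiv (B := Γ(Spec X.functionField, j ⁻¹ᵁ V))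
    (nonZeroDivisors Γ(X, V)) (B' := X.functionField) (RingEquiv.refl _)
    e.commRingCatIsoToRingEquiv fun a ↦ ?_
  have : j.app V ≫ e.hom = X.germToFunctionField V := by
    have hη : genericPoint X ∈ V := ((genericPoint_spec X).mem_open_set_iff V.2).mpr (by
      simpa using ‹Nonempty V›)
    have h (f : Opposite.op (⊤ : (Spec X.functionField).Opens) ⟶ .op ⊤) :
        (Spec X.functionField).presheaf.map f = 𝟙 _ :=
      (congrArg _ (Subsingleton.elim f (𝟙 _))).trans ((Spec X.functionField).presheaf.map_id _)
    simp only [e, j, Scheme.fromSpecStalk_app hη, Iso.trans_hom, Category.assoc, Functor.mapIso_hom]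
    rw [← Functor.map_comp_assoc, h, Category.id_comp, Iso.inv_hom_id]
    exact Category.comp_id _
  exact congr($(this).hom a)

variable (X) in
theorem nonempty_twistableCover_fromSpecStalk :
    Nonempty (TwistableCover (X.fromSpecStalk (genericPoint X))) := by
  have h (x : X) : ∃ V : X.Opens, IsAffineOpen V ∧ x ∈ V := by
    obtain ⟨_, ⟨V, hV, rfl⟩, hxV, -⟩ :=
      X.isBasis_affineOpens.exists_subset_of_mem_open (Set.mem_univ x) isOpen_univ
    exact ⟨V, hV, hxV⟩
  choose V hV hxV using h
  obtain ⟨t, ht⟩ := exists_fintype_cover V hxV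
  have (i : X) : Nonempty (V i) := ⟨⟨i, hxV i⟩⟩
  refine ⟨⟨t, fun i ↦ V i, fun i ↦ hV i, ht, fun i ↦ ?_, fun i ↦ nonZeroDivisors _,
    fun i ↦ le_rfl, fun i ↦ isLocalizationOver_fromSpecStalk_genericPoint (hV i),
    -- A product of ideals lies in each factor, so multiplying the extended ideals of all charts
    -- dominates every denominator at once.
    fun s hs ↦ ⟨fun x ↦ ∏ i, extendSpan (s i) x,
      IsInvertibleFamily.prod _ fun i ↦ isInvertibleFamily_extendSpan (hs i), fun i x hx ↦ ?_, fun i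
          ↦ ?_⟩⟩⟩
  · rw [preimage_fromSpecStalk_genericPoint]
    exact isAffineOpen_top _
  · rw [← extendSpan_of_mem (s i) hx]
    exact Ideal.prod_le_inf.trans (Finset.inf_le (Finset.mem_univ i))
  · choose a ha hmem using fun l ↦ exists_forall_germ_mem_span (hV i) (hs l)
    refine ⟨∏ l, a l, prod_mem fun l _ ↦ ha l, fun x hx ↦ ?_⟩
    rw [map_prod]
    exact Ideal.prod_mem_prod fun l _ ↦ hmem l x hx

end Dedekind

end

theorem proposition1p7 (G : Type v) [Group G] [Finite G] :
    -- localization of an affine scheme at non-zero-divisors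
    (∀ (A F : Type u) [CommRing A] [IsNoetherianRing A] [CommRing F] [Algebra A F]
      (S : Submonoid A), S ≤ nonZeroDivisors A → IsLocalization S F →
      PsiBijective G (Spec.map (CommRingCat.ofHom (algebraMap A F)))) ∧
    -- open immersion whose complement has an ideal locally generated by a non-zero-divisor
    (∀ (X : Scheme.{u}) (F : CommRingCat.{u}) (j : Spec F ⟶ X),
      AlgebraicGeometry.IsNoetherian X → IsOpenImmersion j →
      ∀ I : X.IdealSheafData, (I.support : Set X) = (Set.range j)ᶜ →
      IsLocallyGeneratedByNonZeroDivisor I → PsiBijective G j) ∧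
    -- generic point of a Dedekind scheme
    (∀ (X : Scheme.{u}) [IsDedekindScheme X],
      PsiBijective G (X.fromSpecStalk (genericPoint X) : Spec X.functionField ⟶ X)) := by
  refine ⟨fun A F _ _ _ _ S hS _ ↦ psiBijective_specMap G S hS, fun X F j _ _ I hI h ↦ ?_,
    fun X _ ↦ ?_⟩
  · obtain ⟨T⟩ := nonempty_twistableCover_of_isOpenImmersion j hI h
    exact psiBijective_of_twistableCover T
  · obtain ⟨T⟩ := nonempty_twistableCover_fromSpecStalk X
    exact psiBijective_of_twistableCover T

end
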